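/- Let $\mathcal X,\mathcal Y_1,\mathcal Y_2$ be finite alphabets, let $P_{XY_1Y_2}$ be a probability mass function on $\mathcal X\times\mathcal Y_1\times\mathcal Y_2$, with marginals $P_X$ and $P_{Y_1Y_2}$, and let $R_0,R_1,R_2\ge 0$. All logarithms are to base $2$, with $\log 0=-\infty$. Testing against independence over a Gray–Wyner network. Under hypothesis $\mathcal H=0$ the triple $(X^n,Y_1^n,Y_2^n)$ is i.i.d. with law $P_{XY_1Y_2}$; under $\mathcal H=1$ it is i.i.d. with law $P_XP_{Y_1Y_2}$. For a blocklength $n$ and a rate $R$ let $\mathcal M^{(n)}(R)=\{0,1,\dots,\lfloor 2^{nR}\rfloor\}$. A transmitter observing $X^n$ produces messages $(M_0,M_1,M_2)=\phi^{(n)}(X^n)\in \mathcal M^{(n)}(R_0)\times\mathcal M^{(n)}(R_1)\times\mathcal M^{(n)}(R_2)$ by a possibly stochastic encoder $\phi^{(n)}$, whose randomness is independent of the sources. For $i\in\{1,2\}$, Receiver $i$ observes $(Y_i^n,M_0,M_i)$ and decides $\hat{\mathcal H}_i=g_i^{(n)}(Y_i^n,M_0,M_i)\in\{0,1\}$ by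 a deterministic function $g_i^{(n)}$. Put $\alpha_{i,n}=\Pr[\hat{\mathcal H}_i=1\mid\mathcal H=0]$ and $\beta_{i,n}=\Pr[\hat{\mathcal H}_i=0\mid\mathcal H=1]$. For $\epsilon\in(0,1)$, the tuple $(\theta_1,\theta_2,R_0,R_1,R_2)$ is $\epsilon$-achievable if there is a sequence $(\phi^{(n)},g_1^{(n)},g_2^{(n)})_{n\ge1}$ such that, for both $i\in\{1,2\}$, $\alpha_{i,n}\le\epsilon$ for all $n\ge 1$ and $-\varlimsup_{n\to\infty}\frac1n\log\beta_{i,n}\ge\theta_i$. The exponents region $\mathcal E_{\mathrm{GW}}(R_0,R_1,R_2)$ is the closure of the set of all pairs $(\theta_1,\theta_2)$ with $\theta_1,\theta_2\ge0$ for which $(\theta_1,\theta_2,R_0,R_1,R_2)$ is $\epsilon$-achievable for every $\epsilon\in(0,1)$. Theorem. $\mathcal E_{\mathrm{GW}}(R_0,R_1,R_2)$ is the set of all pairs $(\theta_1,\theta_2)$ of nonnegative real numbers such that $$\theta_1\le I(U_0,U_1;Y_1),\qquad \theta_2\le I(U_0,U_2;Y_2)$$ for some auxiliary random variables $U_0,U_1,U_2$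 with finite alphabets, defined jointly with $(X,Y_1,Y_2)\sim P_{XY_1Y_2}$, that satisfy the Markov chain $(U_0,U_1,U_2)\to X\to(Y_1,Y_2)$ and the rate constraints $$R_0\ge I(U_0;X),\qquad R_1\ge I(U_1;X\mid U_0),\qquad R_2\ge I(U_2;X\mid U_0).$$ -/

import Mathlib

open Filter

namespace GrayWyner

noncomputable section

/-! ### Finite probability: events, laws of random variables, information measures

A probability mass function on a finite type `Ω` is an element of `stdSimplex ℝ Ω`; a random
variable on the finite probability space `(Ω, p)` is a function on `Ω`. -/

/-- Probability of the event `E` under the pmf `p`. -/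
def prob {Ω : Type*} [Fintype Ω] (p : Ω → ℝ) (E : Set Ω) : ℝ :=
  ∑ ω, E.indicator p ω

/-- The pmf of the random variable `A` under `p`. -/
def law {Ω α : Type*} [Fintype Ω] (p : Ω → ℝ) (A : Ω → α) (a : α) : ℝ :=
  prob p {ω | A ω = a}

/-- Mutual information `I(A;B)`, in bits. Terms with `P_{AB}(a,b) = 0` vanish; in all other terms
the denominator is positive. -/
def mutualInfo {Ω α β : Type*} [Fintype Ω] [Fintype α] [Fintype β] (p : Ω → ℝ)
    (A : Ω → α) (B : Ω → β) : ℝ :=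
  ∑ a, ∑ b, law p (fun ω => (A ω, B ω)) (a, b) *
    Real.logb 2 (law p (fun ω => (A ω, B ω)) (a, b) / (law p A a * law p B b))

/-- Conditional mutual information `I(A;B|C)`, in bits:
`∑ P(a,b,c) log (P(a,b,c) P(c) / (P(a,c) P(b,c)))`. -/
def condMutualInfo {Ω α β γ : Type*} [Fintype Ω] [Fintype α] [Fintype β] [Fintype γ] (p : Ω → ℝ)
    (A : Ω → α) (B : Ω → β) (C : Ω → γ) : ℝ :=
  ∑ a, ∑ b, ∑ c, law p (fun ω => (A ω, B ω, C ω)) (a, b, c) *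
    Real.logb 2 (law p (fun ω => (A ω, B ω, C ω)) (a, b, c) * law p C c /
      (law p (fun ω => (A ω, C ω)) (a, c) * law p (fun ω => (B ω, C ω)) (b, c)))

/-- `A → B → C` is a Markov chain: `A` and `C` are conditionally independent given `B`. -/
def IsMarkovChain {Ω α β γ : Type*} [Fintype Ω] (p : Ω → ℝ)
    (A : Ω → α) (B : Ω → β) (C : Ω → γ) : Prop :=
  ∀ a b c, law p (fun ω => (A ω, B ω, C ω)) (a, b, c) * law p B b =
    law p (fun ω => (A ω, B ω)) (a, b) * law p (fun ω => (B ω, C ω)) (b, c)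

/-! ### The operational problem -/

/-- The message set `{0, …, 2^{nR}}` of a bit pipe of rate `R` at blocklength `n`
(the integers between `0` and `2^{nR}`). -/
abbrev Msg (R : ℝ) (n : ℕ) : Type := Fin (⌊(2 : ℝ) ^ ((n : ℝ) * R)⌋₊ + 1)

/-- The single-letter law under the alternative hypothesis, `P_X P_{Y₁Y₂}`. -/
def altLaw {X Y₁ Y₂ : Type*} [Fintype X] [Fintype Y₁] [Fintype Y₂] (P : X × Y₁ × Y₂ → ℝ) :
    X × Y₁ × Y₂ → ℝ :=
  fun s => law P (fun ω => ω.1) s.1 * law P (fun ω => ω.2) s.2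

/-- A blocklength-`n` code: a stochastic encoder (`enc x` is the conditional pmf of the message
triple given `X^n = x`) and the two deterministic decision functions. -/
structure Code (X Y₁ Y₂ : Type*) (R₀ R₁ R₂ : ℝ) (n : ℕ) where
  enc : (Fin n → X) → Msg R₀ n × Msg R₁ n × Msg R₂ n → ℝ
  enc_mem : ∀ x, enc x ∈ stdSimplex ℝ (Msg R₀ n × Msg R₁ n × Msg R₂ n)
  dec₁ : (Fin n → Y₁) → Msg R₀ n → Msg R₁ n → Fin 2
  dec₂ : (Fin n → Y₂) → Msg R₀ n → Msg R₂ n → Fin 2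

/-- Outcomes `((X^n, Y₁^n, Y₂^n), (M₀, M₁, M₂))` of the experiment. -/
abbrev Outcome (X Y₁ Y₂ : Type*) (R₀ R₁ R₂ : ℝ) (n : ℕ) : Type _ :=
  ((Fin n → X) × (Fin n → Y₁) × (Fin n → Y₂)) × (Msg R₀ n × Msg R₁ n × Msg R₂ n)

namespace Code

variable {X Y₁ Y₂ : Type*} {R₀ R₁ R₂ : ℝ} {n : ℕ}

/-- Law of the outcome if the source triple is i.i.d. with single-letter law `Q` and the messages
are produced from `X^n` by the encoder. -/
def outcomeLaw (c : Code X Y₁ Y₂ R₀ R₁ R₂ n) (Q : X × Y₁ × Y₂ → ℝ) :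
    Outcome X Y₁ Y₂ R₀ R₁ R₂ n → ℝ :=
  fun ω => (∏ t, Q (ω.1.1 t, ω.1.2.1 t, ω.1.2.2 t)) * c.enc ω.1.1 ω.2

/-- The decision of receiver 1, `g₁(Y₁^n, M₀, M₁)`. -/
def decision₁ (c : Code X Y₁ Y₂ R₀ R₁ R₂ n) (ω : Outcome X Y₁ Y₂ R₀ R₁ R₂ n) : Fin 2 :=
  c.dec₁ ω.1.2.1 ω.2.1 ω.2.2.1

/-- The decision of receiver 2, `g₂(Y₂^n, M₀, M₂)`. -/
def decision₂ (c : Code X Y₁ Y₂ R₀ R₁ R₂ n) (ω : Outcome X Y₁ Y₂ R₀ R₁ R₂ n) : Fin 2 :=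
  c.dec₂ ω.1.2.2 ω.2.1 ω.2.2.2

variable [Fintype X] [Fintype Y₁] [Fintype Y₂]

/-- Type-I error probability of receiver 1. -/
def typeI₁ (c : Code X Y₁ Y₂ R₀ R₁ R₂ n) (P : X × Y₁ × Y₂ → ℝ) : ℝ :=
  prob (c.outcomeLaw P) {ω | c.decision₁ ω = 1}

/-- Type-I error probability of receiver 2. -/
def typeI₂ (c : Code X Y₁ Y₂ R₀ R₁ R₂ n) (P : X × Y₁ × Y₂ → ℝ) : ℝ :=
  prob (c.outcomeLaw P) {ω | c.decision₂ ω = 1}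

/-- Type-II error probability of receiver 1. -/
def typeII₁ (c : Code X Y₁ Y₂ R₀ R₁ R₂ n) (P : X × Y₁ × Y₂ → ℝ) : ℝ :=
  prob (c.outcomeLaw (altLaw P)) {ω | c.decision₁ ω = 0}

/-- Type-II error probability of receiver 2. -/
def typeII₂ (c : Code X Y₁ Y₂ R₀ R₁ R₂ n) (P : X × Y₁ × Y₂ → ℝ) : ℝ :=
  prob (c.outcomeLaw (altLaw P)) {ω | c.decision₂ ω = 0}

end Code

/-- Base-2 logarithm of a nonnegative real, with `log 0 = -∞`. -/
def elog₂ (b : ℝ) : EReal := if b = 0 then ⊥ else ((Real.logb 2 b : ℝ) : EReal)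

/-- The exponent `-limsup_{n → ∞} (1/n) log β_n`. -/
def exponent (β : ℕ → ℝ) : EReal :=
  -limsup (fun n : ℕ => ((1 / (n : ℝ) : ℝ) : EReal) * elog₂ (β n)) atTop

/-- `ε`-achievability of the exponents-rates tuple `(θ₁, θ₂, R₀, R₁, R₂)`. -/
def EpsAchievable {X Y₁ Y₂ : Type*} [Fintype X] [Fintype Y₁] [Fintype Y₂] (P : X × Y₁ × Y₂ → ℝ)
    (R₀ R₁ R₂ ε θ₁ θ₂ : ℝ) : Prop :=
  ∃ c : (n : ℕ) → Code X Y₁ Y₂ R₀ R₁ R₂ n,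
    (∀ n, 1 ≤ n → (c n).typeI₁ P ≤ ε ∧ (c n).typeI₂ P ≤ ε) ∧
    (θ₁ : EReal) ≤ exponent (fun n => (c n).typeII₁ P) ∧
    (θ₂ : EReal) ≤ exponent (fun n => (c n).typeII₂ P)

/-- The exponents region `E_GW(R₀, R₁, R₂)`. -/
def exponentsRegion {X Y₁ Y₂ : Type*} [Fintype X] [Fintype Y₁] [Fintype Y₂]
    (P : X × Y₁ × Y₂ → ℝ) (R₀ R₁ R₂ : ℝ) : Set (ℝ × ℝ) :=
  closure {θ | 0 ≤ θ.1 ∧ 0 ≤ θ.2 ∧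
    ∀ ε : ℝ, 0 < ε → ε < 1 → EpsAchievable P R₀ R₁ R₂ ε θ.1 θ.2}

/-! ### Auxiliary random variables -/

/-- The common probability space of `U₀, U₁, U₂, X, Y₁, Y₂`, with the auxiliary variables taking
values in finite alphabets of sizes `k₀, k₁, k₂`. -/
abbrev AuxSpace (k₀ k₁ k₂ : ℕ) (X Y₁ Y₂ : Type*) : Type _ :=
  (Fin k₀ × Fin k₁ × Fin k₂) × (X × Y₁ × Y₂)

namespace AuxSpace

variable {k₀ k₁ k₂ : ℕ} {X Y₁ Y₂ : Type*}

/-- The random variable `U₀`. -/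
def U₀ (ω : AuxSpace k₀ k₁ k₂ X Y₁ Y₂) : Fin k₀ := ω.1.1
/-- The random variable `U₁`. -/
def U₁ (ω : AuxSpace k₀ k₁ k₂ X Y₁ Y₂) : Fin k₁ := ω.1.2.1
/-- The random variable `U₂`. -/
def U₂ (ω : AuxSpace k₀ k₁ k₂ X Y₁ Y₂) : Fin k₂ := ω.1.2.2
/-- The random variable `X`. -/
def srcX (ω : AuxSpace k₀ k₁ k₂ X Y₁ Y₂) : X := ω.2.1
/-- The random variable `Y₁`. -/
def srcY₁ (ω : AuxSpace k₀ k₁ k₂ X Y₁ Y₂) : Y₁ := ω.2.2.1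
/-- The random variable `Y₂`. -/
def srcY₂ (ω : AuxSpace k₀ k₁ k₂ X Y₁ Y₂) : Y₂ := ω.2.2.2

end AuxSpace

end

end GrayWyner

namespace GrayWyner

/-! Since P fixes the laws of X, Y₁ and Y₂, every information quantity in the theorem is an affine
function of the vector (P_X, H(X|U₀), (H(X|U₀U₁), H(Y₁|U₀U₁)), (H(X|U₀U₂), H(Y₂|U₀U₂))). The pivot
is that these vectors form a nested convex hull, `entropyRegion`: for constant U₀ the two receivers
contribute unrelated points of two hulls `envelope` over a common input law, and mixing over U₀
takes a hull once more. The two parts are unrelated because only the laws of (U₀,U₁,X) and (U₀,U₂,X)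
matter, so U₁ and U₂ may be taken conditionally independent given (U₀,X).
`IsAuxLaw.exists_entropyVector` and `exists_isAuxLaw` translate between auxiliary variables and
points of this set. It is compact by Carathéodory, so limits can be taken without explicit alphabet
bounds, and it is convex, which is time sharing.

Converse. Under the alternative, Y_i^n is independent of the messages while both keep their marginal
laws, so Gibbs' inequality gives (1-ε) log(1/β) - 1 ≤ I(M₀M_i;Y_i^n). At time t put U₀ = (M₀,
X^{t-1}) and U_i = M_i. The entropies of X obey the chain rule exactly. For the outputs,
H(Y_i^n|M₀M_i) ≥ ∑ H(Y_{i,t}|M₀M_iX^{t-1}), because past outputs are useless once the messages and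
past inputs are known. `exists_blockEntropyVector` proves this by induction on n. Each message has
entropy at most nR + 1, the extra bits vanish after division by n, and compactness closes the
argument in `exists_entropyVector_of_mem_exponentsRegion`.

Direct part. A superposition code is built from cloud centres u₀^n and, around each of them, two
independent satellite codebooks for u₁^n and u₂^n. `exists_superposition_code` is a one-shot
covering statement, derandomized by averaging. Receiver i thresholds the information density between
its codeword pair and Y_i^n. The type-II bound holds for every codeword by a change of measure. For
type-I, the covering is asked to produce a codeword whose test succeeds with high conditional
probability given x^n, which replaces a Markov lemma.

The rate constraints are not strict, whereas covering needs either strict slack or zero information.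
Mixing with trivial auxiliary variables scales all informations by 1 - l and creates exactly this
alternative; l → 0 is absorbed by the closure. -/

open scoped Classical in
lemma law_eq_sum {Ω α : Type*} [Fintype Ω] (p : Ω → ℝ) (A : Ω → α) (a : α) :
    law p A a = ∑ ω, if A ω = a then p ω else 0 := by
  simp [law, prob, Set.indicator_apply]

open scoped Classical in
lemma prob_eq_sum {Ω : Type*} [Fintype Ω] (p : Ω → ℝ) (E : Set Ω) :
    prob p E = ∑ ω, if ω ∈ E then p ω else 0 := by
  simp [prob, Set.indicator_apply]

/-! ### Laws of random variables on finite spaces. -/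

section Laws

variable {Ω α β γ : Type*} [Fintype Ω] {p : Ω → ℝ}

lemma law_nonneg (hp : ∀ ω, 0 ≤ p ω) (A : Ω → α) (a : α) : 0 ≤ law p A a := by
  classical
  rw [law_eq_sum]
  exact Finset.sum_nonneg fun ω _ => by split_ifs <;> simp [hp]

lemma sum_law_mul [Fintype α] (p : Ω → ℝ) (A : Ω → α) (f : α → ℝ) :
    ∑ a, law p A a * f a = ∑ ω, p ω * f (A ω) := by
  classical
  simp only [law_eq_sum, Finset.sum_mul]
  rw [Finset.sum_comm]
  refine Finset.sum_congr rfl fun ω _ => ?_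
  simp [ite_mul]

lemma sum_law [Fintype α] (p : Ω → ℝ) (A : Ω → α) : ∑ a, law p A a = ∑ ω, p ω := by
  simpa using sum_law_mul p A (fun _ => 1)

lemma law_mem_stdSimplex [Fintype α] (hp : p ∈ stdSimplex ℝ Ω) (A : Ω → α) :
    law p A ∈ stdSimplex ℝ α :=
  ⟨law_nonneg hp.1 A, by rw [sum_law, hp.2]⟩

lemma law_law [Fintype α] (p : Ω → ℝ) (T : Ω → α) (A : α → β) (b : β) :
    law (law p T) A b = law p (fun ω => A (T ω)) b := by
  classical
  rw [law_eq_sum, law_eq_sum]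
  have := sum_law_mul p T (fun a => if A a = b then 1 else 0)
  simpa using this

lemma law_eq_sum_fst [Fintype β] (p : Ω → ℝ) (A : Ω → α) (B : Ω → β) (a : α) :
    law p A a = ∑ b, law p (fun ω => (A ω, B ω)) (a, b) := by
  classical
  simp only [law_eq_sum, Prod.mk.injEq]
  rw [Finset.sum_comm]
  refine Finset.sum_congr rfl fun ω _ => ?_
  by_cases h : A ω = a <;> simp [h]

lemma law_eq_sum_snd [Fintype α] (p : Ω → ℝ) (A : Ω → α) (B : Ω → β) (b : β) :
    law p B b = ∑ a, law p (fun ω => (A ω, B ω)) (a, b) := by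
  classical
  simp only [law_eq_sum, Prod.mk.injEq]
  rw [Finset.sum_comm]
  refine Finset.sum_congr rfl fun ω _ => ?_
  by_cases h : B ω = b <;> simp [h]

/-- The law of a function of a random variable, as a sum over the fibre. -/
lemma law_congr_iff {A : Ω → α} {B : Ω → β} {a : α} {b : β} (h : ∀ ω, A ω = a ↔ B ω = b) :
    law p A a = law p B b := by
  classical
  simp only [law_eq_sum, h]

lemma law_le_law (hp : ∀ ω, 0 ≤ p ω) {A : Ω → α} {B : Ω → β} {a : α} {b : β}
    (h : ∀ ω, A ω = a → B ω = b) : law p A a ≤ law p B b := by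
  classical
  simp only [law_eq_sum]
  refine Finset.sum_le_sum fun ω _ => ?_
  by_cases h1 : A ω = a
  · simp [h1, h ω h1]
  · simp only [h1, if_false]; split_ifs <;> simp [hp]

lemma le_law (hp : ∀ ω, 0 ≤ p ω) (A : Ω → α) (ω : Ω) : p ω ≤ law p A (A ω) := by
  classical
  rw [law_eq_sum]
  have := Finset.single_le_sum (f := fun ω' => if A ω' = A ω then p ω' else 0)
    (fun ω' _ => by split_ifs <;> simp [hp]) (Finset.mem_univ ω)
  simpa using this

lemma law_pos (hp : ∀ ω, 0 ≤ p ω) (A : Ω → α) {ω : Ω} (h : p ω ≠ 0) : 0 < law p A (A ω) :=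
  lt_of_lt_of_le (lt_of_le_of_ne (hp ω) (Ne.symm h)) (le_law hp A ω)

end Laws

/-! ### Entropy and Gibbs' inequality. -/

section Entropy

variable {Ω α β γ δ : Type*} [Fintype Ω] {p : Ω → ℝ}

/-- Entropy, in bits, of the random variable `A` under `p`. -/
noncomputable def ent (p : Ω → ℝ) (A : Ω → α) : ℝ :=
  ∑ ω, p ω * -Real.logb 2 (law p A (A ω))

/-- Entropy depends on the random variable only through the partition that it induces. -/
lemma ent_congr {A : Ω → α} {B : Ω → β} (h : ∀ ω ω', A ω = A ω' ↔ B ω = B ω') :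
    ent p A = ent p B := by
  refine Finset.sum_congr rfl fun ω _ => ?_
  rw [law_congr_iff (p := p) (A := A) (B := B) (fun ω' => h ω' ω)]

lemma ent_eq_sum [Fintype α] (p : Ω → ℝ) (A : Ω → α) :
    ent p A = ∑ a, law p A a * -Real.logb 2 (law p A a) :=
  (sum_law_mul p A (fun a => -Real.logb 2 (law p A a))).symm

lemma mutualInfo_eq_sum [Fintype α] [Fintype β] (p : Ω → ℝ) (A : Ω → α) (B : Ω → β) :
    mutualInfo p A B = ∑ ω, p ω * Real.logb 2 (law p (fun ω => (A ω, B ω)) (A ω, B ω) /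
      (law p A (A ω) * law p B (B ω))) := by
  rw [mutualInfo, ← Fintype.sum_prod_type' (f := fun a b => law p (fun ω => (A ω, B ω)) (a, b) *
    Real.logb 2 (law p (fun ω => (A ω, B ω)) (a, b) / (law p A a * law p B b)))]
  exact sum_law_mul p (fun ω => (A ω, B ω))
    (fun x => Real.logb 2 (law p (fun ω => (A ω, B ω)) x / (law p A x.1 * law p B x.2)))

lemma mutualInfo_eq_ent [Fintype α] [Fintype β] (hp : ∀ ω, 0 ≤ p ω) (A : Ω → α) (B : Ω → β) :
    mutualInfo p A B = ent p A + ent p B - ent p (fun ω => (A ω, B ω)) := by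
  rw [mutualInfo_eq_sum, ent, ent, ent, ← Finset.sum_add_distrib, ← Finset.sum_sub_distrib]
  refine Finset.sum_congr rfl fun ω _ => ?_
  by_cases h : p ω = 0
  · simp [h]
  have h1 := (law_pos hp A h).ne'
  have h2 := (law_pos hp B h).ne'
  have h3 := (law_pos hp (fun ω => (A ω, B ω)) h).ne'
  rw [Real.logb_div h3 (mul_ne_zero h1 h2), Real.logb_mul h1 h2]
  ring

lemma condMutualInfo_eq_sum [Fintype α] [Fintype β] [Fintype γ] (p : Ω → ℝ) (A : Ω → α)
    (B : Ω → β) (C : Ω → γ) :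
    condMutualInfo p A B C = ∑ ω, p ω * Real.logb 2
      (law p (fun ω => (A ω, B ω, C ω)) (A ω, B ω, C ω) * law p C (C ω) /
      (law p (fun ω => (A ω, C ω)) (A ω, C ω) * law p (fun ω => (B ω, C ω)) (B ω, C ω))) := by
  have := sum_law_mul p (fun ω => (A ω, B ω, C ω)) (fun x => Real.logb 2
      (law p (fun ω => (A ω, B ω, C ω)) x * law p C x.2.2 /
      (law p (fun ω => (A ω, C ω)) (x.1, x.2.2) * law p (fun ω => (B ω, C ω)) (x.2.1, x.2.2))))
  rw [← this, condMutualInfo, Fintype.sum_prod_type]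
  refine Finset.sum_congr rfl fun a _ => ?_
  rw [Fintype.sum_prod_type]

lemma condMutualInfo_eq_ent [Fintype α] [Fintype β] [Fintype γ] (hp : ∀ ω, 0 ≤ p ω)
    (A : Ω → α) (B : Ω → β) (C : Ω → γ) :
    condMutualInfo p A B C = ent p (fun ω => (A ω, C ω)) + ent p (fun ω => (B ω, C ω)) -
      ent p (fun ω => (A ω, B ω, C ω)) - ent p C := by
  rw [condMutualInfo_eq_sum]
  simp only [ent]
  rw [← Finset.sum_add_distrib, ← Finset.sum_sub_distrib, ← Finset.sum_sub_distrib]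
  refine Finset.sum_congr rfl fun ω _ => ?_
  by_cases h : p ω = 0
  · simp [h]
  have h1 := (law_pos hp (fun ω => (A ω, C ω)) h).ne'
  have h2 := (law_pos hp (fun ω => (B ω, C ω)) h).ne'
  have h3 := (law_pos hp (fun ω => (A ω, B ω, C ω)) h).ne'
  have h4 := (law_pos hp C h).ne'
  rw [Real.logb_div (mul_ne_zero h3 h4) (mul_ne_zero h1 h2), Real.logb_mul h1 h2,
    Real.logb_mul h3 h4]
  ring

/-- Termwise form of Gibbs' inequality. -/
lemma sub_le_mul_logb {f g : ℝ} (hf : 0 ≤ f) (hg : 0 ≤ g) (h : g = 0 → f = 0) :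
    f - g ≤ Real.log 2 * (f * Real.logb 2 (f / g)) := by
  rcases hf.eq_or_lt with rfl | hf
  · simpa using hg
  have hg' : 0 < g := lt_of_le_of_ne hg fun h0 => hf.ne' (h h0.symm)
  have hl : Real.log 2 ≠ 0 := (Real.log_pos one_lt_two).ne'
  have h1 := Real.one_sub_inv_le_log_of_pos (div_pos hf hg')
  have : Real.log 2 * (f * Real.logb 2 (f / g)) = f * Real.log (f / g) := by
    rw [Real.logb]; field_simp
  rw [this]
  calc f - g = f * (1 - (f / g)⁻¹) := by field_simp
    _ ≤ _ := mul_le_mul_of_nonneg_left h1 hf.le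

/-- The termwise bound summed. Only a comparison of total masses is required, so g may be a
subprobability; the bound for tests relies on this. -/
lemma gibbs_nonneg {ι : Type*} [Fintype ι] {f g : ι → ℝ} (hf : ∀ i, 0 ≤ f i) (hg : ∀ i, 0 ≤ g i)
    (h : ∀ i, g i = 0 → f i = 0) (hs : ∑ i, g i ≤ ∑ i, f i) :
    0 ≤ ∑ i, f i * Real.logb 2 (f i / g i) := by
  have h1 := Finset.sum_le_sum fun i (_ : i ∈ Finset.univ) => sub_le_mul_logb (hf i) (hg i) (h i)
  rw [Finset.sum_sub_distrib, ← Finset.mul_sum] at h1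
  exact nonneg_of_mul_nonneg_right ((sub_nonneg.2 hs).trans h1) (Real.log_pos one_lt_two)

/-- Equality case of Gibbs' inequality. -/
lemma gibbs_eq {ι : Type*} [Fintype ι] {f g : ι → ℝ} (hf : ∀ i, 0 ≤ f i) (hg : ∀ i, 0 ≤ g i)
    (h : ∀ i, g i = 0 → f i = 0) (hs : ∑ i, g i ≤ ∑ i, f i)
    (h0 : ∑ i, f i * Real.logb 2 (f i / g i) ≤ 0) (i : ι) : f i = g i := by
  have hl : 0 < Real.log 2 := Real.log_pos one_lt_two
  have h1 : ∀ i, 0 ≤ Real.log 2 * (f i * Real.logb 2 (f i / g i)) - (f i - g i) := fun i =>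
    sub_nonneg.2 (sub_le_mul_logb (hf i) (hg i) (h i))
  have h2 : ∑ i, (Real.log 2 * (f i * Real.logb 2 (f i / g i)) - (f i - g i)) ≤ 0 := by
    rw [Finset.sum_sub_distrib, ← Finset.mul_sum, Finset.sum_sub_distrib]
    nlinarith
  have h3 := (Finset.sum_eq_zero_iff_of_nonneg fun i _ => h1 i).1
    (le_antisymm h2 (Finset.sum_nonneg fun i _ => h1 i)) i (Finset.mem_univ i)
  rcases (hf i).eq_or_lt with hf0 | hf0
  · rw [← hf0] at h3 ⊢
    simp only [zero_mul, mul_zero, zero_sub, sub_neg_eq_add, zero_add] at h3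
    exact h3.symm
  have hg' : 0 < g i := lt_of_le_of_ne (hg i) fun h0 => hf0.ne' (h i h0.symm)
  by_contra hne
  have h4 : (f i / g i)⁻¹ ≠ 1 := by
    rw [inv_div]; intro h5; exact hne ((div_eq_one_iff_eq hf0.ne').1 h5).symm
  have h5 := Real.log_lt_sub_one_of_pos (inv_pos.2 (div_pos hf0 hg')) h4
  rw [Real.log_inv] at h5
  have h6 : Real.log 2 * (f i * Real.logb 2 (f i / g i)) = f i * Real.log (f i / g i) := by
    rw [Real.logb]; field_simp
  rw [h6] at h3
  have h7 : f i * (-Real.log (f i / g i)) < f i * ((f i / g i)⁻¹ - 1) :=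
    mul_lt_mul_of_pos_left h5 hf0
  have h8 : f i * ((f i / g i)⁻¹ - 1) = g i - f i := by field_simp
  linarith

/-- Absolute continuity of P_ABC with respect to P_AC P_BC / P_C, as Gibbs' inequality demands. The
convention x / 0 = 0 makes P_C = 0 one of the cases. -/
lemma condProd_eq_zero (hp : ∀ ω, 0 ≤ p ω) (A : Ω → α) (B : Ω → β) (C : Ω → γ) (x : α × β × γ)
    (h : law p (fun ω => (A ω, C ω)) (x.1, x.2.2) *
      law p (fun ω => (B ω, C ω)) (x.2.1, x.2.2) / law p C x.2.2 = 0) :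
    law p (fun ω => (A ω, B ω, C ω)) x = 0 := by
  obtain ⟨a, b, c⟩ := x
  refine le_antisymm ?_ (law_nonneg hp _ _)
  simp only [div_eq_zero_iff, mul_eq_zero] at h
  rcases h with (h | h) | h <;> rw [← h] <;> refine law_le_law hp fun ω h => ?_ <;>
    simp_all

lemma ent_le_ent_pair (hp : ∀ ω, 0 ≤ p ω) (A : Ω → δ) (B : Ω → γ) :
    ent p A ≤ ent p (fun ω => (A ω, B ω)) := by
  refine Finset.sum_le_sum fun ω _ => ?_
  by_cases h : p ω = 0
  · simp [h]
  refine mul_le_mul_of_nonneg_left (neg_le_neg ?_) (hp ω)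
  refine Real.logb_le_logb_of_le one_lt_two (law_pos hp (fun ω => (A ω, B ω)) h)
    (law_le_law hp fun ω' => by simp +contextual)

/-- Conditional independence in entropy form, from a factorization of the joint law. -/
lemma ent_add_ent_of_isMarkovChain (hp : ∀ ω, 0 ≤ p ω) (A : Ω → α) (B : Ω → β) (C : Ω → γ)
    (h : ∀ a b c, law p (fun ω => (A ω, B ω, C ω)) (a, b, c) * law p C c =
      law p (fun ω => (A ω, C ω)) (a, c) * law p (fun ω => (B ω, C ω)) (b, c)) :
    ent p (fun ω => (A ω, B ω, C ω)) + ent p C =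
      ent p (fun ω => (A ω, C ω)) + ent p (fun ω => (B ω, C ω)) := by
  simp only [ent]
  rw [← Finset.sum_add_distrib, ← Finset.sum_add_distrib]
  refine Finset.sum_congr rfl fun ω _ => ?_
  by_cases h0 : p ω = 0
  · simp [h0]
  have h1 := (law_pos hp (fun ω => (A ω, C ω)) h0).ne'
  have h2 := (law_pos hp (fun ω => (B ω, C ω)) h0).ne'
  have h3 := (law_pos hp (fun ω => (A ω, B ω, C ω)) h0).ne'
  have h4 := (law_pos hp C h0).ne'
  have h5 := congrArg (Real.logb 2) (h (A ω) (B ω) (C ω))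
  rw [Real.logb_mul h3 h4, Real.logb_mul h1 h2] at h5
  linear_combination (-p ω) * h5

end Entropy

/-! ### Shannon inequalities and the bound for tests against independence. -/

section Inequalities

variable {Ω α β γ δ : Type*} [Fintype Ω] [Fintype α] [Fintype β] [Fintype γ] {p : Ω → ℝ}

/-- The Markov coupling built from P_AC and P_BC has the same mass as p: sum out a, then b, each
time recovering P_C. -/
lemma sum_condProd (p : Ω → ℝ) (A : Ω → α) (B : Ω → β) (C : Ω → γ) :
    ∑ x : α × β × γ, law p (fun ω => (A ω, C ω)) (x.1, x.2.2) *
      law p (fun ω => (B ω, C ω)) (x.2.1, x.2.2) / law p C x.2.2 = ∑ ω, p ω := by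
  rw [← sum_law p C]
  simp only [Fintype.sum_prod_type]
  rw [Finset.sum_comm]
  calc _ = ∑ b, ∑ c, (∑ a, law p (fun ω => (A ω, C ω)) (a, c)) *
        law p (fun ω => (B ω, C ω)) (b, c) / law p C c := by
        refine Finset.sum_congr rfl fun b _ => ?_
        rw [Finset.sum_comm]
        refine Finset.sum_congr rfl fun c _ => ?_
        rw [Finset.sum_mul, Finset.sum_div]
    _ = ∑ c, law p C c * (∑ b, law p (fun ω => (B ω, C ω)) (b, c)) / law p C c := by
        rw [Finset.sum_comm]
        refine Finset.sum_congr rfl fun c _ => ?_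
        rw [← law_eq_sum_snd, Finset.mul_sum, Finset.sum_div]
    _ = _ := by
        refine Finset.sum_congr rfl fun c _ => ?_
        rw [← law_eq_sum_snd]
        by_cases h : law p C c = 0
        · simp [h]
        · field_simp

lemma condMutualInfo_eq_gibbs (A : Ω → α) (B : Ω → β) (C : Ω → γ) :
    condMutualInfo p A B C = ∑ x : α × β × γ, law p (fun ω => (A ω, B ω, C ω)) x *
      Real.logb 2 (law p (fun ω => (A ω, B ω, C ω)) x /
        (law p (fun ω => (A ω, C ω)) (x.1, x.2.2) *
      law p (fun ω => (B ω, C ω)) (x.2.1, x.2.2) / law p C x.2.2)) := by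
  simp only [Fintype.sum_prod_type, condMutualInfo, div_div_eq_mul_div]

lemma condMutualInfo_nonneg (hp : ∀ ω, 0 ≤ p ω) (A : Ω → α) (B : Ω → β) (C : Ω → γ) :
    0 ≤ condMutualInfo p A B C := by
  rw [condMutualInfo_eq_gibbs]
  refine gibbs_nonneg (fun x => law_nonneg hp _ _) (fun x => div_nonneg (mul_nonneg
    (law_nonneg hp _ _) (law_nonneg hp _ _)) (law_nonneg hp _ _))
    (condProd_eq_zero hp A B C) ?_
  rw [sum_condProd, sum_law]

/-- If the conditional mutual information vanishes then the conditional law factorizes. -/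
lemma law_eq_condProd_of_condMutualInfo_le_zero (hp : ∀ ω, 0 ≤ p ω) (A : Ω → α) (B : Ω → β)
    (C : Ω → γ) (h : condMutualInfo p A B C ≤ 0) (a : α) (b : β) (c : γ) :
    law p (fun ω => (A ω, B ω, C ω)) (a, b, c) = law p (fun ω => (A ω, C ω)) (a, c) *
      law p (fun ω => (B ω, C ω)) (b, c) / law p C c := by
  rw [condMutualInfo_eq_gibbs] at h
  refine gibbs_eq (fun x => law_nonneg hp _ _) (fun x => div_nonneg (mul_nonneg
    (law_nonneg hp _ _) (law_nonneg hp _ _)) (law_nonneg hp _ _))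
    (condProd_eq_zero hp A B C) ?_ h (a, b, c)
  rw [sum_condProd, sum_law]

lemma ent_submodular (hp : ∀ ω, 0 ≤ p ω) (A : Ω → α) (B : Ω → β) (C : Ω → γ) :
    ent p (fun ω => (A ω, B ω, C ω)) + ent p C ≤
      ent p (fun ω => (A ω, C ω)) + ent p (fun ω => (B ω, C ω)) := by
  have := condMutualInfo_nonneg hp A B C
  rw [condMutualInfo_eq_ent hp] at this
  linarith

lemma ent_const (hp : p ∈ stdSimplex ℝ Ω) : ent p (fun _ => ()) = 0 := by
  have : law p (fun _ => ()) () = 1 := by classical rw [law_eq_sum]; simpa using hp.2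
  simp [ent, this]

lemma mutualInfo_eq_condMutualInfo (hp : p ∈ stdSimplex ℝ Ω) (A : Ω → α) (B : Ω → β) :
    mutualInfo p A B = condMutualInfo p A B (fun _ => ()) := by
  rw [condMutualInfo_eq_ent hp.1, mutualInfo_eq_ent hp.1, ent_const hp,
    ent_congr (A := fun ω => (A ω, ())) (B := A) (by simp),
    ent_congr (A := fun ω => (B ω, ())) (B := B) (by simp),
    ent_congr (A := fun ω => (A ω, B ω, ())) (B := fun ω => (A ω, B ω)) (by simp), sub_zero]

/-- Equality case of Gibbs with trivial conditioning. It serves covering without rate slack, where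
exact independence is what makes one codeword enough. -/
lemma law_eq_mul_of_mutualInfo_le_zero (hp : p ∈ stdSimplex ℝ Ω) (A : Ω → α) (B : Ω → β)
    (h : mutualInfo p A B ≤ 0) (a : α) (b : β) :
    law p (fun ω => (A ω, B ω)) (a, b) = law p A a * law p B b := by
  rw [mutualInfo_eq_condMutualInfo hp] at h
  have h1 := law_eq_condProd_of_condMutualInfo_le_zero hp.1 A B (fun _ => ()) h a b ()
  have : law p (fun _ => ()) () = 1 := by classical rw [law_eq_sum]; simpa using hp.2
  rw [this, div_one] at h1
  rw [law_congr_iff (A := A) (B := fun ω => (A ω, ())) (b := (a, ())) (by simp),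
    law_congr_iff (A := B) (B := fun ω => (B ω, ())) (b := (b, ())) (by simp), ← h1]
  exact law_congr_iff (by simp)

lemma ent_pair_le_add (hp : p ∈ stdSimplex ℝ Ω) (A : Ω → α) (B : Ω → β) :
    ent p (fun ω => (A ω, B ω)) ≤ ent p A + ent p B := by
  have := condMutualInfo_nonneg hp.1 A B (fun _ => ())
  rw [← mutualInfo_eq_condMutualInfo hp, mutualInfo_eq_ent hp.1] at this
  linarith

lemma ent_le_logb_card (hp : p ∈ stdSimplex ℝ Ω) (A : Ω → α) :
    ent p A ≤ Real.logb 2 (Fintype.card α) := by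
  have hne : Nonempty α := by
    by_contra h
    rw [not_nonempty_iff] at h
    have := hp.2
    rw [← sum_law p A] at this
    simp at this
  have hc : (0 : ℝ) < Fintype.card α := by exact_mod_cast Fintype.card_pos
  have := gibbs_nonneg (f := law p A) (g := fun _ => (Fintype.card α : ℝ)⁻¹)
    (fun a => law_nonneg hp.1 _ _) (fun a => (inv_pos.2 hc).le)
    (fun a h => absurd h (inv_pos.2 hc).ne') (by
      rw [sum_law, hp.2]; simp [hc.ne'])
  have h2 : ∑ a, law p A a * Real.logb 2 (law p A a / (Fintype.card α : ℝ)⁻¹) =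
      -ent p A + Real.logb 2 (Fintype.card α) := by
    rw [ent_eq_sum, ← Finset.sum_neg_distrib]
    have h3 : Real.logb 2 (Fintype.card α) =
        ∑ a, law p A a * Real.logb 2 (Fintype.card α) := by
      rw [← Finset.sum_mul, sum_law, hp.2, one_mul]
    conv_rhs => rw [h3]
    rw [← Finset.sum_add_distrib]
    refine Finset.sum_congr rfl fun a _ => ?_
    by_cases h0 : law p A a = 0
    · simp [h0]
    rw [div_inv_eq_mul, Real.logb_mul h0 hc.ne']
    ring
  linarith

open scoped Classical in
/-- Weak converse for testing a joint law against the product of its marginals. -/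
lemma prob_mul_neg_logb_sub_one_le_mutualInfo (hp : p ∈ stdSimplex ℝ Ω) (A : Ω → α) (B : Ω → β)
    (E : Set (α × β)) {b : ℝ} (hb : 0 < b)
    (hE : ∑ x : α × β, (if x ∈ E then law p A x.1 * law p B x.2 else 0) ≤ b) :
    (∑ x : α × β, (if x ∈ E then law p (fun ω => (A ω, B ω)) x else 0)) * -Real.logb 2 b - 1 ≤
      mutualInfo p A B := by
  set f : α × β → ℝ := law p (fun ω => (A ω, B ω)) with hf
  set t : α × β → ℝ := fun x => if x ∈ E then b⁻¹ else 1 with ht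
  have htpos : ∀ x, 0 < t x := fun x => by
    simp only [ht]; split_ifs
    · exact inv_pos.2 hb
    · exact one_pos
  have hQ : ∑ x : α × β, law p A x.1 * law p B x.2 = 1 := by
    rw [Fintype.sum_prod_type, ← Finset.sum_mul_sum, sum_law, sum_law, hp.2, one_mul]
  have hzero : ∀ x : α × β, law p A x.1 * law p B x.2 = 0 → f x = 0 := by
    rintro ⟨a, c⟩ h
    refine le_antisymm ?_ (law_nonneg hp.1 _ _)
    rcases mul_eq_zero.1 h with h | h <;> rw [← h] <;> refine law_le_law hp.1 fun ω h => ?_ <;>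
      simp_all
  have hnn : ∀ x : α × β, 0 ≤ law p A x.1 * law p B x.2 := fun x =>
    mul_nonneg (law_nonneg hp.1 _ _) (law_nonneg hp.1 _ _)
  have key := gibbs_nonneg (f := f) (g := fun x => law p A x.1 * law p B x.2 * t x / 2)
    (fun x => law_nonneg hp.1 _ _)
    (fun x => by have := hnn x; have := htpos x; positivity)
    (fun x h => by
      refine hzero x ?_
      simpa [(htpos x).ne'] using h) (by
      rw [hf, sum_law, hp.2, ← Finset.sum_div, div_le_one two_pos]
      calc ∑ x : α × β, law p A x.1 * law p B x.2 * t x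
          ≤ ∑ x : α × β, (b⁻¹ * (if x ∈ E then law p A x.1 * law p B x.2 else 0) +
              law p A x.1 * law p B x.2) := by
            refine Finset.sum_le_sum fun x _ => ?_
            have := hnn x
            simp only [ht]
            split_ifs <;> linarith
        _ ≤ b⁻¹ * b + 1 := by
            rw [Finset.sum_add_distrib, ← Finset.mul_sum, hQ]
            gcongr
        _ = 2 := by rw [inv_mul_cancel₀ hb.ne']; norm_num)
  have h2 : ∑ x, f x * Real.logb 2 (f x / (law p A x.1 * law p B x.2 * t x / 2)) =
      ∑ x, f x * Real.logb 2 (f x / (law p A x.1 * law p B x.2)) -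
        (∑ x : α × β, (if x ∈ E then f x else 0)) * -Real.logb 2 b + 1 := by
    have h1 : (1 : ℝ) = ∑ x, f x := by rw [hf, sum_law, hp.2]
    conv_rhs => rw [h1]
    rw [Finset.sum_mul, ← Finset.sum_sub_distrib, ← Finset.sum_add_distrib]
    refine Finset.sum_congr rfl fun x _ => ?_
    by_cases h0 : f x = 0
    · simp [h0]
    have h3 : law p A x.1 * law p B x.2 ≠ 0 := fun h => h0 (hzero x h)
    rw [Real.logb_div h0 (by have := (htpos x).ne'; positivity), Real.logb_div h0 h3,
      Real.logb_div (mul_ne_zero h3 (htpos x).ne') two_ne_zero, Real.logb_mul h3 (htpos x).ne',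
      Real.logb_self_eq_one one_lt_two]
    simp only [ht]
    split_ifs
    · rw [Real.logb_inv]; ring
    · rw [Real.logb_one]; ring
  rw [h2] at key
  have h3 : mutualInfo p A B = ∑ x, f x * Real.logb 2 (f x / (law p A x.1 * law p B x.2)) := by
    rw [mutualInfo, Fintype.sum_prod_type]
  rw [h3]
  linarith

end Inequalities

/-- In a finite-dimensional space, the convex hull of a compact set is compact. -/
lemma isCompact_convexHull {E : Type*} [NormedAddCommGroup E] [NormedSpace ℝ E]
    [FiniteDimensional ℝ E] {s : Set E} (hs : IsCompact s) : IsCompact (convexHull ℝ s) := by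
  rcases s.eq_empty_or_nonempty with rfl | ⟨e₀, he₀⟩
  · simp
  -- Carathéodory: `finrank + 1` points suffice, so the hull is the continuous image of a simplex
  -- times a finite power of s.
  set d := Module.finrank ℝ E + 1
  let F : (Fin d → ℝ) × (Fin d → E) → E := fun y => ∑ i, y.1 i • y.2 i
  have hF : Continuous F := by fun_prop
  have hcomp : IsCompact (stdSimplex ℝ (Fin d) ×ˢ (Set.univ.pi fun _ : Fin d => s)) :=
    (isCompact_stdSimplex ℝ (Fin d)).prod (isCompact_univ_pi fun _ => hs)
  convert hcomp.image hF using 1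
  apply Set.Subset.antisymm
  · intro x hx
    obtain ⟨ι, hι, z, w, hz, hind, hw, hw1, hx⟩ := eq_pos_convex_span_of_mem_convexHull hx
    have hcard : Fintype.card ι ≤ Fintype.card (Fin d) := by
      rw [Fintype.card_fin]
      exact hind.card_le_finrank_succ.trans (Nat.succ_le_succ (Submodule.finrank_le _))
    obtain ⟨g⟩ := Function.Embedding.nonempty_of_card_le hcard
    -- Unused slots get weight 0 and the arbitrary point e₀ of s.
    refine ⟨(Function.extend g w 0, Function.extend g z fun _ => e₀), ⟨⟨fun i => ?_, ?_⟩, ?_⟩, ?_⟩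
    · by_cases hi : ∃ j, g j = i
      · obtain ⟨j, rfl⟩ := hi
        simp only [g.injective.extend_apply]; exact (hw j).le
      · simp [Function.extend_apply' _ _ _ hi]
    · simp only
      rw [← hw1]
      refine (Fintype.sum_of_injective g g.injective _ _ (fun i hi => ?_) fun j => ?_).symm
      · simp [Function.extend_apply' _ _ _ hi]
      · simp [g.injective.extend_apply]
    · intro i _
      by_cases hi : ∃ j, g j = i
      · obtain ⟨j, rfl⟩ := hi
        simp only [g.injective.extend_apply]; exact hz ⟨j, rfl⟩
      · simpa [Function.extend_apply' _ _ _ hi] using he₀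
    · simp only [F]
      rw [← hx]
      refine (Fintype.sum_of_injective g g.injective _ _ (fun i hi => ?_) fun j => ?_).symm
      · simp [Function.extend_apply' _ _ _ hi]
      · simp [g.injective.extend_apply]
  · rintro _ ⟨⟨w, z⟩, ⟨hw, hz⟩, rfl⟩
    exact (convex_convexHull ℝ s).sum_mem (fun i _ => hw.1 i) hw.2
      fun i _ => subset_convexHull ℝ s (hz i trivial)

/-! ### The convex region of entropy vectors. -/

section Region

variable {X Y Y₁ Y₂ : Type*} [Fintype X] [Fintype Y] [Fintype Y₁] [Fintype Y₂]

/-- Entropy functional, in bits, on the probability simplex. -/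
noncomputable def entFun (v : X → ℝ) : ℝ := ∑ x, v x * -Real.logb 2 (v x)

/-- The output of the channel `W` when the input has law `v`. -/
def output (W : X → Y → ℝ) (v : X → ℝ) (y : Y) : ℝ := ∑ x, v x * W x y

lemma continuous_entFun : Continuous (entFun : (X → ℝ) → ℝ) := by
  have : (entFun : (X → ℝ) → ℝ) = fun v => ∑ x, Real.negMulLog (v x) / Real.log 2 := by
    funext v
    refine Finset.sum_congr rfl fun x _ => ?_
    rw [Real.negMulLog, Real.logb]; ring
  rw [this]
  exact continuous_finsetSum _ fun x _ =>
    (Real.continuous_negMulLog.comp (continuous_apply x)).div_const _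

omit [Fintype Y] in
lemma continuous_output (W : X → Y → ℝ) : Continuous (output W) := by
  unfold output
  fun_prop

lemma ent_eq_entFun {Ω : Type*} [Fintype Ω] (p : Ω → ℝ) (A : Ω → X) :
    ent p A = entFun (law p A) := ent_eq_sum p A

/-- The convex hull of the graph of input and output entropy over the simplex. -/
def envelope (W : X → Y → ℝ) : Set ((X → ℝ) × ℝ × ℝ) :=
  convexHull ℝ ((fun v => (v, entFun v, entFun (output W v))) '' stdSimplex ℝ X)

lemma isCompact_envelope (W : X → Y → ℝ) : IsCompact (envelope W) :=
  isCompact_convexHull <| (isCompact_stdSimplex ℝ X).image <|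
    continuous_id.prodMk (continuous_entFun.prodMk (continuous_entFun.comp (continuous_output W)))

/-- The entropy vectors attained when `U₀` is constant. -/
def layer (W₁ : X → Y₁ → ℝ) (W₂ : X → Y₂ → ℝ) : Set ((X → ℝ) × ℝ × (ℝ × ℝ) × (ℝ × ℝ)) :=
  {z | z.1 ∈ stdSimplex ℝ X ∧ z.2.1 = entFun z.1 ∧ (z.1, z.2.2.1) ∈ envelope W₁ ∧
    (z.1, z.2.2.2) ∈ envelope W₂}

/-- The vectors
`(P_X, H(X|U₀), (H(X|U₀,U₁), H(Y₁|U₀,U₁)), (H(X|U₀,U₂), H(Y₂|U₀,U₂)))`. -/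
def entropyRegion (W₁ : X → Y₁ → ℝ) (W₂ : X → Y₂ → ℝ) :
    Set ((X → ℝ) × ℝ × (ℝ × ℝ) × (ℝ × ℝ)) :=
  convexHull ℝ (layer W₁ W₂)

/-- A fibre product of two compact envelopes over their common first coordinate: a closed subset of
a product of compact sets. -/
lemma isCompact_layer (W₁ : X → Y₁ → ℝ) (W₂ : X → Y₂ → ℝ) : IsCompact (layer W₁ W₂) := by
  have hbig : IsCompact (stdSimplex ℝ X ×ˢ ((entFun '' stdSimplex ℝ X) ×ˢ
      ((Prod.snd '' envelope W₁) ×ˢ (Prod.snd '' envelope W₂)))) :=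
    (isCompact_stdSimplex ℝ X).prod (((isCompact_stdSimplex ℝ X).image continuous_entFun).prod
      (((isCompact_envelope W₁).image continuous_snd).prod
        ((isCompact_envelope W₂).image continuous_snd)))
  refine hbig.of_isClosed_subset ?_ ?_
  · refine IsClosed.inter ((isCompact_stdSimplex ℝ X).isClosed.preimage continuous_fst)
      (IsClosed.inter (isClosed_eq (by fun_prop) (continuous_entFun.comp continuous_fst))
      (IsClosed.inter ((isCompact_envelope W₁).isClosed.preimage (by fun_prop))
        ((isCompact_envelope W₂).isClosed.preimage (by fun_prop))))
  · rintro ⟨v, a, h₁, h₂⟩ ⟨hv, ha, hh₁, hh₂⟩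
    exact ⟨hv, ⟨v, hv, ha.symm⟩, ⟨_, hh₁, rfl⟩, ⟨_, hh₂, rfl⟩⟩

lemma isCompact_entropyRegion (W₁ : X → Y₁ → ℝ) (W₂ : X → Y₂ → ℝ) :
    IsCompact (entropyRegion W₁ W₂) :=
  isCompact_convexHull (isCompact_layer W₁ W₂)

/-- The entropy vector of constant auxiliary variables. -/
lemma trivial_mem_entropyRegion (W₁ : X → Y₁ → ℝ) (W₂ : X → Y₂ → ℝ) {v : X → ℝ}
    (hv : v ∈ stdSimplex ℝ X) :
    (v, entFun v, (entFun v, entFun (output W₁ v)), (entFun v, entFun (output W₂ v))) ∈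
      entropyRegion W₁ W₂ :=
  subset_convexHull ℝ _ ⟨hv, rfl, subset_convexHull ℝ _ ⟨v, hv, rfl⟩,
    subset_convexHull ℝ _ ⟨v, hv, rfl⟩⟩

end Region

section Assoc

variable {Ω α β γ : Type*} [Fintype Ω] (p : Ω → ℝ) (A : Ω → α) (B : Ω → β) (C : Ω → γ)

lemma law_assoc (a : α) (b : β) (c : γ) : law p (fun ω => (A ω, B ω, C ω)) (a, b, c) =
    law p (fun ω => ((A ω, B ω), C ω)) ((a, b), c) :=
  law_congr_iff (by simp [and_assoc])

lemma ent_assoc : ent p (fun ω => ((A ω, B ω), C ω)) = ent p (fun ω => (A ω, B ω, C ω)) :=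
  ent_congr (by simp [and_assoc])

end Assoc

/-! ### Conditioning, mixtures, and entropy vectors of random variables. -/

section Conditioning

variable {Ω α β γ : Type*} [Fintype Ω] {p : Ω → ℝ}

open scoped Classical in
/-- The pmf `p` conditioned on the event `U = u`. -/
noncomputable def condOn (p : Ω → ℝ) (U : Ω → α) (u : α) (ω : Ω) : ℝ :=
  (if U ω = u then p ω else 0) / law p U u

lemma condOn_mem_stdSimplex (hp : ∀ ω, 0 ≤ p ω) (U : Ω → α) {u : α} (hu : law p U u ≠ 0) :
    condOn p U u ∈ stdSimplex ℝ Ω := by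
  classical
  refine ⟨fun ω => div_nonneg (by split_ifs <;> simp [hp]) (law_nonneg hp _ _), ?_⟩
  simp only [condOn]
  rw [← Finset.sum_div]
  convert div_self hu
  rw [law_eq_sum]

lemma law_condOn (p : Ω → ℝ) (U : Ω → α) (u : α) (A : Ω → β) (a : β) :
    law (condOn p U u) A a = law p (fun ω => (U ω, A ω)) (u, a) / law p U u := by
  classical
  rw [law_eq_sum, law_eq_sum p (fun ω => (U ω, A ω)), Finset.sum_div]
  refine Finset.sum_congr rfl fun ω _ => ?_
  simp only [condOn, Prod.mk.injEq]
  by_cases h1 : U ω = u <;> by_cases h2 : A ω = a <;> simp [h1, h2]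

/-- Conditional entropy of a pair whose joint law is given by a kernel. -/
lemma ent_pair_sub_of_kernel [Fintype α] [Fintype β] (hp : ∀ ω, 0 ≤ p ω) (A : Ω → α) (B : Ω → β)
    (κ : α → β → ℝ)
    (hκ : ∀ a b, law p (fun ω => (A ω, B ω)) (a, b) = law p A a * κ a b) :
    ent p (fun ω => (A ω, B ω)) - ent p A = ∑ a, law p A a * entFun (κ a) := by
  have h1 : ent p (fun ω => (A ω, B ω)) - ent p A =
      ∑ ω, p ω * -Real.logb 2 (κ (A ω) (B ω)) := by
    rw [ent, ent, ← Finset.sum_sub_distrib]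
    refine Finset.sum_congr rfl fun ω _ => ?_
    by_cases h0 : p ω = 0
    · simp [h0]
    have h1 := (law_pos hp (fun ω => (A ω, B ω)) h0).ne'
    have h2 := (law_pos hp A h0).ne'
    simp only [hκ] at h1 ⊢
    rw [Real.logb_mul h2 (right_ne_zero_of_mul h1)]
    ring
  rw [h1]
  have h2 := sum_law_mul p (fun ω => (A ω, B ω)) (fun x => -Real.logb 2 (κ x.1 x.2))
  rw [← h2, Fintype.sum_prod_type]
  refine Finset.sum_congr rfl fun a _ => ?_
  rw [entFun, Finset.mul_sum]
  refine Finset.sum_congr rfl fun b _ => ?_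
  simp only [hκ]; ring

lemma ent_pair_sub_eq_sum_condOn [Fintype α] [Fintype β] (hp : ∀ ω, 0 ≤ p ω) (U : Ω → α)
    (A : Ω → β) :
    ent p (fun ω => (U ω, A ω)) - ent p U = ∑ u, law p U u * ent (condOn p U u) A := by
  rw [ent_pair_sub_of_kernel hp U A (fun u => law (condOn p U u) A)]
  · simp only [ent_eq_entFun]
  · intro u a
    rw [law_condOn]
    by_cases h : law p U u = 0
    · rw [h, zero_mul]
      refine le_antisymm ?_ (law_nonneg hp _ _)
      rw [← h]; exact law_le_law hp fun ω => by simp +contextual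
    · field_simp

lemma sum_law_mul_law_condOn [Fintype α] [Fintype β] (hp : ∀ ω, 0 ≤ p ω) (U : Ω → α)
    (A : Ω → β) (a : β) : ∑ u, law p U u * law (condOn p U u) A a = law p A a := by
  rw [law_eq_sum_snd p U A]
  refine Finset.sum_congr rfl fun u _ => ?_
  rw [law_condOn]
  by_cases h : law p U u = 0
  · rw [h, zero_mul]
    refine (le_antisymm ?_ (law_nonneg hp _ _)).symm
    rw [← h]; exact law_le_law hp fun ω => by simp +contextual
  · field_simp

/-- Mixtures, over a random variable, of points of a convex set. -/
lemma sum_law_smul_mem {E : Type*} [AddCommGroup E] [Module ℝ E] {s : Set E} (hs : Convex ℝ s)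
    [Fintype α] (hp : p ∈ stdSimplex ℝ Ω) (U : Ω → α) (z : α → E)
    (hz : ∀ u, law p U u ≠ 0 → z u ∈ s) : ∑ u, law p U u • z u ∈ s := by
  classical
  have h1 : ∑ u, law p U u • z u = ∑ u ∈ Finset.univ.filter (fun u => law p U u ≠ 0),
      law p U u • z u := by
    rw [Finset.sum_filter_of_ne]
    intro u _ h h0
    exact h (by rw [h0, zero_smul])
  rw [h1]
  refine hs.sum_mem (fun u _ => law_nonneg hp.1 _ _) ?_ (fun u hu => hz u (Finset.mem_filter.1 hu).2)
  rw [Finset.sum_filter_of_ne (fun u _ h => h), sum_law, hp.2]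

end Conditioning

section Vectors

variable {Ω α β γ X Y Y₁ Y₂ : Type*} [Fintype Ω] [Fintype X] [Fintype Y] [Fintype Y₁] [Fintype Y₂]
  [Fintype α] [Fintype β] [Fintype γ] {p : Ω → ℝ}

/-- Conditioning on U exhibits the vector as a mixture of points of the graph. The hypothesis says
that, given U, the law of Z is the image under W of the law of V. -/
lemma mem_envelope (hp : p ∈ stdSimplex ℝ Ω) (W : X → Y → ℝ) (U : Ω → α) (V : Ω → X) (Z : Ω → Y)
    (h : ∀ u y, law p (fun ω => (U ω, Z ω)) (u, y) =
      ∑ x, law p (fun ω => (U ω, V ω)) (u, x) * W x y) :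
    (law p V, ent p (fun ω => (U ω, V ω)) - ent p U, ent p (fun ω => (U ω, Z ω)) - ent p U) ∈
      envelope W := by
  have key := sum_law_smul_mem (s := envelope W) (convex_convexHull ℝ _) hp U
    (fun u => (law (condOn p U u) V, entFun (law (condOn p U u) V),
      entFun (output W (law (condOn p U u) V)))) (fun u hu => subset_convexHull ℝ _
      (Set.mem_image_of_mem (fun v => (v, entFun v, entFun (output W v)))
        (law_mem_stdSimplex (condOn_mem_stdSimplex hp.1 U hu) V)))
  have h2 : ∀ u, output W (law (condOn p U u) V) = law (condOn p U u) Z := by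
    intro u; funext y
    simp only [output, law_condOn, h, Finset.sum_div]
    exact Finset.sum_congr rfl fun x _ => by ring
  convert key using 1
  simp only [Prod.smul_mk, Prod.ext_iff, Prod.fst_sum, Prod.snd_sum, smul_eq_mul]
  refine ⟨?_, ?_, ?_⟩
  · funext x
    simp [Finset.sum_apply, sum_law_mul_law_condOn hp.1]
  · rw [ent_pair_sub_eq_sum_condOn hp.1]
    simp only [ent_eq_entFun]
  · rw [ent_pair_sub_eq_sum_condOn hp.1]
    simp only [ent_eq_entFun, h2]

/-- The entropy vector of auxiliary random variables. -/
lemma mem_entropyRegion (hp : p ∈ stdSimplex ℝ Ω) (W₁ : X → Y₁ → ℝ) (W₂ : X → Y₂ → ℝ)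
    (U₀ : Ω → α) (U₁ : Ω → β) (U₂ : Ω → γ) (V : Ω → X) (Z₁ : Ω → Y₁) (Z₂ : Ω → Y₂)
    (h₁ : ∀ u₀ u₁ y, law p (fun ω => ((U₀ ω, U₁ ω), Z₁ ω)) ((u₀, u₁), y) =
      ∑ x, law p (fun ω => ((U₀ ω, U₁ ω), V ω)) ((u₀, u₁), x) * W₁ x y)
    (h₂ : ∀ u₀ u₂ y, law p (fun ω => ((U₀ ω, U₂ ω), Z₂ ω)) ((u₀, u₂), y) =
      ∑ x, law p (fun ω => ((U₀ ω, U₂ ω), V ω)) ((u₀, u₂), x) * W₂ x y) :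
    (law p V, ent p (fun ω => (U₀ ω, V ω)) - ent p U₀,
      (ent p (fun ω => ((U₀ ω, U₁ ω), V ω)) - ent p (fun ω => (U₀ ω, U₁ ω)),
        ent p (fun ω => ((U₀ ω, U₁ ω), Z₁ ω)) - ent p (fun ω => (U₀ ω, U₁ ω))),
      (ent p (fun ω => ((U₀ ω, U₂ ω), V ω)) - ent p (fun ω => (U₀ ω, U₂ ω)),
        ent p (fun ω => ((U₀ ω, U₂ ω), Z₂ ω)) - ent p (fun ω => (U₀ ω, U₂ ω)))) ∈
      entropyRegion W₁ W₂ := by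
  -- Given U₀ = u, both receivers see the same conditional law of V and each contributes a point of
  -- its own envelope, which is a point of `layer`. Mixing over u gives the outer hull.
  have key := sum_law_smul_mem (s := entropyRegion W₁ W₂) (convex_convexHull ℝ _) hp U₀
    (fun u => (law (condOn p U₀ u) V, entFun (law (condOn p U₀ u) V),
      (ent (condOn p U₀ u) (fun ω => (U₁ ω, V ω)) - ent (condOn p U₀ u) U₁,
        ent (condOn p U₀ u) (fun ω => (U₁ ω, Z₁ ω)) - ent (condOn p U₀ u) U₁),
      (ent (condOn p U₀ u) (fun ω => (U₂ ω, V ω)) - ent (condOn p U₀ u) U₂,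
        ent (condOn p U₀ u) (fun ω => (U₂ ω, Z₂ ω)) - ent (condOn p U₀ u) U₂)))
    (fun u hu => by
      have hc := condOn_mem_stdSimplex hp.1 U₀ hu
      refine subset_convexHull ℝ _ ⟨law_mem_stdSimplex hc V, rfl,
        mem_envelope hc W₁ U₁ V Z₁ fun u₁ y => ?_, mem_envelope hc W₂ U₂ V Z₂ fun u₂ y => ?_⟩
      · simp only [law_condOn, div_mul_eq_mul_div, ← Finset.sum_div]
        congr 1
        rw [law_assoc, h₁]
        exact Finset.sum_congr rfl fun x _ => by rw [law_assoc]
      · simp only [law_condOn, div_mul_eq_mul_div, ← Finset.sum_div]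
        congr 1
        rw [law_assoc, h₂]
        exact Finset.sum_congr rfl fun x _ => by rw [law_assoc])
  convert key using 1
  simp only [Prod.smul_mk, Prod.ext_iff, Prod.fst_sum, Prod.snd_sum, smul_eq_mul, mul_sub,
    Finset.sum_sub_distrib, ← ent_pair_sub_eq_sum_condOn hp.1, ent_assoc, ← ent_eq_entFun]
  refine ⟨?_, trivial, ⟨by ring, by ring⟩, by ring, by ring⟩
  funext x
  simp [Finset.sum_apply, sum_law_mul_law_condOn hp.1]

end Vectors

/-- The marginal law of the source observed by the transmitter. -/
noncomputable def lawX {X Y : Type*} [Fintype X] [Fintype Y] (P : X × Y → ℝ) : X → ℝ :=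
  law P (fun ω => ω.1)

/-- First marginal of a channel with two outputs. -/
def chan₁ {X Y₁ Y₂ : Type*} [Fintype Y₂] (V : X → Y₁ × Y₂ → ℝ) (x : X) (y : Y₁) : ℝ :=
  ∑ y₂, V x (y, y₂)

/-- Second marginal of a channel with two outputs. -/
def chan₂ {X Y₁ Y₂ : Type*} [Fintype Y₁] (V : X → Y₁ × Y₂ → ℝ) (x : X) (y : Y₂) : ℝ :=
  ∑ y₁, V x (y₁, y)

/-- `V` is a version of the conditional law of the side information given the source. -/
structure IsChannelOf {X Y : Type*} [Fintype X] [Fintype Y] (P : X × Y → ℝ) (V : X → Y → ℝ) :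
    Prop where
  mem : ∀ x, V x ∈ stdSimplex ℝ Y
  eq : ∀ x y, P (x, y) = lawX P x * V x y

lemma law_apply_of_injective {Ω α : Type*} [Fintype Ω] (p : Ω → ℝ) {A : Ω → α}
    (hA : Function.Injective A) (ω : Ω) : law p A (A ω) = p ω := by
  classical
  simp [law_eq_sum, hA.eq_iff]

lemma lawX_eq_sum {X Y : Type*} [Fintype X] [Fintype Y] (P : X × Y → ℝ) (x : X) :
    lawX P x = ∑ y, P (x, y) := by
  rw [lawX, law_eq_sum_fst P _ (fun ω => ω.2)]
  exact Finset.sum_congr rfl fun y _ => law_apply_of_injective P Function.injective_id (x, y)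

/-- The conditional law of Y given X. Where P_X vanishes the row is irrelevant but must still be a
pmf; the marginal of Y is one at hand. -/
lemma exists_isChannelOf {X Y : Type*} [Fintype X] [Fintype Y] {P : X × Y → ℝ}
    (hP : P ∈ stdSimplex ℝ (X × Y)) : ∃ V, IsChannelOf P V := by
  classical
  refine ⟨fun x y => if lawX P x = 0 then law P Prod.snd y else P (x, y) / lawX P x,
    fun x => ?_, fun x y => ?_⟩
  · by_cases h : lawX P x = 0
    · simp only [h, if_true]; exact law_mem_stdSimplex hP Prod.snd
    · simp only [h, if_false]
      refine ⟨fun y => div_nonneg (hP.1 _) (law_nonneg hP.1 _ _), ?_⟩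
      rw [← Finset.sum_div, ← lawX_eq_sum, div_self h]
  · by_cases h : lawX P x = 0
    · simp only [h, zero_mul]
      rw [lawX_eq_sum] at h
      exact (Finset.sum_eq_zero_iff_of_nonneg fun y _ => hP.1 _).1 h y (Finset.mem_univ _)
    · simp only [h, if_false]; field_simp

open AuxSpace

/-! ### From auxiliary variables to entropy vectors. -/

section Forward

variable {X Y₁ Y₂ : Type*} [Fintype X] [Fintype Y₁] [Fintype Y₂]
  {P : X × Y₁ × Y₂ → ℝ} {V : X → Y₁ × Y₂ → ℝ} {k₀ k₁ k₂ : ℕ} {q : AuxSpace k₀ k₁ k₂ X Y₁ Y₂ → ℝ}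

/-- `q` is a joint law of auxiliary random variables and the source triple: the source triple has
law `P` and the auxiliary variables are conditionally independent of the side information given the
source. -/
def IsAuxLaw (P : X × Y₁ × Y₂ → ℝ) (q : AuxSpace k₀ k₁ k₂ X Y₁ Y₂ → ℝ) : Prop :=
  q ∈ stdSimplex ℝ (AuxSpace k₀ k₁ k₂ X Y₁ Y₂) ∧
    law q (fun ω => (srcX ω, srcY₁ ω, srcY₂ ω)) = P ∧
    IsMarkovChain q (fun ω => (U₀ ω, U₁ ω, U₂ ω)) srcX (fun ω => (srcY₁ ω, srcY₂ ω))

lemma IsAuxLaw.law_srcX (hq : IsAuxLaw P q) : law q srcX = lawX P := by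
  funext x
  rw [lawX, ← hq.2.1, law_law]

/-- The Markov chain in product form: q(u,x,y) = q(u,x) V(y|x). It cancels P_X from the definition;
where P_X(x) = 0 both sides vanish. -/
lemma IsAuxLaw.apply_eq (hq : IsAuxLaw P q) (hV : IsChannelOf P V)
    (ω : AuxSpace k₀ k₁ k₂ X Y₁ Y₂) :
    q ω = law q (fun ω => (ω.1, srcX ω)) (ω.1, srcX ω) * V (srcX ω) ω.2.2 := by
  have h := hq.2.2 ω.1 (srcX ω) ω.2.2
  have h1 : law q (fun ω => ((U₀ ω, U₁ ω, U₂ ω), srcX ω, (srcY₁ ω, srcY₂ ω)))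
      (ω.1, srcX ω, ω.2.2) = q ω :=
    law_apply_of_injective q (A := fun ω => ((U₀ ω, U₁ ω, U₂ ω), srcX ω, (srcY₁ ω, srcY₂ ω)))
      (fun _ _ h => h) ω
  have h2 : law q (fun ω => (srcX ω, (srcY₁ ω, srcY₂ ω))) (srcX ω, ω.2.2) =
      lawX P (srcX ω) * V (srcX ω) ω.2.2 := by
    rw [← hV.eq, ← hq.2.1]
  rw [h1, h2, hq.law_srcX] at h
  by_cases h0 : lawX P (srcX ω) = 0
  · have h3 : q ω ≤ 0 := by
      rw [← h0, ← hq.law_srcX]; exact le_law hq.1.1 srcX ω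
    have h4 : law q (fun ω => (ω.1, srcX ω)) (ω.1, srcX ω) ≤ 0 := by
      rw [← h0, ← hq.law_srcX]; exact law_le_law hq.1.1 fun ω' => by simp +contextual
    rw [le_antisymm h3 (hq.1.1 ω), le_antisymm h4 (law_nonneg hq.1.1 _ _), zero_mul]
  · have h5 : law q (fun ω => ((U₀ ω, U₁ ω, U₂ ω), srcX ω)) (ω.1, srcX ω) =
      law q (fun ω => (ω.1, srcX ω)) (ω.1, srcX ω) := rfl
    rw [h5] at h
    apply mul_right_cancel₀ h0
    linear_combination h

lemma IsAuxLaw.sum_mul (hq : IsAuxLaw P q) (hV : IsChannelOf P V)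
    (f : (Fin k₀ × Fin k₁ × Fin k₂) × X → Y₁ × Y₂ → ℝ) :
    ∑ ω, q ω * f (ω.1, srcX ω) ω.2.2 =
      ∑ ω, q ω * ∑ y, V (srcX ω) y * f (ω.1, srcX ω) y := by
  have h1 := sum_law_mul q (fun ω => (ω.1, srcX ω)) (fun a => ∑ y, V a.2 y * f a y)
  rw [← h1]
  simp only [Fintype.sum_prod_type, Finset.mul_sum]
  refine Finset.sum_congr rfl fun _ _ => Finset.sum_congr rfl fun _ _ =>
    Finset.sum_congr rfl fun _ _ => Finset.sum_congr rfl fun _ _ =>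
    Finset.sum_congr rfl fun _ _ => Finset.sum_congr rfl fun _ _ => ?_
  conv_lhs => rw [hq.apply_eq hV]
  simp only [srcX]
  ring

/-- F selects the part of the auxiliary variables that is kept: the pair seen by a receiver, or
nothing at all when only the law of the output is wanted. -/
lemma IsAuxLaw.law_pair₁ {α : Type*} [Fintype α] (hq : IsAuxLaw P q) (hV : IsChannelOf P V)
    (F : Fin k₀ × Fin k₁ × Fin k₂ → α) (a : α) (y : Y₁) :
    law q (fun ω => (F ω.1, srcY₁ ω)) (a, y) =
      ∑ x, law q (fun ω => (F ω.1, srcX ω)) (a, x) * chan₁ V x y := by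
  classical
  have h := hq.sum_mul hV fun u z => if F u.1 = a ∧ z.1 = y then 1 else 0
  have h2 := sum_law_mul q (fun ω => (F ω.1, srcX ω))
    (fun b => if b.1 = a then chan₁ V b.2 y else 0)
  rw [Fintype.sum_prod_type, Finset.sum_eq_single a (by simp +contextual) (by simp)] at h2
  simp only [if_true] at h2
  rw [h2, law_eq_sum]
  simp only [mul_ite, mul_one, mul_zero] at h
  simp only [Prod.mk.injEq]
  rw [show (∑ ω, if F ω.1 = a ∧ srcY₁ ω = y then q ω else 0) = _ from h]
  refine Finset.sum_congr rfl fun ω _ => ?_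
  congr 1
  by_cases h3 : F ω.1 = a
  · simp only [h3, true_and, if_true, chan₁, Fintype.sum_prod_type]
    rw [Finset.sum_eq_single y (by simp +contextual) (by simp)]
    simp
  · simp [h3]

lemma IsAuxLaw.law_pair₂ {α : Type*} [Fintype α] (hq : IsAuxLaw P q) (hV : IsChannelOf P V)
    (F : Fin k₀ × Fin k₁ × Fin k₂ → α) (a : α) (y : Y₂) :
    law q (fun ω => (F ω.1, srcY₂ ω)) (a, y) =
      ∑ x, law q (fun ω => (F ω.1, srcX ω)) (a, x) * chan₂ V x y := by
  classical
  have h := hq.sum_mul hV fun u z => if F u.1 = a ∧ z.2 = y then 1 else 0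
  have h2 := sum_law_mul q (fun ω => (F ω.1, srcX ω))
    (fun b => if b.1 = a then chan₂ V b.2 y else 0)
  rw [Fintype.sum_prod_type, Finset.sum_eq_single a (by simp +contextual) (by simp)] at h2
  simp only [if_true] at h2
  rw [h2, law_eq_sum]
  simp only [mul_ite, mul_one, mul_zero] at h
  simp only [Prod.mk.injEq]
  rw [show (∑ ω, if F ω.1 = a ∧ srcY₂ ω = y then q ω else 0) = _ from h]
  refine Finset.sum_congr rfl fun ω _ => ?_
  congr 1
  by_cases h3 : F ω.1 = a
  · simp only [h3, true_and, if_true, chan₂, Fintype.sum_prod_type_right]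
    rw [Finset.sum_eq_single y (by simp +contextual) (by simp)]
    simp
  · simp [h3]

lemma IsAuxLaw.law_srcY₁ (hq : IsAuxLaw P q) (hV : IsChannelOf P V) :
    law q srcY₁ = output (chan₁ V) (lawX P) := by
  funext y
  have := hq.law_pair₁ hV (fun _ => ()) () y
  rw [law_congr_iff (B := fun ω => ((), srcY₁ ω)) (b := ((), y)) (by simp), this, output]
  refine Finset.sum_congr rfl fun x _ => ?_
  rw [← hq.law_srcX]
  congr 1
  exact law_congr_iff (by simp)

lemma IsAuxLaw.law_srcY₂ (hq : IsAuxLaw P q) (hV : IsChannelOf P V) :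
    law q srcY₂ = output (chan₂ V) (lawX P) := by
  funext y
  have := hq.law_pair₂ hV (fun _ => ()) () y
  rw [law_congr_iff (B := fun ω => ((), srcY₂ ω)) (b := ((), y)) (by simp), this, output]
  refine Finset.sum_congr rfl fun x _ => ?_
  rw [← hq.law_srcX]
  congr 1
  exact law_congr_iff (by simp)

/-- `q` has the information quantities that correspond to the entropy vector `z`. -/
def HasEntropyVector (P : X × Y₁ × Y₂ → ℝ) (V : X → Y₁ × Y₂ → ℝ)
    (q : AuxSpace k₀ k₁ k₂ X Y₁ Y₂ → ℝ) (z : (X → ℝ) × ℝ × (ℝ × ℝ) × (ℝ × ℝ)) : Prop :=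
  mutualInfo q U₀ srcX = entFun (lawX P) - z.2.1 ∧
  condMutualInfo q U₁ srcX U₀ = z.2.1 - z.2.2.1.1 ∧
  condMutualInfo q U₂ srcX U₀ = z.2.1 - z.2.2.2.1 ∧
  mutualInfo q (fun ω => (U₀ ω, U₁ ω)) srcY₁ = entFun (output (chan₁ V) (lawX P)) - z.2.2.1.2 ∧
  mutualInfo q (fun ω => (U₀ ω, U₂ ω)) srcY₂ = entFun (output (chan₂ V) (lawX P)) - z.2.2.2.2

/-- The entropies of X, Y₁ and Y₂ are determined by P, so only conditional entropies vary and the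
five informations are affine in the vector. -/
lemma IsAuxLaw.hasEntropyVector (hq : IsAuxLaw P q) (hV : IsChannelOf P V) :
    HasEntropyVector P V q
      (law q srcX, ent q (fun ω => (U₀ ω, srcX ω)) - ent q U₀,
      (ent q (fun ω => ((U₀ ω, U₁ ω), srcX ω)) - ent q (fun ω => (U₀ ω, U₁ ω)),
        ent q (fun ω => ((U₀ ω, U₁ ω), srcY₁ ω)) - ent q (fun ω => (U₀ ω, U₁ ω))),
      (ent q (fun ω => ((U₀ ω, U₂ ω), srcX ω)) - ent q (fun ω => (U₀ ω, U₂ ω)),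
        ent q (fun ω => ((U₀ ω, U₂ ω), srcY₂ ω)) - ent q (fun ω => (U₀ ω, U₂ ω)))) := by
  have s1 : ent q (fun ω => (srcX ω, U₀ ω)) = ent q (fun ω => (U₀ ω, srcX ω)) :=
    ent_congr (by simp [and_comm])
  have s2 : ent q (fun ω => (U₁ ω, U₀ ω)) = ent q (fun ω => (U₀ ω, U₁ ω)) :=
    ent_congr (by simp [and_comm])
  have s3 : ent q (fun ω => (U₂ ω, U₀ ω)) = ent q (fun ω => (U₀ ω, U₂ ω)) :=
    ent_congr (by simp [and_comm])
  have s4 : ent q (fun ω => (U₁ ω, srcX ω, U₀ ω)) = ent q (fun ω => ((U₀ ω, U₁ ω), srcX ω)) :=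
    ent_congr (by simp; tauto)
  have s5 : ent q (fun ω => (U₂ ω, srcX ω, U₀ ω)) = ent q (fun ω => ((U₀ ω, U₂ ω), srcX ω)) :=
    ent_congr (by simp; tauto)
  refine ⟨?_, ?_, ?_, ?_, ?_⟩
  · rw [mutualInfo_eq_ent hq.1.1, ent_eq_entFun q srcX, hq.law_srcX]; ring
  · rw [condMutualInfo_eq_ent hq.1.1, s1, s2, s4]; ring
  · rw [condMutualInfo_eq_ent hq.1.1, s1, s3, s5]; ring
  · rw [mutualInfo_eq_ent hq.1.1, ent_eq_entFun q srcY₁, hq.law_srcY₁ hV]; ring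
  · rw [mutualInfo_eq_ent hq.1.1, ent_eq_entFun q srcY₂, hq.law_srcY₂ hV]; ring

lemma IsAuxLaw.exists_entropyVector (hq : IsAuxLaw P q) (hV : IsChannelOf P V) :
    ∃ z ∈ entropyRegion (chan₁ V) (chan₂ V), z.1 = lawX P ∧ HasEntropyVector P V q z :=
  ⟨_, mem_entropyRegion hq.1 (chan₁ V) (chan₂ V) U₀ U₁ U₂ srcX srcY₁ srcY₂
    (fun u₀ u₁ y => hq.law_pair₁ hV (fun u => (u.1, u.2.1)) (u₀, u₁) y)
    (fun u₀ u₂ y => hq.law_pair₂ hV (fun u => (u.1, u.2.2)) (u₀, u₂) y),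
    hq.law_srcX, hq.hasEntropyVector hV⟩

end Forward

/-! ### From entropy vectors to auxiliary variables. -/

section Backward

variable {X Y Y₁ Y₂ : Type*} [Fintype X] [Fintype Y] [Fintype Y₁] [Fintype Y₂]

lemma exists_of_mem_envelope {W : X → Y → ℝ} {v : X → ℝ} {h : ℝ × ℝ} (hz : (v, h) ∈ envelope W) :
    ∃ (ι : Type) (_ : Fintype ι) (w : ι → ℝ) (u : ι → X → ℝ), w ∈ stdSimplex ℝ ι ∧
      (∀ i, u i ∈ stdSimplex ℝ X) ∧ (∀ x, ∑ i, w i * u i x = v x) ∧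
      ∑ i, w i * entFun (u i) = h.1 ∧ ∑ i, w i * entFun (output W (u i)) = h.2 := by
  obtain ⟨ι, hι, w, z, hw, hw1, hz, hx⟩ := mem_convexHull_iff_exists_fintype.1 hz
  choose u hu huz using hz
  refine ⟨ι, hι, w, u, ⟨hw, hw1⟩, hu, ?_⟩
  simp only [← huz, Prod.smul_mk, Prod.ext_iff, Prod.fst_sum, Prod.snd_sum, smul_eq_mul] at hx
  refine ⟨fun x => ?_, hx.2.1, hx.2.2⟩
  have := congrFun hx.1 x
  simpa [Finset.sum_apply] using this

/-- Finite-alphabet test channels realizing a point of the entropy region. -/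
lemma exists_of_mem_entropyRegion {W₁ : X → Y₁ → ℝ} {W₂ : X → Y₂ → ℝ}
    {z : (X → ℝ) × ℝ × (ℝ × ℝ) × (ℝ × ℝ)} (hz : z ∈ entropyRegion W₁ W₂) :
    ∃ (k₀ k₁ k₂ : ℕ) (w₀ : Fin k₀ → ℝ) (μ : Fin k₀ → X → ℝ)
      (w₁ : Fin k₀ → Fin k₁ → ℝ) (v₁ : Fin k₁ → X → ℝ)
      (w₂ : Fin k₀ → Fin k₂ → ℝ) (v₂ : Fin k₂ → X → ℝ),
      w₀ ∈ stdSimplex ℝ (Fin k₀) ∧ (∀ i, μ i ∈ stdSimplex ℝ X) ∧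
      (∀ i, w₁ i ∈ stdSimplex ℝ (Fin k₁)) ∧ (∀ j, v₁ j ∈ stdSimplex ℝ X) ∧
      (∀ i, w₂ i ∈ stdSimplex ℝ (Fin k₂)) ∧ (∀ j, v₂ j ∈ stdSimplex ℝ X) ∧
      (∀ i x, ∑ j, w₁ i j * v₁ j x = μ i x) ∧ (∀ i x, ∑ j, w₂ i j * v₂ j x = μ i x) ∧
      (∀ x, ∑ i, w₀ i * μ i x = z.1 x) ∧ ∑ i, w₀ i * entFun (μ i) = z.2.1 ∧
      ∑ i, w₀ i * ∑ j, w₁ i j * entFun (v₁ j) = z.2.2.1.1 ∧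
      ∑ i, w₀ i * ∑ j, w₁ i j * entFun (output W₁ (v₁ j)) = z.2.2.1.2 ∧
      ∑ i, w₀ i * ∑ j, w₂ i j * entFun (v₂ j) = z.2.2.2.1 ∧
      ∑ i, w₀ i * ∑ j, w₂ i j * entFun (output W₂ (v₂ j)) = z.2.2.2.2 := by
  classical
  obtain ⟨ι, hι, w, y, hw, hw1, hy, hx⟩ := mem_convexHull_iff_exists_fintype.1 hz
  choose hμ ha hy₁ hy₂ using hy
  choose J₁ hJ₁ w₁ v₁ hw₁ hv₁ hm₁ he₁ ho₁ using fun i => exists_of_mem_envelope (hy₁ i)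
  choose J₂ hJ₂ w₂ v₂ hw₂ hv₂ hm₂ he₂ ho₂ using fun i => exists_of_mem_envelope (hy₂ i)
  let e₀ := (Fintype.equivFin ι).symm
  -- The decomposition at the receiver has an index type depending on the cloud value i. The
  -- alphabet of U₁ is the disjoint union of these types, with weights that vanish outside block i;
  -- likewise for U₂.
  let e₁ := (Fintype.equivFin (Σ i, J₁ i)).symm
  let e₂ := (Fintype.equivFin (Σ i, J₂ i)).symm
  have sum₁ : ∀ i (f : (Σ i, J₁ i) → ℝ),
      ∑ j, (if (e₁ j).1 = i then w₁ (e₁ j).1 (e₁ j).2 else 0) * f (e₁ j) =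
        ∑ l, w₁ i l * f ⟨i, l⟩ := by
    intro i f
    rw [e₁.sum_comp (fun j => (if j.1 = i then w₁ j.1 j.2 else 0) * f j), Fintype.sum_sigma,
      Finset.sum_eq_single i (by simp +contextual) (by simp)]
    simp
  have sum₂ : ∀ i (f : (Σ i, J₂ i) → ℝ),
      ∑ j, (if (e₂ j).1 = i then w₂ (e₂ j).1 (e₂ j).2 else 0) * f (e₂ j) =
        ∑ l, w₂ i l * f ⟨i, l⟩ := by
    intro i f
    rw [e₂.sum_comp (fun j => (if j.1 = i then w₂ j.1 j.2 else 0) * f j), Fintype.sum_sigma,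
      Finset.sum_eq_single i (by simp +contextual) (by simp)]
    simp
  simp only [Prod.ext_iff, Prod.fst_sum, Prod.snd_sum, smul_eq_mul, Prod.smul_fst,
    Prod.smul_snd] at hx
  refine ⟨_, _, _, fun i => w (e₀ i), fun i => (y (e₀ i)).1,
    fun i j => if (e₁ j).1 = e₀ i then w₁ (e₁ j).1 (e₁ j).2 else 0, fun j => v₁ (e₁ j).1 (e₁ j).2,
    fun i j => if (e₂ j).1 = e₀ i then w₂ (e₂ j).1 (e₂ j).2 else 0, fun j => v₂ (e₂ j).1 (e₂ j).2,
    ⟨fun i => hw _, ?_⟩, fun i => hμ _, fun i => ⟨fun j => ?_, ?_⟩, fun j => hv₁ _ _,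
    fun i => ⟨fun j => ?_, ?_⟩, fun j => hv₂ _ _, fun i x => ?_, fun i x => ?_, fun x => ?_, ?_,
    ?_, ?_, ?_, ?_⟩
  · rw [e₀.sum_comp w, hw1]
  · dsimp only; split_ifs
    · exact (hw₁ _).1 _
    · exact le_rfl
  · have := sum₁ (e₀ i) (fun _ => 1)
    simp only [mul_one] at this
    rw [this, (hw₁ _).2]
  · dsimp only; split_ifs
    · exact (hw₂ _).1 _
    · exact le_rfl
  · have := sum₂ (e₀ i) (fun _ => 1)
    simp only [mul_one] at this
    rw [this, (hw₂ _).2]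
  · rw [sum₁ (e₀ i) (fun j => v₁ j.1 j.2 x), hm₁]
  · rw [sum₂ (e₀ i) (fun j => v₂ j.1 j.2 x), hm₂]
  · rw [e₀.sum_comp (fun i => w i * (y i).1 x), ← hx.1]
    simp [Finset.sum_apply]
  · rw [e₀.sum_comp (fun i => w i * entFun (y i).1), ← hx.2.1]
    exact Finset.sum_congr rfl fun i _ => by rw [ha]
  · simp only [fun i => sum₁ (e₀ i) (fun j => entFun (v₁ j.1 j.2)), he₁]
    rw [e₀.sum_comp (fun i => w i * (y i).2.2.1.1), ← hx.2.2.1.1]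
  · simp only [fun i => sum₁ (e₀ i) (fun j => entFun (output W₁ (v₁ j.1 j.2))), ho₁]
    rw [e₀.sum_comp (fun i => w i * (y i).2.2.1.2), ← hx.2.2.1.2]
  · simp only [fun i => sum₂ (e₀ i) (fun j => entFun (v₂ j.1 j.2)), he₂]
    rw [e₀.sum_comp (fun i => w i * (y i).2.2.2.1), ← hx.2.2.2.1]
  · simp only [fun i => sum₂ (e₀ i) (fun j => entFun (output W₂ (v₂ j.1 j.2))), ho₂]
    rw [e₀.sum_comp (fun i => w i * (y i).2.2.2.2), ← hx.2.2.2.2]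

end Backward

open AuxSpace

section Backward

variable {X Y₁ Y₂ : Type*} [Fintype X] [Fintype Y₁] [Fintype Y₂]

/-- The vector constrains only the laws of (U₀,U₁,X) and (U₀,U₂,X). These share the marginal (U₀,X),
so they can be glued by conditional independence of U₁ and U₂ given (U₀,X). -/
theorem exists_isAuxLaw {P : X × Y₁ × Y₂ → ℝ} {V : X → Y₁ × Y₂ → ℝ} (hV : IsChannelOf P V)
    {z : (X → ℝ) × ℝ × (ℝ × ℝ) × (ℝ × ℝ)} (hz : z ∈ entropyRegion (chan₁ V) (chan₂ V))
    (hzP : z.1 = lawX P) :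
    ∃ (k₀ k₁ k₂ : ℕ) (q : AuxSpace k₀ k₁ k₂ X Y₁ Y₂ → ℝ), IsAuxLaw P q ∧
      HasEntropyVector P V q z := by
  classical
  obtain ⟨k₀, k₁, k₂, w₀, μ, w₁, v₁, w₂, v₂, hw₀, hμ, hw₁, hv₁, hw₂, hv₂, hm₁, hm₂, hx, ha, he₁,
    ho₁, he₂, ho₂⟩ := exists_of_mem_entropyRegion hz
  rw [hzP] at hx
  -- Here μ is the law of X given U₀, and w₁v₁, w₂v₂ are the laws of (U₁,X), (U₂,X) given U₀. Both
  -- numerators vanish where μ does (`hz₁`, `hz₂`), so division by zero does no harm.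
  let q : AuxSpace k₀ k₁ k₂ X Y₁ Y₂ → ℝ := fun ω =>
    w₀ (U₀ ω) * (w₁ (U₀ ω) (U₁ ω) * v₁ (U₁ ω) (srcX ω)) *
      (w₂ (U₀ ω) (U₂ ω) * v₂ (U₂ ω) (srcX ω)) / μ (U₀ ω) (srcX ω) * V (srcX ω) ω.2.2
  have hq0 : ∀ ω, 0 ≤ q ω := fun ω =>
    mul_nonneg (div_nonneg (mul_nonneg (mul_nonneg (hw₀.1 _) (mul_nonneg ((hw₁ _).1 _)
      ((hv₁ _).1 _))) (mul_nonneg ((hw₂ _).1 _) ((hv₂ _).1 _))) ((hμ _).1 _)) ((hV.mem _).1 _)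
  have hz₁ : ∀ i j x, μ i x = 0 → w₁ i j * v₁ j x = 0 := fun i j x h => by
    rw [← hm₁] at h
    exact (Finset.sum_eq_zero_iff_of_nonneg fun j _ => mul_nonneg ((hw₁ _).1 _) ((hv₁ _).1 _)).1 h
      j (Finset.mem_univ _)
  have hz₂ : ∀ i j x, μ i x = 0 → w₂ i j * v₂ j x = 0 := fun i j x h => by
    rw [← hm₂] at h
    exact (Finset.sum_eq_zero_iff_of_nonneg fun j _ => mul_nonneg ((hw₂ _).1 _) ((hv₂ _).1 _)).1 h
      j (Finset.mem_univ _)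
  -- joint laws
  have l_all : ∀ u x y, law q (fun ω => ((ω.1, srcX ω), ω.2.2)) ((u, x), y) = q (u, x, y) :=
    fun u x y => law_apply_of_injective q (A := fun ω => ((ω.1, srcX ω), ω.2.2))
      (fun a b h => by simp only [srcX, Prod.ext_iff] at h ⊢; tauto) (u, x, y)
  have lUX : ∀ i j l x, law q (fun ω => (ω.1, srcX ω)) ((i, j, l), x) =
      w₀ i * (w₁ i j * v₁ j x) * (w₂ i l * v₂ l x) / μ i x := by
    intro i j l x
    rw [law_eq_sum_fst q _ (fun ω => ω.2.2)]
    simp only [l_all]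
    change ∑ y, w₀ i * (w₁ i j * v₁ j x) * (w₂ i l * v₂ l x) / μ i x * V x y = _
    rw [← Finset.mul_sum, (hV.mem x).2, mul_one]
  have l01X : ∀ i j x, law q (fun ω => ((U₀ ω, U₁ ω), srcX ω)) ((i, j), x) =
      w₀ i * w₁ i j * v₁ j x := by
    intro i j x
    rw [law_eq_sum_fst q _ U₂]
    have : ∀ l, law q (fun ω => (((U₀ ω, U₁ ω), srcX ω), U₂ ω)) (((i, j), x), l) =
        w₀ i * (w₁ i j * v₁ j x) * (w₂ i l * v₂ l x) / μ i x := fun l => by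
      rw [← lUX]
      exact law_congr_iff fun ω => by simp only [U₀, U₁, U₂, Prod.ext_iff]; tauto
    simp only [this]
    rw [← Finset.sum_div, ← Finset.mul_sum, hm₂]
    by_cases h : μ i x = 0
    · rw [h, mul_zero, zero_div, mul_assoc, hz₁ i j x h, mul_zero]
    · field_simp
  have l02X : ∀ i l x, law q (fun ω => ((U₀ ω, U₂ ω), srcX ω)) ((i, l), x) =
      w₀ i * w₂ i l * v₂ l x := by
    intro i l x
    rw [law_eq_sum_fst q _ U₁]
    have : ∀ j, law q (fun ω => (((U₀ ω, U₂ ω), srcX ω), U₁ ω)) (((i, l), x), j) =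
        (w₁ i j * v₁ j x) * (w₀ i * (w₂ i l * v₂ l x)) / μ i x := fun j => by
      rw [show (w₁ i j * v₁ j x) * (w₀ i * (w₂ i l * v₂ l x)) / μ i x =
        w₀ i * (w₁ i j * v₁ j x) * (w₂ i l * v₂ l x) / μ i x by ring, ← lUX]
      exact law_congr_iff fun ω => by simp only [U₀, U₁, U₂, Prod.ext_iff]; tauto
    simp only [this]
    rw [← Finset.sum_div, ← Finset.sum_mul, hm₁]
    by_cases h : μ i x = 0
    · rw [h, zero_mul, zero_div, mul_assoc, hz₂ i l x h, mul_zero]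
    · field_simp
  have l01 : ∀ i j, law q (fun ω => (U₀ ω, U₁ ω)) (i, j) = w₀ i * w₁ i j := by
    intro i j
    rw [law_eq_sum_fst q _ srcX]
    simp only [l01X]
    rw [← Finset.mul_sum, (hv₁ j).2, mul_one]
  have l02 : ∀ i l, law q (fun ω => (U₀ ω, U₂ ω)) (i, l) = w₀ i * w₂ i l := by
    intro i l
    rw [law_eq_sum_fst q _ srcX]
    simp only [l02X]
    rw [← Finset.mul_sum, (hv₂ l).2, mul_one]
  have l0 : ∀ i, law q U₀ i = w₀ i := by
    intro i
    rw [law_eq_sum_fst q _ U₁]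
    simp only [l01]
    rw [← Finset.mul_sum, (hw₁ i).2, mul_one]
  have l0X : ∀ i x, law q (fun ω => (U₀ ω, srcX ω)) (i, x) = w₀ i * μ i x := by
    intro i x
    rw [law_eq_sum_fst q _ U₁, ← hm₁, Finset.mul_sum]
    refine Finset.sum_congr rfl fun j _ => ?_
    rw [← mul_assoc, ← l01X]
    exact law_congr_iff fun ω => by simp only [Prod.ext_iff]; tauto
  have lX : ∀ x, law q srcX x = lawX P x := by
    intro x
    rw [law_eq_sum_snd q U₀ srcX, ← hx]
    simp only [l0X]
  have lXY : ∀ x y, law q (fun ω => (srcX ω, ω.2.2)) (x, y) = P (x, y) := by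
    intro x y
    rw [law_eq_sum_snd q (fun ω => ω.1), hV.eq, ← lX, law_eq_sum_snd q (fun ω => ω.1) srcX,
      Finset.sum_mul]
    refine Finset.sum_congr rfl fun u _ => ?_
    rw [law_assoc, l_all]
    obtain ⟨i, j, l⟩ := u
    rw [lUX]
    rfl
  have hq : IsAuxLaw P q := by
    refine ⟨⟨hq0, ?_⟩, ?_, ?_⟩
    · rw [← sum_law q U₀]
      simp only [l0]; exact hw₀.2
    · funext s
      rw [← lXY]; rfl
    · rintro ⟨i, j, l⟩ x y
      have h1 : law q (fun ω => ((U₀ ω, U₁ ω, U₂ ω), srcX ω, (srcY₁ ω, srcY₂ ω)))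
          ((i, j, l), x, y) = q ((i, j, l), x, y) :=
        law_apply_of_injective q
          (A := fun ω => ((U₀ ω, U₁ ω, U₂ ω), srcX ω, (srcY₁ ω, srcY₂ ω)))
          (fun _ _ h => h) ((i, j, l), x, y)
      have h2 : law q (fun ω => (srcX ω, (srcY₁ ω, srcY₂ ω))) (x, y) = lawX P x * V x y := by
        rw [← hV.eq, ← lXY]; rfl
      have h3 : law q (fun ω => ((U₀ ω, U₁ ω, U₂ ω), srcX ω)) ((i, j, l), x) =
        w₀ i * (w₁ i j * v₁ j x) * (w₂ i l * v₂ l x) / μ i x := by rw [← lUX]; rfl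
      rw [h1, h2, h3, lX]
      simp only [q, U₀, U₁, U₂, srcX]
      ring
  refine ⟨k₀, k₁, k₂, q, hq, ?_⟩
  have hh := hq.hasEntropyVector hV
  have e0 : ent q (fun ω => (U₀ ω, srcX ω)) - ent q U₀ = z.2.1 := by
    rw [ent_pair_sub_of_kernel hq0 U₀ srcX μ (fun i x => by rw [l0X, l0]), ← ha]
    simp only [l0]
  have e1 : ent q (fun ω => ((U₀ ω, U₁ ω), srcX ω)) - ent q (fun ω => (U₀ ω, U₁ ω)) =
      z.2.2.1.1 := by
    rw [ent_pair_sub_of_kernel hq0 _ srcX (fun u => v₁ u.2)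
      (fun u x => by obtain ⟨i, j⟩ := u; rw [l01X, l01]), ← he₁, Fintype.sum_prod_type]
    simp only [l01, Finset.mul_sum, mul_assoc]
  have e2 : ent q (fun ω => ((U₀ ω, U₂ ω), srcX ω)) - ent q (fun ω => (U₀ ω, U₂ ω)) =
      z.2.2.2.1 := by
    rw [ent_pair_sub_of_kernel hq0 _ srcX (fun u => v₂ u.2)
      (fun u x => by obtain ⟨i, j⟩ := u; rw [l02X, l02]), ← he₂, Fintype.sum_prod_type]
    simp only [l02, Finset.mul_sum, mul_assoc]
  have o1 : ent q (fun ω => ((U₀ ω, U₁ ω), srcY₁ ω)) - ent q (fun ω => (U₀ ω, U₁ ω)) =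
      z.2.2.1.2 := by
    rw [ent_pair_sub_of_kernel hq0 _ srcY₁ (fun u => output (chan₁ V) (v₁ u.2))
      (fun u y => by
        refine (hq.law_pair₁ hV (fun u => (u.1, u.2.1)) u y).trans ?_
        rw [output, Finset.mul_sum]
        obtain ⟨i, j⟩ := u
        refine Finset.sum_congr rfl fun x _ => ?_
        rw [l01, ← mul_assoc]
        exact congrArg (· * _) (l01X i j x)), ← ho₁, Fintype.sum_prod_type]
    simp only [l01, Finset.mul_sum, mul_assoc]
  have o2 : ent q (fun ω => ((U₀ ω, U₂ ω), srcY₂ ω)) - ent q (fun ω => (U₀ ω, U₂ ω)) =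
      z.2.2.2.2 := by
    rw [ent_pair_sub_of_kernel hq0 _ srcY₂ (fun u => output (chan₂ V) (v₂ u.2))
      (fun u y => by
        refine (hq.law_pair₂ hV (fun u => (u.1, u.2.2)) u y).trans ?_
        rw [output, Finset.mul_sum]
        obtain ⟨i, j⟩ := u
        refine Finset.sum_congr rfl fun x _ => ?_
        rw [l02, ← mul_assoc]
        exact congrArg (· * _) (l02X i j x)), ← ho₂, Fintype.sum_prod_type]
    simp only [l02, Finset.mul_sum, mul_assoc]
  rw [e0, e1, e2, o1, o2] at hh
  exact hh

end Backward

/-! ### Blocks and outputs of memoryless channels. -/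

section Blocks

variable {Y : Type*} [Fintype Y]

lemma sum_prod_pi {ι : Type*} [Fintype ι] [DecidableEq ι] (f : ι → Y → ℝ) :
    ∑ y : ι → Y, ∏ i, f i (y i) = ∏ i, ∑ a, f i a := by
  rw [Finset.prod_univ_sum, Fintype.piFinset_univ]

lemma sum_fin_succ {n : ℕ} (g : (Fin (n + 1) → Y) → ℝ) :
    ∑ y, g y = ∑ a, ∑ y' : Fin n → Y, g (Fin.cons a y') := by
  rw [← (Fin.consEquiv fun _ : Fin (n + 1) => Y).sum_comp g, Fintype.sum_prod_type]
  rfl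

omit [Fintype Y] in
lemma eq_iff_head_tail {n : ℕ} (x y : Fin (n + 1) → Y) :
    x = y ↔ x 0 = y 0 ∧ Fin.tail x = Fin.tail y := by
  refine ⟨fun h => by simp [h], fun h => ?_⟩
  rw [← Fin.cons_self_tail x, ← Fin.cons_self_tail y, h.1, h.2]

omit [Fintype Y] in
lemma eq_cons_iff {n : ℕ} (x : Fin (n + 1) → Y) (a : Y) (y : Fin n → Y) :
    x = Fin.cons a y ↔ x 0 = a ∧ Fin.tail x = y := by
  rw [eq_iff_head_tail]; simp

end Blocks

section Outputs

variable {Ω X Y β γ : Type*} [Fintype Ω] [Fintype X] [Fintype Y] {n : ℕ}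

/-- Given `(M, X^n)`, the block `Y^n` is the output of the memoryless channel `W` with input
`X^n`. -/
def IsOutput (p : Ω → ℝ) (W : X → Y → ℝ) (M : Ω → β) (Xs : Ω → Fin n → X) (Ys : Ω → Fin n → Y) :
    Prop :=
  ∀ f : β → (Fin n → X) → (Fin n → Y) → ℝ, ∑ ω, p ω * f (M ω) (Xs ω) (Ys ω) =
    ∑ ω, p ω * ∑ y : Fin n → Y, (∏ i, W (Xs ω i) (y i)) * f (M ω) (Xs ω) y

omit [Fintype X] in
lemma IsOutput.comp {p : Ω → ℝ} {W : X → Y → ℝ} {M : Ω → β} {Xs : Ω → Fin n → X}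
    {Ys : Ω → Fin n → Y} (h : IsOutput p W M Xs Ys) (g : β → γ) :
    IsOutput p W (fun ω => g (M ω)) Xs Ys :=
  fun f => h fun b => f (g b)

variable {p : Ω → ℝ} {W : X → Y → ℝ} {M : Ω → β} {Xs : Ω → Fin (n + 1) → X}
  {Ys : Ω → Fin (n + 1) → Y}

-- The first output letter is integrated out while the first input letter joins the side
-- information. Iterating this is what puts X^{t-1} into U₀.
omit [Fintype X] in
lemma IsOutput.tail (hW : ∀ x, ∑ y, W x y = 1) (h : IsOutput p W M Xs Ys) :
    IsOutput p W (fun ω => (M ω, Xs ω 0)) (fun ω => Fin.tail (Xs ω)) (fun ω => Fin.tail (Ys ω)) := by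
  intro f
  refine (h fun m x y => f (m, x 0) (Fin.tail x) (Fin.tail y)).trans ?_
  refine Finset.sum_congr rfl fun ω _ => ?_
  congr 1
  rw [sum_fin_succ]
  simp only [Fin.prod_univ_succ, Fin.cons_zero, Fin.cons_succ, Fin.tail_cons, mul_assoc,
    ← Finset.mul_sum]
  rw [← Finset.sum_mul, hW, one_mul]
  rfl

omit [Fintype X] in
lemma IsOutput.sum_head (hW : ∀ x, ∑ y, W x y = 1) (h : IsOutput p W M Xs Ys)
    (f : β → X → Y → ℝ) : ∑ ω, p ω * f (M ω) (Xs ω 0) (Ys ω 0) =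
      ∑ ω, p ω * ∑ y, W (Xs ω 0) y * f (M ω) (Xs ω 0) y := by
  refine (h fun m x y => f m (x 0) (y 0)).trans ?_
  refine Finset.sum_congr rfl fun ω _ => ?_
  congr 1
  rw [sum_fin_succ]
  simp only [Fin.prod_univ_succ, Fin.cons_zero, Fin.cons_succ, ← Finset.mul_sum, ← Finset.sum_mul]
  rw [sum_prod_pi (fun (i : Fin n) y => W (Xs ω i.succ) y)]
  simp [hW]

lemma IsOutput.law_head [Fintype β] (hW : ∀ x, ∑ y, W x y = 1) (h : IsOutput p W M Xs Ys)
    (m : β) (y : Y) : law p (fun ω => (M ω, Ys ω 0)) (m, y) =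
      ∑ x, law p (fun ω => (M ω, Xs ω 0)) (m, x) * W x y := by
  classical
  have h1 := h.sum_head hW fun m' _ y' => if m' = m ∧ y' = y then 1 else 0
  have h2 := sum_law_mul p (fun ω => (M ω, Xs ω 0)) (fun b => if b.1 = m then W b.2 y else 0)
  rw [Fintype.sum_prod_type, Finset.sum_eq_single m (by simp +contextual) (by simp)] at h2
  simp only [if_true] at h2
  rw [h2, law_eq_sum]
  simp only [mul_ite, mul_one, mul_zero] at h1
  simp only [Prod.mk.injEq]
  rw [h1]
  refine Finset.sum_congr rfl fun ω _ => ?_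
  by_cases h3 : M ω = m <;> simp [h3]

omit [Fintype X] in
lemma IsOutput.law_head_input (hW : ∀ x, ∑ y, W x y = 1) (h : IsOutput p W M Xs Ys)
    (y : Y) (m : β) (x : X) : law p (fun ω => (Ys ω 0, (M ω, Xs ω 0))) (y, (m, x)) =
      W x y * law p (fun ω => (M ω, Xs ω 0)) (m, x) := by
  classical
  have h1 := h.sum_head hW fun m' x' y' => if y' = y ∧ m' = m ∧ x' = x then 1 else 0
  simp only [mul_ite, mul_one, mul_zero] at h1
  rw [law_eq_sum, law_eq_sum, Finset.mul_sum]
  simp only [Prod.mk.injEq]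
  rw [h1]
  refine Finset.sum_congr rfl fun ω _ => ?_
  by_cases h3 : M ω = m <;> by_cases h4 : Xs ω 0 = x <;> simp [h3, h4, mul_comm]

-- With `IsOutput.law_head_input`: given (M, X₀), the first output letter is independent of the
-- later ones.
omit [Fintype X] in
lemma IsOutput.law_head_tail (hW : ∀ x, ∑ y, W x y = 1) (h : IsOutput p W M Xs Ys)
    (y : Y) (y' : Fin n → Y) (m : β) (x : X) :
    law p (fun ω => (Ys ω 0, Fin.tail (Ys ω), (M ω, Xs ω 0))) (y, y', (m, x)) =
      W x y * law p (fun ω => (Fin.tail (Ys ω), (M ω, Xs ω 0))) (y', (m, x)) := by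
  classical
  have h1 := h fun m' x' z => if z 0 = y ∧ Fin.tail z = y' ∧ m' = m ∧ x' 0 = x then 1 else 0
  have h2 := h.tail hW fun b _ z => if z = y' ∧ b.1 = m ∧ b.2 = x then 1 else 0
  simp only [mul_ite, mul_one, mul_zero] at h1 h2
  rw [law_eq_sum, law_eq_sum]
  simp only [Prod.mk.injEq]
  rw [h1, h2, Finset.mul_sum]
  refine Finset.sum_congr rfl fun ω _ => ?_
  by_cases h3 : M ω = m <;> by_cases h4 : Xs ω 0 = x
  · simp only [h3, h4, and_true]
    rw [sum_fin_succ]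
    simp only [Fin.cons_zero, Fin.tail_cons, Fin.prod_univ_succ, Fin.cons_succ]
    rw [Finset.sum_eq_single y (by simp +contextual) (by simp),
      Finset.sum_eq_single y' (by simp +contextual) (by simp),
      Finset.sum_eq_single y' (by simp +contextual) (by simp)]
    simp only [and_self, if_true, h4, Fin.tail]
    ring
  all_goals simp [h3, h4]

/-- Peeling off the first output letter, and replacing past outputs by past inputs. -/
lemma IsOutput.ent_head_add_le [Fintype β] (hp : ∀ ω, 0 ≤ p ω) (hW : ∀ x, ∑ y, W x y = 1)
    (h : IsOutput p W M Xs Ys) :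
    (ent p (fun ω => (M ω, Ys ω 0)) - ent p M) +
      (ent p (fun ω => ((M ω, Xs ω 0), Fin.tail (Ys ω))) - ent p (fun ω => (M ω, Xs ω 0))) ≤
    ent p (fun ω => (M ω, Ys ω)) - ent p M := by
  -- Writing Y' for the tail: H(Y'|M,Y₀) ≥ H(Y'|M,X₀,Y₀) = H(Y'|M,X₀), by submodularity and then by
  -- the Markov property.
  have h1 := ent_submodular hp (fun ω => Fin.tail (Ys ω)) (fun ω => Xs ω 0)
    (fun ω => (M ω, Ys ω 0))
  have h2 := ent_add_ent_of_isMarkovChain hp (fun ω => Ys ω 0) (fun ω => Fin.tail (Ys ω))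
    (fun ω => (M ω, Xs ω 0)) (fun y y' b => by
      obtain ⟨m, x⟩ := b
      rw [h.law_head_tail hW, h.law_head_input hW]; ring)
  have e1 : ent p (fun ω => (Fin.tail (Ys ω), Xs ω 0, (M ω, Ys ω 0))) =
      ent p (fun ω => (Ys ω 0, Fin.tail (Ys ω), (M ω, Xs ω 0))) :=
    ent_congr fun ω ω' => by simp only [Prod.mk.injEq]; tauto
  have e2 : ent p (fun ω => (Fin.tail (Ys ω), (M ω, Ys ω 0))) = ent p (fun ω => (M ω, Ys ω)) :=
    ent_congr fun ω ω' => by simp only [Prod.mk.injEq, eq_iff_head_tail (Ys ω)]; tauto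
  have e3 : ent p (fun ω => (Xs ω 0, (M ω, Ys ω 0))) =
      ent p (fun ω => (Ys ω 0, (M ω, Xs ω 0))) :=
    ent_congr fun ω ω' => by simp only [Prod.mk.injEq]; tauto
  have e4 : ent p (fun ω => (Fin.tail (Ys ω), (M ω, Xs ω 0))) =
      ent p (fun ω => ((M ω, Xs ω 0), Fin.tail (Ys ω))) :=
    ent_congr fun ω ω' => by simp only [Prod.mk.injEq]; tauto
  rw [e1, e2, e3] at h1
  rw [e4] at h2
  linarith

end Outputs

/-! ### Single-letterization. -/

section SingleLetter

universe u

lemma chan₁_sum {X Y₁ Y₂ : Type*} [Fintype X] [Fintype Y₁] [Fintype Y₂] {P : X × Y₁ × Y₂ → ℝ}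
    {V : X → Y₁ × Y₂ → ℝ} (hV : IsChannelOf P V) (x : X) : ∑ y, chan₁ V x y = 1 := by
  rw [← (hV.mem x).2, Fintype.sum_prod_type]; rfl

lemma chan₂_sum {X Y₁ Y₂ : Type*} [Fintype X] [Fintype Y₁] [Fintype Y₂] {P : X × Y₁ × Y₂ → ℝ}
    {V : X → Y₁ × Y₂ → ℝ} (hV : IsChannelOf P V) (x : X) : ∑ y, chan₂ V x y = 1 := by
  rw [← (hV.mem x).2, Fintype.sum_prod_type_right]; rfl

lemma law_head_of_iid {Ω X : Type*} [Fintype Ω] [Fintype X] {p : Ω → ℝ} {n : ℕ} {v : X → ℝ}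
    (hv : ∑ x, v x = 1) {Xs : Ω → Fin (n + 1) → X} (hX : ∀ x, law p Xs x = ∏ i, v (x i)) :
    law p (fun ω => Xs ω 0) = v := by
  funext a
  rw [law_eq_sum_fst p _ (fun ω => Fin.tail (Xs ω))]
  calc _ = ∑ x : Fin n → X, v a * ∏ i, v (x i) := by
        refine Finset.sum_congr rfl fun x _ => ?_
        rw [← law_congr_iff (A := Xs) (a := Fin.cons a x) (by simp [eq_cons_iff]), hX]
        simp [Fin.prod_univ_succ]
    _ = _ := by
        rw [← Finset.mul_sum, sum_prod_pi fun (_ : Fin n) x => v x]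
        simp [hv]

lemma law_tail_of_iid {Ω X : Type*} [Fintype Ω] [Fintype X] {p : Ω → ℝ} {n : ℕ} {v : X → ℝ}
    (hv : ∑ x, v x = 1) {Xs : Ω → Fin (n + 1) → X} (hX : ∀ x, law p Xs x = ∏ i, v (x i))
    (x : Fin n → X) : law p (fun ω => Fin.tail (Xs ω)) x = ∏ i, v (x i) := by
  rw [law_eq_sum_snd p (fun ω => Xs ω 0)]
  calc _ = ∑ a, v a * ∏ i, v (x i) := by
        refine Finset.sum_congr rfl fun a _ => ?_
        rw [← law_congr_iff (A := Xs) (a := Fin.cons a x) (by simp [eq_cons_iff]), hX]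
        simp [Fin.prod_univ_succ]
    _ = _ := by rw [← Finset.sum_mul, hv, one_mul]

/-- Single-letterization: the normalized block entropies form a point of the entropy region. -/
theorem exists_blockEntropyVector {X : Type u} {Y₁ Y₂ B₁ B₂ Ω : Type*} [Fintype X] [Fintype Y₁]
    [Fintype Y₂] [Fintype B₁] [Fintype B₂] [Fintype Ω] {P : X × Y₁ × Y₂ → ℝ}
    (hP : P ∈ stdSimplex ℝ (X × Y₁ × Y₂)) {V : X → Y₁ × Y₂ → ℝ} (hV : IsChannelOf P V)
    {p : Ω → ℝ} (hp : p ∈ stdSimplex ℝ Ω) (M₁ : Ω → B₁) (M₂ : Ω → B₂) (n : ℕ) :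
    ∀ {B₀ : Type u} [Fintype B₀] (M₀ : Ω → B₀) (Xs : Ω → Fin n → X) (Ys₁ : Ω → Fin n → Y₁)
      (Ys₂ : Ω → Fin n → Y₂), (∀ x, law p Xs x = ∏ i, lawX P (x i)) →
      IsOutput p (chan₁ V) (fun ω => (M₀ ω, M₁ ω)) Xs Ys₁ →
      IsOutput p (chan₂ V) (fun ω => (M₀ ω, M₂ ω)) Xs Ys₂ →
      ∃ z ∈ entropyRegion (chan₁ V) (chan₂ V), z.1 = lawX P ∧
        n * z.2.1 = ent p (fun ω => (M₀ ω, Xs ω)) - ent p M₀ ∧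
        n * z.2.2.1.1 = ent p (fun ω => ((M₀ ω, M₁ ω), Xs ω)) - ent p (fun ω => (M₀ ω, M₁ ω)) ∧
        n * z.2.2.1.2 ≤ ent p (fun ω => ((M₀ ω, M₁ ω), Ys₁ ω)) - ent p (fun ω => (M₀ ω, M₁ ω)) ∧
        n * z.2.2.2.1 = ent p (fun ω => ((M₀ ω, M₂ ω), Xs ω)) - ent p (fun ω => (M₀ ω, M₂ ω)) ∧
        n * z.2.2.2.2 ≤ ent p (fun ω => ((M₀ ω, M₂ ω), Ys₂ ω)) - ent p (fun ω => (M₀ ω, M₂ ω)) := by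
  have hPX : lawX P ∈ stdSimplex ℝ X := law_mem_stdSimplex hP _
  -- M₀ stays general, since the induction step replaces it by (M₀, X₀); unrolled, this is U₀ = (M₀,
  -- X^{t-1}), while M₁ and M₂ remain fixed. Its alphabet lives in the universe of X so that the
  -- product with X does too.
  induction n with
  | zero =>
    intro B₀ _ M₀ Xs Ys₁ Ys₂ _ _ _
    refine ⟨_, trivial_mem_entropyRegion (chan₁ V) (chan₂ V) hPX, rfl, ?_, ?_, ?_, ?_, ?_⟩ <;>
    · rw [ent_congr (B := _) (fun ω ω' => Prod.mk_inj.trans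
        (and_iff_left (Subsingleton.elim _ _)))]
      simp
  | succ n ih =>
    intro B₀ _ M₀ Xs Ys₁ Ys₂ hX h₁ h₂
    have hW₁ := chan₁_sum hV
    have hW₂ := chan₂_sum hV
    obtain ⟨z, hz, hz0, ha, he₁, ho₁, he₂, ho₂⟩ := ih (fun ω => (M₀ ω, Xs ω 0))
      (fun ω => Fin.tail (Xs ω)) (fun ω => Fin.tail (Ys₁ ω)) (fun ω => Fin.tail (Ys₂ ω))
      (law_tail_of_iid hPX.2 hX)
      ((h₁.tail hW₁).comp fun b => ((b.1.1, b.2), b.1.2))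
      ((h₂.tail hW₂).comp fun b => ((b.1.1, b.2), b.1.2))
    have hy := mem_entropyRegion hp (chan₁ V) (chan₂ V) M₀ M₁ M₂ (fun ω => Xs ω 0)
      (fun ω => Ys₁ ω 0) (fun ω => Ys₂ ω 0)
      (fun u₀ u₁ y => h₁.law_head hW₁ (u₀, u₁) y) (fun u₀ u₂ y => h₂.law_head hW₂ (u₀, u₂) y)
    rw [law_head_of_iid hPX.2 hX] at hy
    have hn : (0 : ℝ) < n + 1 := by positivity
    -- The first letter has weight 1/(n+1) and the remaining n letters weight n/(n+1); convexity
    -- stands in for a time-sharing variable. The entropies of X add up exactly, and only the output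
    -- entropies lose something.
    have hconv := convex_convexHull ℝ (layer (chan₁ V) (chan₂ V)) hy hz
      (a := 1 / (n + 1 : ℝ)) (b := n / (n + 1 : ℝ)) (by positivity) (by positivity)
      (by field_simp; ring)
    have p₁ := h₁.ent_head_add_le hp.1 hW₁
    have p₂ := h₂.ent_head_add_le hp.1 hW₂
    have r0 : ent p (fun ω => (M₀ ω, Xs ω)) =
        ent p (fun ω => ((M₀ ω, Xs ω 0), Fin.tail (Xs ω))) :=
      ent_congr fun ω ω' => by simp only [Prod.mk.injEq, eq_iff_head_tail (Xs ω)]; tauto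
    have r1 : ent p (fun ω => ((M₀ ω, M₁ ω), Xs ω)) =
        ent p (fun ω => (((M₀ ω, Xs ω 0), M₁ ω), Fin.tail (Xs ω))) :=
      ent_congr fun ω ω' => by simp only [Prod.mk.injEq, eq_iff_head_tail (Xs ω)]; tauto
    have r2 : ent p (fun ω => ((M₀ ω, M₂ ω), Xs ω)) =
        ent p (fun ω => (((M₀ ω, Xs ω 0), M₂ ω), Fin.tail (Xs ω))) :=
      ent_congr fun ω ω' => by simp only [Prod.mk.injEq, eq_iff_head_tail (Xs ω)]; tauto
    have s1 : ent p (fun ω => ((M₀ ω, M₁ ω), Xs ω 0)) = ent p (fun ω => ((M₀ ω, Xs ω 0), M₁ ω)) :=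
      ent_congr fun ω ω' => by simp only [Prod.mk.injEq]; tauto
    have s2 : ent p (fun ω => ((M₀ ω, M₂ ω), Xs ω 0)) = ent p (fun ω => ((M₀ ω, Xs ω 0), M₂ ω)) :=
      ent_congr fun ω ω' => by simp only [Prod.mk.injEq]; tauto
    have t1 : ent p (fun ω => (((M₀ ω, M₁ ω), Xs ω 0), Fin.tail (Ys₁ ω))) =
        ent p (fun ω => (((M₀ ω, Xs ω 0), M₁ ω), Fin.tail (Ys₁ ω))) :=
      ent_congr fun ω ω' => by simp only [Prod.mk.injEq]; tauto
    have t2 : ent p (fun ω => (((M₀ ω, M₂ ω), Xs ω 0), Fin.tail (Ys₂ ω))) =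
        ent p (fun ω => (((M₀ ω, Xs ω 0), M₂ ω), Fin.tail (Ys₂ ω))) :=
      ent_congr fun ω ω' => by simp only [Prod.mk.injEq]; tauto
    rw [t1, s1] at p₁
    rw [t2, s2] at p₂
    rw [s1, s2] at hconv
    have avg : ∀ a b : ℝ, ((n + 1 : ℕ) : ℝ) * (1 / (n + 1 : ℝ) * a + n / (n + 1 : ℝ) * b) =
        a + n * b := fun a b => by push_cast; field_simp
    refine ⟨_, hconv, ?_, ?_, ?_, ?_, ?_, ?_⟩
    · simp only [Prod.fst_add, Prod.smul_fst, hz0]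
      rw [← add_smul, ← add_div, add_comm, div_self hn.ne', one_smul]
    all_goals
      simp only [Prod.fst_add, Prod.snd_add, Prod.smul_fst, Prod.smul_snd, smul_eq_mul, avg,
        ha, he₁, he₂, r0, r1, r2]
    · ring
    · ring
    · linarith
    · ring
    · linarith

end SingleLetter

/-! ### Independent sequences and the alternative law. -/

section Iid

variable {Ω X : Type*} [Fintype Ω] [Fintype X] {p : Ω → ℝ}

lemma ent_pair_of_indep {α β : Type*} [Fintype α] [Fintype β] (hp : p ∈ stdSimplex ℝ Ω)
    (A : Ω → α) (B : Ω → β)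
    (h : ∀ a b, law p (fun ω => (A ω, B ω)) (a, b) = law p A a * law p B b) :
    ent p (fun ω => (A ω, B ω)) = ent p A + ent p B := by
  have := ent_pair_sub_of_kernel hp.1 A B (fun _ => law p B) h
  rw [← Finset.sum_mul, sum_law, hp.2, one_mul, ← ent_eq_entFun] at this
  linarith

lemma ent_of_iid (hp : p ∈ stdSimplex ℝ Ω) {v : X → ℝ} (hv : ∑ x, v x = 1) (n : ℕ) :
    ∀ Xs : Ω → Fin n → X, (∀ x, law p Xs x = ∏ i, v (x i)) → ent p Xs = n * entFun v := by
  induction n with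
  | zero =>
    intro Xs _
    rw [ent_congr (B := fun _ => ()) (fun ω ω' => by simp [Subsingleton.elim (Xs ω) (Xs ω')]),
      ent_const hp]
    simp
  | succ n ih =>
    intro Xs hX
    have hh := law_head_of_iid hv hX
    have ht := law_tail_of_iid hv hX
    rw [ent_congr (B := fun ω => (Xs ω 0, Fin.tail (Xs ω))) (fun ω ω' => by
      rw [Prod.mk.injEq, eq_iff_head_tail]),
      ent_pair_of_indep hp, ih _ ht, ent_eq_entFun, hh]
    · push_cast; ring
    · intro a x
      rw [hh, ht, ← law_congr_iff (A := Xs) (a := Fin.cons a x) (by simp [eq_cons_iff]), hX]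
      simp [Fin.prod_univ_succ]

end Iid

section Alternative

variable {X Y : Type*} [Fintype X] [Fintype Y] {P : X × Y → ℝ}

lemma isChannelOf_const {v : X → ℝ} {w : Y → ℝ} (hw : w ∈ stdSimplex ℝ Y) :
    IsChannelOf (fun s : X × Y => v s.1 * w s.2) (fun _ => w) where
  mem _ := hw
  eq x y := by
    rw [lawX_eq_sum]
    simp only [← Finset.mul_sum, hw.2, mul_one]

lemma lawX_mul {v : X → ℝ} {w : Y → ℝ} (hw : w ∈ stdSimplex ℝ Y) :
    lawX (fun s : X × Y => v s.1 * w s.2) = v := by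
  funext x
  rw [lawX_eq_sum]
  simp only [← Finset.mul_sum, hw.2, mul_one]

end Alternative

/-! ### Laws induced by a code under the two hypotheses. -/

section Codes

variable {X Y₁ Y₂ : Type*} [Fintype X] [Fintype Y₁] [Fintype Y₂] {R₀ R₁ R₂ : ℝ} {n : ℕ}
  {P : X × Y₁ × Y₂ → ℝ} {V : X → Y₁ × Y₂ → ℝ}

lemma output_chan₁ (hV : IsChannelOf P V) (y : Y₁) :
    output (chan₁ V) (lawX P) y = ∑ y₂, law P Prod.snd (y, y₂) := by
  simp only [output, chan₁, Finset.mul_sum, ← hV.eq]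
  rw [Finset.sum_comm]
  refine Finset.sum_congr rfl fun y₂ _ => ?_
  rw [law_eq_sum_snd P Prod.fst Prod.snd]
  exact Finset.sum_congr rfl fun x _ =>
    (law_apply_of_injective P Function.injective_id (x, y, y₂)).symm

lemma output_chan₂ (hV : IsChannelOf P V) (y : Y₂) :
    output (chan₂ V) (lawX P) y = ∑ y₁, law P Prod.snd (y₁, y) := by
  simp only [output, chan₂, Finset.mul_sum, ← hV.eq]
  rw [Finset.sum_comm]
  refine Finset.sum_congr rfl fun y₁ _ => ?_
  rw [law_eq_sum_snd P Prod.fst Prod.snd]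
  exact Finset.sum_congr rfl fun x _ =>
    (law_apply_of_injective P Function.injective_id (x, y₁, y)).symm

/-- The alternative is a source whose channel ignores its input, so the identities for a code under
P apply to it as well. -/
lemma isChannelOf_altLaw (hP : P ∈ stdSimplex ℝ (X × Y₁ × Y₂)) :
    IsChannelOf (altLaw P) (fun _ => law P Prod.snd) :=
  isChannelOf_const (v := lawX P) (law_mem_stdSimplex hP Prod.snd)

lemma lawX_altLaw (hP : P ∈ stdSimplex ℝ (X × Y₁ × Y₂)) : lawX (altLaw P) = lawX P :=
  lawX_mul (v := lawX P) (law_mem_stdSimplex hP Prod.snd)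

variable (c : Code X Y₁ Y₂ R₀ R₁ R₂ n)

/-- Expectations of functions of `(X^n, M, Y₁^n)`. -/
lemma sum_outcomeLaw₁ (hV : IsChannelOf P V)
    (f : (Fin n → X) → Msg R₀ n × Msg R₁ n × Msg R₂ n → (Fin n → Y₁) → ℝ) :
    ∑ ω, c.outcomeLaw P ω * f ω.1.1 ω.2 ω.1.2.1 =
      ∑ x : Fin n → X, ∑ m, (∏ i, lawX P (x i)) * c.enc x m *
        ∑ y : Fin n → Y₁, (∏ i, chan₁ V (x i) (y i)) * f x m y := by
  rw [Fintype.sum_prod_type_right]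
  rw [Finset.sum_comm' (s' := fun _ => Finset.univ) (t' := Finset.univ) (by simp),
    Fintype.sum_prod_type]
  refine Finset.sum_congr rfl fun x _ => ?_
  rw [Finset.sum_comm]
  refine Finset.sum_congr rfl fun m _ => ?_
  rw [Fintype.sum_prod_type, Finset.mul_sum]
  refine Finset.sum_congr rfl fun y _ => ?_
  simp only [Code.outcomeLaw, hV.eq, Finset.prod_mul_distrib, chan₁]
  rw [← sum_prod_pi fun i y₂ => V (x i) (y i, y₂), Finset.sum_mul, Finset.mul_sum]
  exact Finset.sum_congr rfl fun _ _ => by ring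

/-- Expectations of functions of `(X^n, M, Y₂^n)`. -/
lemma sum_outcomeLaw₂ (hV : IsChannelOf P V)
    (f : (Fin n → X) → Msg R₀ n × Msg R₁ n × Msg R₂ n → (Fin n → Y₂) → ℝ) :
    ∑ ω, c.outcomeLaw P ω * f ω.1.1 ω.2 ω.1.2.2 =
      ∑ x : Fin n → X, ∑ m, (∏ i, lawX P (x i)) * c.enc x m *
        ∑ y : Fin n → Y₂, (∏ i, chan₂ V (x i) (y i)) * f x m y := by
  rw [Fintype.sum_prod_type_right]
  rw [Finset.sum_comm' (s' := fun _ => Finset.univ) (t' := Finset.univ) (by simp),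
    Fintype.sum_prod_type]
  refine Finset.sum_congr rfl fun x _ => ?_
  rw [Finset.sum_comm]
  refine Finset.sum_congr rfl fun m _ => ?_
  rw [Fintype.sum_prod_type_right, Finset.mul_sum]
  refine Finset.sum_congr rfl fun y _ => ?_
  simp only [Code.outcomeLaw, hV.eq, Finset.prod_mul_distrib, chan₂]
  rw [← sum_prod_pi fun i y₁ => V (x i) (y₁, y i), Finset.sum_mul, Finset.mul_sum]
  exact Finset.sum_congr rfl fun _ _ => by ring

lemma sum_prod_chan₁ (hV : IsChannelOf P V) (x : Fin n → X) :
    ∑ y : Fin n → Y₁, ∏ i, chan₁ V (x i) (y i) = 1 := by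
  rw [sum_prod_pi fun i y => chan₁ V (x i) y]
  simp [chan₁_sum hV]

lemma sum_prod_chan₂ (hV : IsChannelOf P V) (x : Fin n → X) :
    ∑ y : Fin n → Y₂, ∏ i, chan₂ V (x i) (y i) = 1 := by
  rw [sum_prod_pi fun i y => chan₂ V (x i) y]
  simp [chan₂_sum hV]

/-- Expectations of functions of `(X^n, M)`. -/
lemma sum_outcomeLaw (hV : IsChannelOf P V)
    (f : (Fin n → X) → Msg R₀ n × Msg R₁ n × Msg R₂ n → ℝ) :
    ∑ ω, c.outcomeLaw P ω * f ω.1.1 ω.2 =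
      ∑ x : Fin n → X, ∑ m, (∏ i, lawX P (x i)) * c.enc x m * f x m := by
  rw [sum_outcomeLaw₁ c hV fun x m _ => f x m]
  simp only [← Finset.sum_mul, sum_prod_chan₁ hV, one_mul]

lemma outcomeLaw_mem_stdSimplex (hP : P ∈ stdSimplex ℝ (X × Y₁ × Y₂)) :
    c.outcomeLaw P ∈ stdSimplex ℝ (Outcome X Y₁ Y₂ R₀ R₁ R₂ n) := by
  obtain ⟨V, hV⟩ := exists_isChannelOf hP
  refine ⟨fun ω => mul_nonneg (Finset.prod_nonneg fun _ _ => hP.1 _) ((c.enc_mem _).1 _), ?_⟩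
  have := sum_outcomeLaw c hV fun _ _ => 1
  simp only [mul_one, ← Finset.mul_sum, (c.enc_mem _).2] at this
  rw [this, sum_prod_pi fun _ x => lawX P x]
  have hPX : lawX P ∈ stdSimplex ℝ X := law_mem_stdSimplex hP _
  simp [hPX.2]

lemma law_Xs (hP : P ∈ stdSimplex ℝ (X × Y₁ × Y₂)) (x : Fin n → X) :
    law (c.outcomeLaw P) (fun ω => ω.1.1) x = ∏ i, lawX P (x i) := by
  classical
  obtain ⟨V, hV⟩ := exists_isChannelOf hP
  have := sum_outcomeLaw c hV fun x' _ => if x' = x then 1 else 0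
  rw [law_eq_sum]
  simp only [mul_ite, mul_one, mul_zero] at this
  refine Eq.trans (Finset.sum_congr rfl fun ω _ => by congr) (this.trans ?_)
  rw [Finset.sum_eq_single x (by simp +contextual) (by simp)]
  simp [← Finset.mul_sum, (c.enc_mem _).2]

lemma isOutput₁ {β : Type*} (hV : IsChannelOf P V) (F : Msg R₀ n × Msg R₁ n × Msg R₂ n → β) :
    IsOutput (c.outcomeLaw P) (chan₁ V) (fun ω => F ω.2) (fun ω => ω.1.1) (fun ω => ω.1.2.1) := by
  intro f
  rw [sum_outcomeLaw₁ c hV fun x m y => f (F m) x y,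
    sum_outcomeLaw c hV fun x m => ∑ y : Fin n → Y₁, (∏ i, chan₁ V (x i) (y i)) * f (F m) x y]

lemma isOutput₂ {β : Type*} (hV : IsChannelOf P V) (F : Msg R₀ n × Msg R₁ n × Msg R₂ n → β) :
    IsOutput (c.outcomeLaw P) (chan₂ V) (fun ω => F ω.2) (fun ω => ω.1.1) (fun ω => ω.1.2.2) := by
  intro f
  rw [sum_outcomeLaw₂ c hV fun x m y => f (F m) x y,
    sum_outcomeLaw c hV fun x m => ∑ y : Fin n → Y₂, (∏ i, chan₂ V (x i) (y i)) * f (F m) x y]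

lemma law_Ys₁ (hV : IsChannelOf P V) (y : Fin n → Y₁) :
    law (c.outcomeLaw P) (fun ω => ω.1.2.1) y = ∏ i, output (chan₁ V) (lawX P) (y i) := by
  classical
  have := sum_outcomeLaw₁ c hV fun _ _ y' => if y' = y then 1 else 0
  rw [law_eq_sum]
  simp only [mul_ite, mul_one, mul_zero, Finset.sum_ite_eq', Finset.mem_univ, if_true] at this
  refine Eq.trans (Finset.sum_congr rfl fun ω _ => by congr) (this.trans ?_)
  simp only [← Finset.sum_mul, ← Finset.mul_sum, (c.enc_mem _).2, mul_one, output]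
  rw [← sum_prod_pi fun i x => lawX P x * chan₁ V x (y i)]
  simp only [Finset.prod_mul_distrib]

lemma law_Ys₂ (hV : IsChannelOf P V) (y : Fin n → Y₂) :
    law (c.outcomeLaw P) (fun ω => ω.1.2.2) y = ∏ i, output (chan₂ V) (lawX P) (y i) := by
  classical
  have := sum_outcomeLaw₂ c hV fun _ _ y' => if y' = y then 1 else 0
  rw [law_eq_sum]
  simp only [mul_ite, mul_one, mul_zero, Finset.sum_ite_eq', Finset.mem_univ, if_true] at this
  refine Eq.trans (Finset.sum_congr rfl fun ω _ => by congr) (this.trans ?_)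
  simp only [← Finset.sum_mul, ← Finset.mul_sum, (c.enc_mem _).2, mul_one, output]
  rw [← sum_prod_pi fun i x => lawX P x * chan₂ V x (y i)]
  simp only [Finset.prod_mul_distrib]

/-- Under the alternative, the observation of receiver 1 is independent of the messages. -/
lemma sum_altLaw₁ (hP : P ∈ stdSimplex ℝ (X × Y₁ × Y₂)) (hV : IsChannelOf P V)
    (f : Msg R₀ n × Msg R₁ n × Msg R₂ n → (Fin n → Y₁) → ℝ) :
    ∑ ω, c.outcomeLaw (altLaw P) ω * f ω.2 ω.1.2.1 =
      ∑ ω, c.outcomeLaw P ω *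
        ∑ y : Fin n → Y₁, (∏ i, output (chan₁ V) (lawX P) (y i)) * f ω.2 y := by
  rw [sum_outcomeLaw₁ c (isChannelOf_altLaw hP) fun _ m y => f m y, lawX_altLaw hP,
    sum_outcomeLaw c hV
      fun _ m => ∑ y : Fin n → Y₁, (∏ i, output (chan₁ V) (lawX P) (y i)) * f m y]
  simp only [output_chan₁ hV, chan₁]

/-- Under the alternative, the observation of receiver 2 is independent of the messages. -/
lemma sum_altLaw₂ (hP : P ∈ stdSimplex ℝ (X × Y₁ × Y₂)) (hV : IsChannelOf P V)
    (f : Msg R₀ n × Msg R₁ n × Msg R₂ n → (Fin n → Y₂) → ℝ) :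
    ∑ ω, c.outcomeLaw (altLaw P) ω * f ω.2 ω.1.2.2 =
      ∑ ω, c.outcomeLaw P ω *
        ∑ y : Fin n → Y₂, (∏ i, output (chan₂ V) (lawX P) (y i)) * f ω.2 y := by
  rw [sum_outcomeLaw₂ c (isChannelOf_altLaw hP) fun _ m y => f m y, lawX_altLaw hP,
    sum_outcomeLaw c hV
      fun _ m => ∑ y : Fin n → Y₂, (∏ i, output (chan₂ V) (lawX P) (y i)) * f m y]
  simp only [output_chan₂ hV, chan₂]

end Codes

/-! ### The converse. -/

section Converse

variable {Ω α β : Type*} [Fintype Ω] [Fintype α] [Fintype β] {p : Ω → ℝ}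

open scoped Classical in
/-- Weak converse for a deterministic test of a joint law against the product of its marginals. -/
lemma one_sub_mul_neg_logb_le (hp : p ∈ stdSimplex ℝ Ω) (A : Ω → α) (B : Ω → β)
    (d : α → β → Fin 2) {ε b : ℝ} (hε : ε < 1) (hb : 0 < b)
    (hI : prob p {ω | d (A ω) (B ω) = 1} ≤ ε)
    (hII : ∑ ω, p ω * ∑ y, law p B y * (if d (A ω) y = 0 then 1 else 0) ≤ b) :
    (1 - ε) * -Real.logb 2 b - 1 ≤ mutualInfo p A B := by
  have hnn : 0 ≤ mutualInfo p A B := by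
    rw [mutualInfo_eq_condMutualInfo hp]; exact condMutualInfo_nonneg hp.1 _ _ _
  -- If b ≥ 1 the left side is nonpositive. Otherwise log(1/b) ≥ 0, so the acceptance probability
  -- may be replaced by its lower bound 1 - ε.
  rcases le_total (-Real.logb 2 b) 0 with h0 | h0
  · nlinarith
  have key := prob_mul_neg_logb_sub_one_le_mutualInfo hp A B {x | d x.1 x.2 = 0} hb (by
    refine le_trans (le_of_eq ?_) hII
    rw [← sum_law_mul p A fun a => ∑ y, law p B y * (if d a y = 0 then 1 else 0),
      Fintype.sum_prod_type]
    refine Finset.sum_congr rfl fun a _ => ?_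
    rw [Finset.mul_sum]
    refine Finset.sum_congr rfl fun y _ => ?_
    by_cases h : d a y = 0 <;> simp [h])
  have h1 : 1 - ε ≤ ∑ x : α × β, (if x ∈ {x : α × β | d x.1 x.2 = 0} then
      law p (fun ω => (A ω, B ω)) x else 0) := by
    have h2 := sum_law_mul p (fun ω => (A ω, B ω)) (fun x => if d x.1 x.2 = 0 then 1 else 0)
    simp only [mul_ite, mul_one, mul_zero] at h2
    have h3 : (∑ ω, if d (A ω) (B ω) = 0 then p ω else 0) +
        prob p {ω | d (A ω) (B ω) = 1} = 1 := by
      rw [prob_eq_sum, ← Finset.sum_add_distrib, ← hp.2]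
      refine Finset.sum_congr rfl fun ω _ => ?_
      have : d (A ω) (B ω) = 0 ∨ d (A ω) (B ω) = 1 := by
        generalize d (A ω) (B ω) = t; omega
      rcases this with h | h <;> simp [h]
    simp only [Set.mem_ofPred_eq]
    rw [h2]; linarith
  refine le_trans (sub_le_sub_right (mul_le_mul_of_nonneg_right (h1.trans (le_of_eq ?_)) h0) 1) key
  exact Finset.sum_congr rfl fun x _ => by congr

end Converse

section CodeConverse

/-- The extra bit pays for the additional message: ⌊2^{nR}⌋ + 1 ≤ 2 · 2^{nR} because R ≥ 0. -/
lemma logb_card_msg_le {R : ℝ} (hR : 0 ≤ R) (n : ℕ) :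
    Real.logb 2 (Fintype.card (Msg R n)) ≤ n * R + 1 := by
  have h1 : (1 : ℝ) ≤ 2 ^ ((n : ℝ) * R) := Real.one_le_rpow one_le_two (by positivity)
  have h2 : ((Fintype.card (Msg R n) : ℕ) : ℝ) ≤ 2 ^ ((n : ℝ) * R + 1) := by
    rw [Fintype.card_fin, Real.rpow_add two_pos, Real.rpow_one]
    push_cast
    have := Nat.floor_le (zero_le_one.trans h1)
    linarith
  calc _ ≤ Real.logb 2 (2 ^ ((n : ℝ) * R + 1)) :=
        Real.logb_le_logb_of_le one_lt_two (by exact_mod_cast Fintype.card_pos) h2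
    _ = _ := Real.logb_rpow two_pos (by norm_num)

variable {X Y₁ Y₂ : Type*} [Fintype X] [Fintype Y₁] [Fintype Y₂] {R₀ R₁ R₂ : ℝ} {n : ℕ}
  {P : X × Y₁ × Y₂ → ℝ} {V : X → Y₁ × Y₂ → ℝ}

-- Messages and Y₁^n keep their marginal laws under the alternative but become independent, so
-- type-II error is acceptance under the product of the marginals computed from P.
open scoped Classical in
lemma typeII₁_eq (hP : P ∈ stdSimplex ℝ (X × Y₁ × Y₂)) (c : Code X Y₁ Y₂ R₀ R₁ R₂ n) :
    c.typeII₁ P = ∑ ω, c.outcomeLaw P ω * ∑ y, law (c.outcomeLaw P) (fun ω => ω.1.2.1) y *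
      (if c.dec₁ y ω.2.1 ω.2.2.1 = 0 then 1 else 0) := by
  obtain ⟨V, hV⟩ := exists_isChannelOf hP
  have := sum_altLaw₁ c hP hV fun m y => if c.dec₁ y m.1 m.2.1 = 0 then 1 else 0
  simp only [law_Ys₁ c hV]
  rw [← this, Code.typeII₁, prob_eq_sum]
  exact Finset.sum_congr rfl fun ω _ => by simp [Code.decision₁]; congr

open scoped Classical in
lemma typeII₂_eq (hP : P ∈ stdSimplex ℝ (X × Y₁ × Y₂)) (c : Code X Y₁ Y₂ R₀ R₁ R₂ n) :
    c.typeII₂ P = ∑ ω, c.outcomeLaw P ω * ∑ y, law (c.outcomeLaw P) (fun ω => ω.1.2.2) y *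
      (if c.dec₂ y ω.2.1 ω.2.2.2 = 0 then 1 else 0) := by
  obtain ⟨V, hV⟩ := exists_isChannelOf hP
  have := sum_altLaw₂ c hP hV fun m y => if c.dec₂ y m.1 m.2.2 = 0 then 1 else 0
  simp only [law_Ys₂ c hV]
  rw [← this, Code.typeII₂, prob_eq_sum]
  exact Finset.sum_congr rfl fun ω _ => by simp [Code.decision₂]; congr

/-- Finite-blocklength weak converse. -/
theorem exists_entropyVector_of_code (hP : P ∈ stdSimplex ℝ (X × Y₁ × Y₂)) (hV : IsChannelOf P V)
    (hR₀ : 0 ≤ R₀) (hR₁ : 0 ≤ R₁) (hR₂ : 0 ≤ R₂) (c : Code X Y₁ Y₂ R₀ R₁ R₂ n) {ε b₁ b₂ : ℝ}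
    (hε : ε < 1) (hb₁ : 0 < b₁) (hb₂ : 0 < b₂) (hα₁ : c.typeI₁ P ≤ ε) (hα₂ : c.typeI₂ P ≤ ε)
    (hβ₁ : c.typeII₁ P ≤ b₁) (hβ₂ : c.typeII₂ P ≤ b₂) :
    ∃ z ∈ entropyRegion (chan₁ V) (chan₂ V), z.1 = lawX P ∧
      n * (entFun (lawX P) - z.2.1) ≤ n * R₀ + 1 ∧
      n * (z.2.1 - z.2.2.1.1) ≤ n * R₁ + 1 ∧
      n * (z.2.1 - z.2.2.2.1) ≤ n * R₂ + 1 ∧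
      (1 - ε) * -Real.logb 2 b₁ - 1 ≤ n * (entFun (output (chan₁ V) (lawX P)) - z.2.2.1.2) ∧
      (1 - ε) * -Real.logb 2 b₂ - 1 ≤ n * (entFun (output (chan₂ V) (lawX P)) - z.2.2.2.2) := by
  set p := c.outcomeLaw P with hpdef
  have hp : p ∈ stdSimplex ℝ _ := outcomeLaw_mem_stdSimplex c hP
  have hPX : lawX P ∈ stdSimplex ℝ X := law_mem_stdSimplex hP _
  let M₀ : Outcome X Y₁ Y₂ R₀ R₁ R₂ n → Msg R₀ n := fun ω => ω.2.1
  let M₁ : Outcome X Y₁ Y₂ R₀ R₁ R₂ n → Msg R₁ n := fun ω => ω.2.2.1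
  let M₂ : Outcome X Y₁ Y₂ R₀ R₁ R₂ n → Msg R₂ n := fun ω => ω.2.2.2
  let Xs : Outcome X Y₁ Y₂ R₀ R₁ R₂ n → Fin n → X := fun ω => ω.1.1
  let Ys₁ : Outcome X Y₁ Y₂ R₀ R₁ R₂ n → Fin n → Y₁ := fun ω => ω.1.2.1
  let Ys₂ : Outcome X Y₁ Y₂ R₀ R₁ R₂ n → Fin n → Y₂ := fun ω => ω.1.2.2
  -- `ULift` moves the common message to the universe of X, as the induction on n requires; the
  -- entropies do not change.
  obtain ⟨z, hz, hz0, ha, he₁, ho₁, he₂, ho₂⟩ := exists_blockEntropyVector hP hV hp M₁ M₂ n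
    (fun ω => ULift.up (M₀ ω)) Xs Ys₁ Ys₂ (law_Xs c hP)
    (isOutput₁ c hV fun m => (ULift.up m.1, m.2.1)) (isOutput₂ c hV fun m => (ULift.up m.1, m.2.2))
  have u0 : ent p (fun ω => ULift.up (M₀ ω)) = ent p M₀ := ent_congr (by simp)
  have u0X : ent p (fun ω => (ULift.up (M₀ ω), Xs ω)) = ent p (fun ω => (M₀ ω, Xs ω)) :=
    ent_congr (by simp)
  have u01 : ent p (fun ω => (ULift.up (M₀ ω), M₁ ω)) = ent p (fun ω => (M₀ ω, M₁ ω)) :=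
    ent_congr (by simp)
  have u02 : ent p (fun ω => (ULift.up (M₀ ω), M₂ ω)) = ent p (fun ω => (M₀ ω, M₂ ω)) :=
    ent_congr (by simp)
  have u01X : ent p (fun ω => ((ULift.up (M₀ ω), M₁ ω), Xs ω)) =
      ent p (fun ω => ((M₀ ω, Xs ω), M₁ ω)) :=
    ent_congr fun ω ω' => by simp only [Prod.mk.injEq, ULift.up_inj]; tauto
  have u02X : ent p (fun ω => ((ULift.up (M₀ ω), M₂ ω), Xs ω)) =
      ent p (fun ω => ((M₀ ω, Xs ω), M₂ ω)) :=
    ent_congr fun ω ω' => by simp only [Prod.mk.injEq, ULift.up_inj]; tauto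
  have u01Y : ent p (fun ω => ((ULift.up (M₀ ω), M₁ ω), Ys₁ ω)) =
      ent p (fun ω => ((M₀ ω, M₁ ω), Ys₁ ω)) := ent_congr (by simp)
  have u02Y : ent p (fun ω => ((ULift.up (M₀ ω), M₂ ω), Ys₂ ω)) =
      ent p (fun ω => ((M₀ ω, M₂ ω), Ys₂ ω)) := ent_congr (by simp)
  rw [u0, u0X] at ha
  rw [u01, u01X] at he₁
  rw [u02, u02X] at he₂
  rw [u01, u01Y] at ho₁
  rw [u02, u02Y] at ho₂
  have hX : ent p Xs = n * entFun (lawX P) := ent_of_iid hp hPX.2 n Xs (law_Xs c hP)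
  have hout₁ : ∑ y, output (chan₁ V) (lawX P) y = 1 := by
    simp only [output_chan₁ hV]
    rw [← Fintype.sum_prod_type', sum_law, hP.2]
  have hout₂ : ∑ y, output (chan₂ V) (lawX P) y = 1 := by
    simp only [output_chan₂ hV]
    rw [← Fintype.sum_prod_type_right', sum_law, hP.2]
  have hY₁ : ent p Ys₁ = n * entFun (output (chan₁ V) (lawX P)) :=
    ent_of_iid hp hout₁ n Ys₁ (law_Ys₁ c hV)
  have hY₂ : ent p Ys₂ = n * entFun (output (chan₂ V) (lawX P)) :=
    ent_of_iid hp hout₂ n Ys₂ (law_Ys₂ c hV)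
  have c0 := (ent_le_logb_card hp M₀).trans (logb_card_msg_le hR₀ n)
  have c1 := (ent_le_logb_card hp M₁).trans (logb_card_msg_le hR₁ n)
  have c2 := (ent_le_logb_card hp M₂).trans (logb_card_msg_le hR₂ n)
  -- The encoder is stochastic, so messages need not be functions of X^n. It is enough that
  -- adjoining a message does not decrease entropy: H(X^n) - H(X^n|M₀) ≤ H(M₀) and H(X^n|M₀) -
  -- H(X^n|M₀M_i) ≤ H(M_i).
  have d0 : ent p Xs ≤ ent p (fun ω => (M₀ ω, Xs ω)) := by
    rw [ent_congr (A := fun ω => (M₀ ω, Xs ω)) (B := fun ω => (Xs ω, M₀ ω)) (by simp [and_comm])]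
    exact ent_le_ent_pair hp.1 _ _
  have d1 := ent_le_ent_pair hp.1 (fun ω => (M₀ ω, Xs ω)) M₁
  have d2 := ent_le_ent_pair hp.1 (fun ω => (M₀ ω, Xs ω)) M₂
  have f1 := ent_pair_le_add hp M₀ M₁
  have f2 := ent_pair_le_add hp M₀ M₂
  have g1 := one_sub_mul_neg_logb_le hp (fun ω => (M₀ ω, M₁ ω)) Ys₁
    (fun m y => c.dec₁ y m.1 m.2) hε hb₁ hα₁ (by rw [typeII₁_eq hP] at hβ₁; exact hβ₁)
  have g2 := one_sub_mul_neg_logb_le hp (fun ω => (M₀ ω, M₂ ω)) Ys₂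
    (fun m y => c.dec₂ y m.1 m.2) hε hb₂ hα₂ (by rw [typeII₂_eq hP] at hβ₂; exact hβ₂)
  rw [mutualInfo_eq_ent hp.1, hY₁] at g1
  rw [mutualInfo_eq_ent hp.1, hY₂] at g2
  refine ⟨z, hz, hz0, ?_, ?_, ?_, ?_, ?_⟩ <;> rw [mul_sub] <;> linarith

end CodeConverse

section Converse

/-- A strictly positive majorant, valid also when β n = 0; the finite-blocklength converse needs a
positive bound to take its logarithm. -/
lemma eventually_le_of_le_exponent {β : ℕ → ℝ} (hβ : ∀ n, 0 ≤ β n) {θ δ : ℝ} (hδ : 0 < δ)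
    (h : (θ : EReal) ≤ exponent β) : ∀ᶠ n : ℕ in atTop, β n ≤ 2 ^ ((n : ℝ) * (δ - θ)) := by
  have h1 : limsup (fun n : ℕ => ((1 / (n : ℝ) : ℝ) : EReal) * elog₂ (β n)) atTop <
      ((δ - θ : ℝ) : EReal) := by
    refine lt_of_le_of_lt (EReal.le_neg.1 h) ?_
    rw [← EReal.coe_neg]
    exact_mod_cast (by linarith : -θ < δ - θ)
  filter_upwards [eventually_lt_of_limsup_lt h1, eventually_gt_atTop 0] with n hn hn0
  have hn' : (0 : ℝ) < n := by exact_mod_cast hn0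
  rcases (hβ n).eq_or_lt with h0 | h0
  · rw [← h0]; positivity
  · rw [elog₂, if_neg h0.ne', ← EReal.coe_mul, EReal.coe_lt_coe_iff, one_div,
      inv_mul_lt_iff₀ hn'] at hn
    exact (Real.logb_le_iff_le_rpow one_lt_two h0).1 hn.le

variable {X Y₁ Y₂ : Type*} [Fintype X] [Fintype Y₁] [Fintype Y₂] {R₀ R₁ R₂ : ℝ}
  {P : X × Y₁ × Y₂ → ℝ} {V : X → Y₁ × Y₂ → ℝ}

lemma prob_nonneg {Ω : Type*} [Fintype Ω] {p : Ω → ℝ} (hp : ∀ ω, 0 ≤ p ω) (E : Set Ω) :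
    0 ≤ prob p E := by
  classical
  rw [prob_eq_sum]
  exact Finset.sum_nonneg fun ω _ => by split_ifs <;> simp [hp]

lemma altLaw_mem_stdSimplex (hP : P ∈ stdSimplex ℝ (X × Y₁ × Y₂)) :
    altLaw P ∈ stdSimplex ℝ (X × Y₁ × Y₂) := by
  refine ⟨fun s => mul_nonneg (law_nonneg hP.1 _ _) (law_nonneg hP.1 _ _), ?_⟩
  simp only [altLaw]
  rw [Fintype.sum_prod_type, ← Finset.sum_mul_sum, sum_law, sum_law, hP.2, one_mul]

/-- Approximate single-letter conditions for an achievable pair of exponents. -/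
lemma exists_entropyVector_of_achievable (hP : P ∈ stdSimplex ℝ (X × Y₁ × Y₂))
    (hV : IsChannelOf P V) (hR₀ : 0 ≤ R₀) (hR₁ : 0 ≤ R₁) (hR₂ : 0 ≤ R₂) {θ₁ θ₂ : ℝ}
    (hθ₁ : 0 ≤ θ₁) (hθ₂ : 0 ≤ θ₂)
    (h : ∀ ε : ℝ, 0 < ε → ε < 1 → EpsAchievable P R₀ R₁ R₂ ε θ₁ θ₂) {δ : ℝ} (hδ : 0 < δ) :
    ∃ z ∈ entropyRegion (chan₁ V) (chan₂ V), z.1 = lawX P ∧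
      entFun (lawX P) - z.2.1 ≤ R₀ + δ ∧ z.2.1 - z.2.2.1.1 ≤ R₁ + δ ∧
      z.2.1 - z.2.2.2.1 ≤ R₂ + δ ∧
      θ₁ - δ ≤ entFun (output (chan₁ V) (lawX P)) - z.2.2.1.2 ∧
      θ₂ - δ ≤ entFun (output (chan₂ V) (lawX P)) - z.2.2.2.2 := by
  -- The loss δ splits into thirds: the factor 1 - ε costs at most εθ ≤ δ/3, the exponent slack
  -- costs δ/3, and the single bit divided by n costs the rest.
  set ε : ℝ := min (1 / 2) (δ / 3 / (1 + θ₁ + θ₂)) with hε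
  have hs : 0 < 1 + θ₁ + θ₂ := by positivity
  have hε0 : 0 < ε := lt_min (by norm_num) (by positivity)
  have hε1 : ε < 1 := (min_le_left _ _).trans_lt (by norm_num)
  have hεs : ε * (1 + θ₁ + θ₂) ≤ δ / 3 := by
    rw [← le_div_iff₀ hs]; exact min_le_right _ _
  obtain ⟨c, hα, hβ₁, hβ₂⟩ := h ε hε0 hε1
  have hnn : ∀ n ω, 0 ≤ (c n).outcomeLaw (altLaw P) ω := fun n =>
    (outcomeLaw_mem_stdSimplex (c n) (altLaw_mem_stdSimplex hP)).1
  have e₁ := eventually_le_of_le_exponent (δ := δ / 3) (fun n => prob_nonneg (hnn n) _)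
    (by positivity) hβ₁
  have e₂ := eventually_le_of_le_exponent (δ := δ / 3) (fun n => prob_nonneg (hnn n) _)
    (by positivity) hβ₂
  obtain ⟨N, hN⟩ := exists_nat_gt (3 / δ)
  obtain ⟨n, ⟨h₁, h₂⟩, hn⟩ := ((e₁.and e₂).and (eventually_ge_atTop (N + 1))).exists
  have hNn : (N : ℝ) + 1 ≤ n := by exact_mod_cast hn
  have hn1 : 1 ≤ n := by omega
  have hn0 : (0 : ℝ) < n := by exact_mod_cast hn1
  have hnδ : 1 ≤ n * (δ / 3) := by
    have : 3 < N * δ := by rwa [div_lt_iff₀ hδ] at hN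
    nlinarith
  obtain ⟨z, hz, hz0, a0, a1, a2, b1, b2⟩ := exists_entropyVector_of_code hP hV hR₀ hR₁ hR₂ (c n)
    hε1 (by positivity) (by positivity) (hα n hn1).1 (hα n hn1).2 h₁ h₂
  rw [Real.logb_rpow two_pos (by norm_num)] at b1 b2
  refine ⟨z, hz, hz0, ?_, ?_, ?_, ?_, ?_⟩ <;> refine le_of_mul_le_mul_left ?_ hn0
  · nlinarith
  · nlinarith
  · nlinarith
  · refine le_trans ?_ b1
    have : (θ₁ - δ) + δ / 3 ≤ (1 - ε) * (θ₁ - δ / 3) := by nlinarith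
    have := mul_le_mul_of_nonneg_left this hn0.le
    linarith
  · refine le_trans ?_ b2
    have : (θ₂ - δ) + δ / 3 ≤ (1 - ε) * (θ₂ - δ / 3) := by nlinarith
    have := mul_le_mul_of_nonneg_left this hn0.le
    linarith

/-- Converse: exponents in the region satisfy the single-letter conditions. -/
theorem exists_entropyVector_of_mem_exponentsRegion (hP : P ∈ stdSimplex ℝ (X × Y₁ × Y₂))
    (hV : IsChannelOf P V) (hR₀ : 0 ≤ R₀) (hR₁ : 0 ≤ R₁) (hR₂ : 0 ≤ R₂) {θ : ℝ × ℝ}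
    (h : θ ∈ exponentsRegion P R₀ R₁ R₂) :
    ∃ z ∈ entropyRegion (chan₁ V) (chan₂ V), z.1 = lawX P ∧
      entFun (lawX P) - z.2.1 ≤ R₀ ∧ z.2.1 - z.2.2.1.1 ≤ R₁ ∧ z.2.1 - z.2.2.2.1 ≤ R₂ ∧
      θ.1 ≤ entFun (output (chan₁ V) (lawX P)) - z.2.2.1.2 ∧
      θ.2 ≤ entFun (output (chan₂ V) (lawX P)) - z.2.2.2.2 := by
  have hPX : lawX P ∈ stdSimplex ℝ X := law_mem_stdSimplex hP _
  -- The worst violation among the five constraints. On the compact slice with input law P_X it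
  -- attains its minimum, which approximate solutions force below every δ > 0.
  let g : (X → ℝ) × ℝ × (ℝ × ℝ) × (ℝ × ℝ) → ℝ := fun z =>
    max (max (max (entFun (lawX P) - z.2.1 - R₀) (z.2.1 - z.2.2.1.1 - R₁))
      (z.2.1 - z.2.2.2.1 - R₂))
      (max (θ.1 - (entFun (output (chan₁ V) (lawX P)) - z.2.2.1.2))
      (θ.2 - (entFun (output (chan₂ V) (lawX P)) - z.2.2.2.2)))
  have hg : Continuous g := by fun_prop
  have hS : IsCompact (entropyRegion (chan₁ V) (chan₂ V) ∩ {z | z.1 = lawX P}) :=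
    (isCompact_entropyRegion _ _).inter_right (isClosed_eq continuous_fst continuous_const)
  obtain ⟨z, ⟨hz, hz0⟩, hmin⟩ := hS.exists_isMinOn
    ⟨_, trivial_mem_entropyRegion (chan₁ V) (chan₂ V) hPX, rfl⟩ hg.continuousOn
  have hle : g z ≤ 0 := by
    refine le_of_forall_pos_le_add fun δ hδ => ?_
    rw [zero_add]
    obtain ⟨θ', ⟨h1, h2, hθ'⟩, hdist⟩ := Metric.mem_closure_iff.1 h (δ / 2) (by positivity)
    rw [Prod.dist_eq, max_lt_iff, Real.dist_eq, Real.dist_eq, abs_lt, abs_lt] at hdist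
    obtain ⟨y, hy, hy0, a0, a1, a2, b1, b2⟩ :=
      exists_entropyVector_of_achievable hP hV hR₀ hR₁ hR₂ h1 h2 hθ' (half_pos hδ)
    refine (isMinOn_iff.1 hmin y (Set.mem_inter hy hy0)).trans ?_
    refine max_le (max_le (max_le ?_ ?_) ?_) (max_le ?_ ?_) <;> linarith [hdist.1.1, hdist.1.2,
      hdist.2.1, hdist.2.2]
  obtain ⟨⟨⟨a0, a1⟩, a2⟩, b1, b2⟩ :
      ((_ ≤ (0 : ℝ) ∧ _ ≤ (0 : ℝ)) ∧ _ ≤ (0 : ℝ)) ∧ _ ≤ (0 : ℝ) ∧ _ ≤ (0 : ℝ) := by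
    simpa only [g, max_le_iff] using hle
  exact ⟨z, hz, hz0, by linarith, by linarith, by linarith, by linarith, by linarith⟩

lemma nonneg_of_mem_exponentsRegion {θ : ℝ × ℝ} (h : θ ∈ exponentsRegion P R₀ R₁ R₂) :
    0 ≤ θ.1 ∧ 0 ≤ θ.2 := by
  have hc : IsClosed {θ : ℝ × ℝ | 0 ≤ θ.1 ∧ 0 ≤ θ.2} :=
    (isClosed_le continuous_const continuous_fst).inter
      (isClosed_le continuous_const continuous_snd)
  refine closure_minimal (t := {θ : ℝ × ℝ | 0 ≤ θ.1 ∧ 0 ≤ θ.2}) ?_ hc h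
  rintro θ ⟨h1, h2, _⟩
  exact ⟨h1, h2⟩

end Converse

/-! ### Concentration of information densities. -/

section LargeDeviations

variable {Z : Type*} [Fintype Z]

open scoped Classical in
/-- Weak law of large numbers: the empirical mean of a function with negative expectation is
eventually negative with high probability. -/
lemma tendsto_sum_prod_tail {p : Z → ℝ} (hp : p ∈ stdSimplex ℝ Z) {φ : Z → ℝ}
    (h : ∑ z, p z * φ z < 0) :
    Tendsto (fun n : ℕ => ∑ z : Fin n → Z, if 0 ≤ ∑ i, φ (z i) then ∏ i, p (z i) else 0)
      atTop (nhds 0) := by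
  -- Chernoff bound: the moment generating function has F(0) = 1 and negative derivative at 0, so
  -- F(s) < 1 for some s > 0, and the tail is at most F(s)^n.
  let F : ℝ → ℝ := fun s => ∑ z, p z * Real.exp (s * φ z)
  have hF : HasDerivAt F (∑ z, p z * φ z) 0 := by
    have : ∀ z ∈ (Finset.univ : Finset Z),
        HasDerivAt (fun s => p z * Real.exp (s * φ z)) (p z * φ z) 0 := fun z _ => by
      have := (((hasDerivAt_id (0 : ℝ)).mul_const (φ z)).exp).const_mul (p z)
      simpa using this
    exact HasDerivAt.fun_sum this
  have hF0 : F 0 = 1 := by simp [F, hp.2]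
  obtain ⟨s, hs, hs0⟩ : ∃ s, F s < 1 ∧ 0 < s := by
    have h1 := (hasDerivAt_iff_tendsto_slope.1 hF).eventually_lt_const h
    have h2 : ∀ᶠ s in nhdsWithin (0 : ℝ) (Set.Ioi 0), slope F 0 s < 0 :=
      h1.filter_mono (nhdsWithin_mono _ fun s (hs : 0 < s) => hs.ne')
    obtain ⟨s, hs, hs0⟩ := (h2.and self_mem_nhdsWithin).exists
    have hs0 : 0 < s := hs0
    refine ⟨s, ?_, hs0⟩
    rw [slope_def_field, sub_zero, div_lt_iff₀ hs0, zero_mul, hF0] at hs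
    linarith
  have hFs : 0 ≤ F s := Finset.sum_nonneg fun z _ => mul_nonneg (hp.1 z) (Real.exp_pos _).le
  refine squeeze_zero (fun n => Finset.sum_nonneg fun z _ => ?_) (fun n => ?_)
    (tendsto_pow_atTop_nhds_zero_of_lt_one hFs hs)
  · split_ifs
    · exact Finset.prod_nonneg fun i _ => hp.1 _
    · exact le_rfl
  · have h1 : F s ^ n = ∑ z : Fin n → Z, ∏ i, (p (z i) * Real.exp (s * φ (z i))) := by
      rw [sum_prod_pi fun (_ : Fin n) z => p z * Real.exp (s * φ z)]
      simp [F]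
    rw [h1]
    refine Finset.sum_le_sum fun z _ => ?_
    have hnn : 0 ≤ ∏ i, p (z i) := Finset.prod_nonneg fun i _ => hp.1 _
    rw [Finset.prod_mul_distrib, ← Real.exp_sum, ← Finset.mul_sum]
    split_ifs with h0
    · exact le_mul_of_one_le_right hnn (Real.one_le_exp (mul_nonneg hs0.le h0))
    · exact mul_nonneg hnn (Real.exp_pos _).le

open scoped Classical in
/-- Information densities of an i.i.d. sequence do not exceed a number above their mean. -/
lemma tendsto_density_tail {p f g : Z → ℝ} (hp : p ∈ stdSimplex ℝ Z) (hf : ∀ z, p z ≠ 0 → 0 < f z)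
    (hg : ∀ z, p z ≠ 0 → 0 < g z) {c : ℝ} (hc : ∑ z, p z * Real.logb 2 (f z / g z) < c) :
    Tendsto (fun n : ℕ => ∑ z : Fin n → Z,
      if 2 ^ ((n : ℝ) * c) * ∏ i, g (z i) ≤ ∏ i, f (z i) then ∏ i, p (z i) else 0)
      atTop (nhds 0) := by
  have h : ∑ z, p z * (Real.logb 2 (f z / g z) - c) < 0 := by
    simp only [mul_sub, Finset.sum_sub_distrib, ← Finset.sum_mul, hp.2]
    linarith
  have hnn : ∀ (n : ℕ) (z : Fin n → Z), 0 ≤ ∏ i, p (z i) :=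
    fun n z => Finset.prod_nonneg fun i _ => hp.1 _
  refine squeeze_zero (fun n => Finset.sum_nonneg fun z _ => ?_) (fun n => ?_)
    (tendsto_sum_prod_tail hp h)
  · split_ifs
    · exact hnn n z
    · exact le_rfl
  · refine Finset.sum_le_sum fun z _ => ?_
    by_cases h0 : ∏ i, p (z i) = 0
    · simp [h0]
    have hz : ∀ i, p (z i) ≠ 0 := fun i hi => h0 (Finset.prod_eq_zero (Finset.mem_univ i) hi)
    by_cases h1 : 2 ^ ((n : ℝ) * c) * ∏ i, g (z i) ≤ ∏ i, f (z i)
    · rw [if_pos h1, if_pos]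
      have hgp : 0 < ∏ i, g (z i) := Finset.prod_pos fun i _ => hg _ (hz i)
      have h2 : 2 ^ ((n : ℝ) * c) ≤ ∏ i, (f (z i) / g (z i)) := by
        rw [Finset.prod_div_distrib, le_div_iff₀ hgp]; exact h1
      have h3 := Real.logb_le_logb_of_le one_lt_two (by positivity) h2
      rw [Real.logb_rpow two_pos (by norm_num), Real.logb_prod] at h3
      · simpa [Finset.sum_sub_distrib] using h3
      · exact fun i _ => (div_pos (hf _ (hz i)) (hg _ (hz i))).ne'
    · rw [if_neg h1]
      split_ifs
      · exact hnn n z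
      · exact le_rfl

end LargeDeviations

/-! ### One-shot covering. -/

section Covering

/-- `M` codewords, each good with probability at least `q / G`, contain a good one up to
probability `1 - q + τ`. -/
def CoverBound (M : ℕ) (G τ : ℝ) : Prop :=
  ∀ q a : ℝ, 0 ≤ q → q ≤ 1 → a ≤ 1 → q ≤ G * a → (1 - a) ^ M ≤ 1 - q + τ

/-- With G = 1 one codeword already succeeds with probability a ≥ q, and no rate slack is needed.
This handles zero information, in particular at zero rate. -/
lemma coverBound_one {M : ℕ} (hM : 1 ≤ M) : CoverBound M 1 0 := by
  intro q a hq _ ha h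
  have h1 : (1 - a) ^ M ≤ (1 - a) ^ 1 :=
    pow_le_pow_of_le_one (by linarith) (by linarith) hM
  linarith

/-- (1-a)^M ≤ e^{-aM} ≤ e^{-qT}, and convexity of exp replaces e^{-qT} by the chord 1 - q + q
e^{-T}. -/
lemma coverBound_exp {M : ℕ} {G T : ℝ} (hG : 0 < G) (hT : T * G ≤ M) (hT0 : 0 ≤ T) :
    CoverBound M G (Real.exp (-T)) := by
  intro q a hq hq1 ha h
  have h1 : (1 - a) ^ M ≤ Real.exp (-(q * T)) := by
    calc (1 - a) ^ M ≤ Real.exp (-a) ^ M :=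
          pow_le_pow_left₀ (by linarith) (by have := Real.add_one_le_exp (-a); linarith) M
      _ = Real.exp (-(a * M)) := by rw [← Real.exp_nat_mul]; ring_nf
      _ ≤ _ := by
          apply Real.exp_le_exp.2
          have ha0 : 0 ≤ a := by
            by_contra hneg
            have := mul_neg_of_pos_of_neg hG (not_le.1 hneg)
            linarith
          have h2 := mul_le_mul_of_nonneg_left hT ha0
          have h3 := mul_le_mul_of_nonneg_right h hT0
          nlinarith
  have h2 : Real.exp (-(q * T)) ≤ 1 - q + q * Real.exp (-T) := by
    have := convexOn_exp.2 (Set.mem_univ (0 : ℝ)) (Set.mem_univ (-T))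
      (sub_nonneg.2 hq1) hq (by ring)
    simp only [smul_eq_mul, mul_zero, zero_add, Real.exp_zero, mul_one] at this
    rwa [show q * -T = -(q * T) by ring] at this
  have h3 : q * Real.exp (-T) ≤ Real.exp (-T) :=
    mul_le_of_le_one_left (Real.exp_pos _).le hq1
  linarith

open scoped Classical in
/-- Covering lemma, derandomized one codeword at a time. -/
lemma exists_codebook {B S : Type*} [Fintype B] [Fintype S] {π : B → ℝ} (hπ : π ∈ stdSimplex ℝ B)
    (T : B → S → Prop) (M : ℕ) : ∀ (w : S → ℝ), (∀ s, 0 ≤ w s) →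
    ∃ c : Fin M → B, ∑ s, (if ∃ i, T (c i) s then 0 else w s) ≤
      ∑ s, w s * (1 - ∑ b, if T b s then π b else 0) ^ M := by
  induction M with
  | zero => intro w _; exact ⟨Fin.elim0, by simp⟩
  | succ M ih =>
    intro w hw
    set r : S → ℝ := fun s => 1 - ∑ b, if T b s then π b else 0 with hr
    have hr' : ∀ s, r s = ∑ b, if T b s then 0 else π b := by
      intro s
      simp only [hr]
      rw [← hπ.2, ← Finset.sum_sub_distrib]
      exact Finset.sum_congr rfl fun b _ => by split_ifs <;> simp
    have hr0 : ∀ s, 0 ≤ r s := fun s => by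
      rw [hr']; exact Finset.sum_nonneg fun b _ => by split_ifs <;> simp [hπ.1]
    -- The average over b ~ π of the left side equals the right side, so some b does no worse. The
    -- remaining M codewords only have to cover what b leaves uncovered.
    obtain ⟨b, hb⟩ : ∃ b, ∑ s, (if T b s then 0 else w s) * r s ^ M ≤ ∑ s, w s * r s ^ (M + 1) := by
      by_contra hcon
      push Not at hcon
      have hav : ∑ b, π b * ∑ s, (if T b s then 0 else w s) * r s ^ M =
          ∑ s, w s * r s ^ (M + 1) := by
        simp only [Finset.mul_sum]
        rw [Finset.sum_comm]
        refine Finset.sum_congr rfl fun s _ => ?_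
        rw [pow_succ, ← mul_assoc]
        refine Eq.trans ?_ (congrArg (fun t => w s * r s ^ M * t) (hr' s)).symm
        rw [Finset.mul_sum]
        exact Finset.sum_congr rfl fun b _ => by split_ifs <;> ring
      obtain ⟨b₀, hb₀⟩ : ∃ b, 0 < π b := by
        by_contra h
        push Not at h
        have := Finset.sum_nonpos fun b (_ : b ∈ Finset.univ) => h b
        rw [hπ.2] at this; linarith
      have hlt : ∑ b, π b * ∑ s, w s * r s ^ (M + 1) <
          ∑ b, π b * ∑ s, (if T b s then 0 else w s) * r s ^ M :=
        Finset.sum_lt_sum (fun b _ => mul_le_mul_of_nonneg_left (hcon b).le (hπ.1 b))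
          ⟨b₀, Finset.mem_univ _, mul_lt_mul_of_pos_left (hcon b₀) hb₀⟩
      rw [hav, ← Finset.sum_mul, hπ.2, one_mul] at hlt
      exact lt_irrefl _ hlt
    obtain ⟨c, hc⟩ := ih (fun s => if T b s then 0 else w s)
      (fun s => by split_ifs <;> simp [hw])
    refine ⟨Fin.cons b c, le_trans (le_of_eq ?_) (hc.trans hb)⟩
    refine Finset.sum_congr rfl fun s _ => ?_
    simp only [Fin.exists_fin_succ, Fin.cons_zero, Fin.cons_succ]
    by_cases h1 : T b s <;> by_cases h2 : ∃ i, T (c i) s <;> simp [h1, h2]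

open scoped Classical in
/-- A codebook together with an encoder that selects a good codeword whenever there is one. -/
lemma exists_codebook_encoder {B S : Type*} [Fintype B] [Fintype S] {π : B → ℝ}
    (hπ : π ∈ stdSimplex ℝ B) (T : B → S → Prop) {M : ℕ} [NeZero M] {G τ : ℝ}
    (hM : CoverBound M G τ) {w : S → ℝ} (hw : ∀ s, 0 ≤ w s) (q : S → ℝ)
    (hq : ∀ s, w s ≠ 0 → 0 ≤ q s ∧ q s ≤ 1 ∧ q s ≤ G * ∑ b, if T b s then π b else 0) :
    ∃ (c : Fin M → B) (e : S → Fin M),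
      ∑ s, (if T (c (e s)) s then 0 else w s) ≤ ∑ s, w s * (1 - q s + τ) := by
  obtain ⟨c, hc⟩ := exists_codebook hπ T M w hw
  refine ⟨c, fun s => if h : ∃ i, T (c i) s then h.choose else 0, ?_⟩
  refine le_trans (Finset.sum_le_sum fun s _ => ?_)
    (hc.trans (Finset.sum_le_sum fun s _ => ?_))
  · by_cases h : ∃ i, T (c i) s
    · simp only [dif_pos h, if_pos h.choose_spec, if_pos h, le_refl]
    · rw [if_neg h]
      split_ifs
      · exact hw s
      · exact le_rfl
  · by_cases h0 : w s = 0
    · simp [h0]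
    obtain ⟨q0, q1, q2⟩ := hq s h0
    refine mul_le_mul_of_nonneg_left (hM _ _ q0 q1 ?_ q2) (hw s)
    rw [← hπ.2]
    exact Finset.sum_le_sum fun b _ => by split_ifs <;> simp [hπ.1]

end Covering

/-! ### Superposition covering. -/

section Superposition

variable {A₀ A₁ A₂ S : Type*} [Fintype A₀] [Fintype A₁] [Fintype A₂] [Fintype S]

omit [Fintype A₀] in
open scoped Classical in
/-- Conditional covering: satellite codebooks around cloud centres that were already selected. -/
lemma exists_satellite {p₀ : A₀ → S → ℝ} {p₁ : A₀ → A₁ → S → ℝ} (h₁ : ∀ a b s, 0 ≤ p₁ a b s)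
    (hm : ∀ a s, ∑ b, p₁ a b s = p₀ a s) (hne : Nonempty A₁) (w : S → ℝ) (hw : ∀ s, 0 ≤ w s)
    {M₀ M : ℕ} [NeZero M] {G τ η : ℝ} (hM : CoverBound M G τ) (hτη : 0 ≤ η + τ)
    (E : A₀ → A₁ → S → Prop)
    (hE : ∀ a b s, E a b s → p₁ a b s * ∑ s, p₀ a s ≤ G * (∑ s, p₁ a b s) * p₀ a s)
    (good : A₀ → S → Prop) (hg0 : ∀ a s, good a s → 0 < p₀ a s)
    (hg : ∀ a s, good a s → (1 - η) * p₀ a s ≤ ∑ b, if E a b s then p₁ a b s else 0)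
    (c₀ : Fin M₀ → A₀) (e₀ : S → Fin M₀) :
    ∃ (c : Fin M₀ → Fin M → A₁) (e : S → Fin M),
      ∑ s, (if good (c₀ (e₀ s)) s ∧ ¬ E (c₀ (e₀ s)) (c (e₀ s) (e s)) s then w s else 0) ≤
        (∑ s, w s) * (η + τ) := by
  have h₀ : ∀ a s, 0 ≤ p₀ a s := fun a s => by
    rw [← hm]; exact Finset.sum_nonneg fun b _ => h₁ a b s
  -- Each cloud index m has its own satellite codebook, responsible only for the s that the cloud
  -- encoder maps to m. These sets are disjoint, so the failures add up without loss.
  have key : ∀ m : Fin M₀, ∃ (c : Fin M → A₁) (e : S → Fin M),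
      ∑ s, (if E (c₀ m) (c (e s)) s then 0 else
        if e₀ s = m ∧ good (c₀ m) s then w s else 0) ≤
      ∑ s, (if e₀ s = m then w s else 0) * (η + τ) := by
    intro m
    set a := c₀ m with ha
    have hrhs : ∀ s, 0 ≤ (if e₀ s = m then w s else 0) * (η + τ) := fun s =>
      mul_nonneg (by split_ifs <;> simp [hw]) hτη
    by_cases hpos : ∑ s, p₀ a s = 0
    · refine ⟨fun _ => hne.some, fun _ => 0, Finset.sum_le_sum fun s _ => ?_⟩
      have : ¬ good a s := fun h => (hg0 a s h).ne'
        ((Finset.sum_eq_zero_iff_of_nonneg fun s _ => h₀ a s).1 hpos s (Finset.mem_univ s))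
      simpa [this] using hrhs s
    have hpos : 0 < ∑ s, p₀ a s :=
      lt_of_le_of_ne (Finset.sum_nonneg fun s _ => h₀ a s) (Ne.symm hpos)
    -- Satellites follow the conditional law of b given a. The target q is the probability of E
    -- given (a,s), and the density bound `hE` compares it with G times the probability of E under
    -- that conditional law.
    have hπ : (fun b => (∑ s, p₁ a b s) / ∑ s, p₀ a s) ∈ stdSimplex ℝ A₁ := by
      refine ⟨fun b => div_nonneg (Finset.sum_nonneg fun s _ => h₁ a b s) hpos.le, ?_⟩
      rw [← Finset.sum_div, Finset.sum_comm]
      simp only [hm]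
      exact div_self hpos.ne'
    obtain ⟨c, e, hce⟩ := exists_codebook_encoder hπ (E a) hM
      (w := fun s => if e₀ s = m ∧ good a s then w s else 0)
      (fun s => by split_ifs <;> simp [hw])
      (fun s => (∑ b, if E a b s then p₁ a b s else 0) / p₀ a s) (fun s hs => by
        have hgood : good a s := by
          by_contra h; simp [h] at hs
        have hp := hg0 a s hgood
        refine ⟨div_nonneg (Finset.sum_nonneg fun b _ => by split_ifs <;> simp [h₁]) hp.le,
          (div_le_one hp).2 ?_, ?_⟩
        · rw [← hm]
          exact Finset.sum_le_sum fun b _ => by split_ifs <;> simp [h₁]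
        · rw [Finset.sum_div, Finset.mul_sum]
          refine Finset.sum_le_sum fun b _ => ?_
          split_ifs with hb
          · have := hE a b s hb
            rw [div_le_iff₀ hp, mul_div_assoc', div_mul_eq_mul_div, le_div_iff₀ hpos]
            exact this
          · simp)
    refine ⟨c, e, hce.trans (Finset.sum_le_sum fun s _ => ?_)⟩
    by_cases hs : e₀ s = m ∧ good a s
    · rw [if_pos hs, if_pos hs.1]
      refine mul_le_mul_of_nonneg_left ?_ (hw s)
      have hp := hg0 a s hs.2
      have : 1 - η ≤ (∑ b, if E a b s then p₁ a b s else 0) / p₀ a s :=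
        (le_div_iff₀ hp).2 (hg a s hs.2)
      linarith
    · rw [if_neg hs, zero_mul]; exact hrhs s
  choose c e hce using key
  refine ⟨c, fun s => e (e₀ s) s, ?_⟩
  calc _ = ∑ m, ∑ s, (if E (c₀ m) (c m (e m s)) s then 0 else
        if e₀ s = m ∧ good (c₀ m) s then w s else 0) := by
        rw [Finset.sum_comm]
        refine Finset.sum_congr rfl fun s _ => ?_
        rw [Finset.sum_eq_single (e₀ s) (fun m _ hm => by simp [hm.symm]) (by simp)]
        by_cases h1 : E (c₀ (e₀ s)) (c (e₀ s) (e (e₀ s) s)) s <;> simp [h1]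
    _ ≤ ∑ m, ∑ s, (if e₀ s = m then w s else 0) * (η + τ) :=
        Finset.sum_le_sum fun m _ => hce m
    _ = _ := by
        rw [Finset.sum_comm, Finset.sum_mul]
        refine Finset.sum_congr rfl fun s _ => ?_
        rw [Finset.sum_eq_single (e₀ s) (fun m _ hm => by simp [hm.symm]) (by simp), if_pos rfl]

open scoped Classical in
/-- Markov's inequality for the conditional probability of `¬ E`. -/
lemma sum_not_cond_le {p₀ : A₀ → S → ℝ} {p₁ : A₀ → A₁ → S → ℝ} (h₁ : ∀ a b s, 0 ≤ p₁ a b s)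
    (hm : ∀ a s, ∑ b, p₁ a b s = p₀ a s) {η : ℝ} (hη : 0 < η) (E : A₀ → A₁ → S → Prop) :
    ∑ a, ∑ s, (if (1 - η) * p₀ a s ≤ ∑ b, (if E a b s then p₁ a b s else 0) then 0 else p₀ a s) ≤
      (∑ a, ∑ b, ∑ s, if E a b s then 0 else p₁ a b s) / η := by
  rw [Finset.sum_div]
  refine Finset.sum_le_sum fun a _ => ?_
  rw [Finset.sum_comm, Finset.sum_div]
  refine Finset.sum_le_sum fun s _ => ?_
  have hsplit : (∑ b, if E a b s then 0 else p₁ a b s) =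
      p₀ a s - ∑ b, if E a b s then p₁ a b s else 0 := by
    rw [← hm, ← Finset.sum_sub_distrib]
    exact Finset.sum_congr rfl fun b _ => by split_ifs <;> simp
  split_ifs with h
  · exact div_nonneg (Finset.sum_nonneg fun b _ => by split_ifs <;> simp [h₁]) hη.le
  · rw [le_div_iff₀ hη, hsplit]
    linarith

open scoped Classical in
/-- One-shot superposition covering with two satellite codebooks. -/
theorem exists_superposition_code {p₀ : A₀ → S → ℝ} {p₁ : A₀ → A₁ → S → ℝ}
    {p₂ : A₀ → A₂ → S → ℝ} {pS : S → ℝ}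
    (h₁ : ∀ a b s, 0 ≤ p₁ a b s) (h₂ : ∀ a b s, 0 ≤ p₂ a b s)
    (hm₁ : ∀ a s, ∑ b, p₁ a b s = p₀ a s) (hm₂ : ∀ a s, ∑ b, p₂ a b s = p₀ a s)
    (hS : ∀ s, ∑ a, p₀ a s = pS s) (hsum : ∑ s, pS s = 1)
    {M₀ M₁ M₂ : ℕ} [NeZero M₀] [NeZero M₁] [NeZero M₂] {G₀ G₁ G₂ τ₀ τ₁ τ₂ η : ℝ}
    (hM₀ : CoverBound M₀ G₀ τ₀) (hM₁ : CoverBound M₁ G₁ τ₁) (hM₂ : CoverBound M₂ G₂ τ₂)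
    (hτ₁ : 0 ≤ τ₁) (hτ₂ : 0 ≤ τ₂) (hη : 0 < η)
    (E₁ : A₀ → A₁ → S → Prop) (E₂ : A₀ → A₂ → S → Prop)
    (hE₁ : ∀ a b s, E₁ a b s → p₁ a b s * ∑ s, p₀ a s ≤ G₁ * (∑ s, p₁ a b s) * p₀ a s)
    (hE₂ : ∀ a b s, E₂ a b s → p₂ a b s * ∑ s, p₀ a s ≤ G₂ * (∑ s, p₂ a b s) * p₀ a s) :
    ∃ (c₀ : Fin M₀ → A₀) (e₀ : S → Fin M₀) (c₁ : Fin M₀ → Fin M₁ → A₁) (e₁ : S → Fin M₁)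
      (c₂ : Fin M₀ → Fin M₂ → A₂) (e₂ : S → Fin M₂),
      ∑ s, (if E₁ (c₀ (e₀ s)) (c₁ (e₀ s) (e₁ s)) s ∧ E₂ (c₀ (e₀ s)) (c₂ (e₀ s) (e₂ s)) s
        then 0 else pS s) ≤
      (∑ a, ∑ s, if p₀ a s ≤ G₀ * (∑ s, p₀ a s) * pS s then 0 else p₀ a s) +
        (∑ a, ∑ b, ∑ s, if E₁ a b s then 0 else p₁ a b s) / η +
        (∑ a, ∑ b, ∑ s, if E₂ a b s then 0 else p₂ a b s) / η +
        τ₀ + (η + τ₁) + (η + τ₂) := by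
  have h₀ : ∀ a s, 0 ≤ p₀ a s := fun a s => by
    rw [← hm₁]; exact Finset.sum_nonneg fun b _ => h₁ a b s
  have hS0 : ∀ s, 0 ≤ pS s := fun s => by
    rw [← hS]; exact Finset.sum_nonneg fun a _ => h₀ a s
  have htot : ∑ a, ∑ s, p₀ a s = 1 := by
    rw [Finset.sum_comm]; simp only [hS]; exact hsum
  have hne : ∃ a s, p₀ a s ≠ 0 := by
    by_contra h
    push Not at h
    simp [h] at htot
  obtain ⟨a', s', hp'⟩ := hne
  have hne₁ : Nonempty A₁ := by
    by_contra h
    rw [not_nonempty_iff] at h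
    exact hp' (by rw [← hm₁]; simp)
  have hne₂ : Nonempty A₂ := by
    by_contra h
    rw [not_nonempty_iff] at h
    exact hp' (by rw [← hm₂]; simp)
  -- A cloud centre must be covered at cost G₀ and also leave each satellite event conditional
  -- probability at least 1 - η, so that both satellite coverings then fail with probability at most
  -- η + τ.
  obtain ⟨good, hgood⟩ : ∃ good : A₀ → S → Prop, ∀ a s, good a s ↔
      (0 < p₀ a s ∧ p₀ a s ≤ G₀ * (∑ s, p₀ a s) * pS s ∧
      ((1 - η) * p₀ a s ≤ ∑ b, if E₁ a b s then p₁ a b s else 0) ∧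
      ((1 - η) * p₀ a s ≤ ∑ b, if E₂ a b s then p₂ a b s else 0)) := ⟨_, fun _ _ => Iff.rfl⟩
  obtain ⟨c₀, e₀, hce₀⟩ := exists_codebook_encoder (π := fun a => ∑ s, p₀ a s)
    ⟨fun a => Finset.sum_nonneg fun s _ => h₀ a s, htot⟩ good hM₀ hS0
    (fun s => (∑ a, if good a s then p₀ a s else 0) / pS s) (fun s hs => by
      have hp : 0 < pS s := lt_of_le_of_ne (hS0 s) (Ne.symm hs)
      refine ⟨div_nonneg (Finset.sum_nonneg fun a _ => by split_ifs <;> simp [h₀]) hp.le,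
        (div_le_one hp).2 ?_, ?_⟩
      · rw [← hS]
        exact Finset.sum_le_sum fun a _ => by split_ifs <;> simp [h₀]
      · rw [Finset.sum_div, Finset.mul_sum]
        refine Finset.sum_le_sum fun a _ => ?_
        split_ifs with ha
        · rw [div_le_iff₀ hp]; exact ((hgood a s).1 ha).2.1
        · simp)
  obtain ⟨c₁, e₁, hce₁⟩ := exists_satellite h₁ hm₁ hne₁ pS hS0 hM₁ (by linarith : 0 ≤ η + τ₁) E₁ hE₁
    good (fun a s h => ((hgood a s).1 h).1) (fun a s h => ((hgood a s).1 h).2.2.1) c₀ e₀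
  obtain ⟨c₂, e₂, hce₂⟩ := exists_satellite h₂ hm₂ hne₂ pS hS0 hM₂ (by linarith : 0 ≤ η + τ₂) E₂ hE₂
    good (fun a s h => ((hgood a s).1 h).1) (fun a s h => ((hgood a s).1 h).2.2.2) c₀ e₀
  refine ⟨c₀, e₀, c₁, e₁, c₂, e₂, ?_⟩
  rw [hsum, one_mul] at hce₁ hce₂
  have hfail : ∑ s, pS s * (1 - (∑ a, if good a s then p₀ a s else 0) / pS s + τ₀) =
      (∑ a, ∑ s, if good a s then 0 else p₀ a s) + τ₀ := by
    have : ∀ s, pS s * (1 - (∑ a, if good a s then p₀ a s else 0) / pS s + τ₀) =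
        (∑ a, if good a s then 0 else p₀ a s) + pS s * τ₀ := by
      intro s
      have hsplit : (∑ a, if good a s then 0 else p₀ a s) =
          pS s - ∑ a, if good a s then p₀ a s else 0 := by
        rw [← hS, ← Finset.sum_sub_distrib]
        exact Finset.sum_congr rfl fun b _ => by split_ifs <;> simp
      rw [hsplit]
      by_cases h : pS s = 0
      · have : ∀ a, p₀ a s = 0 := fun a => by
          rw [← hS] at h
          exact (Finset.sum_eq_zero_iff_of_nonneg fun a _ => h₀ a s).1 h a (Finset.mem_univ a)
        simp [h, this]
      · field_simp
    simp only [this]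
    rw [Finset.sum_add_distrib, Finset.sum_comm, ← Finset.sum_mul, hsum, one_mul]
  have hbad : (∑ a, ∑ s, if good a s then 0 else p₀ a s) ≤
      (∑ a, ∑ s, if p₀ a s ≤ G₀ * (∑ s, p₀ a s) * pS s then 0 else p₀ a s) +
        (∑ a, ∑ b, ∑ s, if E₁ a b s then 0 else p₁ a b s) / η +
        (∑ a, ∑ b, ∑ s, if E₂ a b s then 0 else p₂ a b s) / η := by
    refine le_trans ?_ (add_le_add (add_le_add le_rfl (sum_not_cond_le h₁ hm₁ hη E₁))
      (sum_not_cond_le h₂ hm₂ hη E₂))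
    rw [← Finset.sum_add_distrib, ← Finset.sum_add_distrib]
    refine Finset.sum_le_sum fun a _ => ?_
    rw [← Finset.sum_add_distrib, ← Finset.sum_add_distrib]
    refine Finset.sum_le_sum fun s _ => ?_
    have hp := h₀ a s
    rcases hp.eq_or_lt with h0 | h0
    · simp [← h0]
    · by_cases g1 : p₀ a s ≤ G₀ * (∑ s, p₀ a s) * pS s <;>
      by_cases g2 : (1 - η) * p₀ a s ≤ ∑ b, (if E₁ a b s then p₁ a b s else 0) <;>
      by_cases g3 : (1 - η) * p₀ a s ≤ ∑ b, (if E₂ a b s then p₂ a b s else 0) <;>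
      simp only [hgood, h0, g1, g2, g3, and_true, and_false, if_true, if_false] <;> linarith
  calc _ ≤ ∑ s, ((if good (c₀ (e₀ s)) s then 0 else pS s) +
        (if good (c₀ (e₀ s)) s ∧ ¬ E₁ (c₀ (e₀ s)) (c₁ (e₀ s) (e₁ s)) s then pS s else 0) +
        (if good (c₀ (e₀ s)) s ∧ ¬ E₂ (c₀ (e₀ s)) (c₂ (e₀ s) (e₂ s)) s then pS s else 0)) := by
        refine Finset.sum_le_sum fun s _ => ?_
        have hp := hS0 s
        by_cases g1 : good (c₀ (e₀ s)) s <;>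
        by_cases g2 : E₁ (c₀ (e₀ s)) (c₁ (e₀ s) (e₁ s)) s <;>
        by_cases g3 : E₂ (c₀ (e₀ s)) (c₂ (e₀ s) (e₂ s)) s <;>
        simp [g1, g2, g3, hp]
    _ ≤ _ := by
        rw [Finset.sum_add_distrib, Finset.sum_add_distrib]
        rw [hfail] at hce₀
        linarith

end Superposition

/-! ### Covering parameters for blocks. -/

section BlockTools

lemma sum_arrow_prod {ι α β : Type*} [Fintype ι] [DecidableEq ι] [Fintype α] [Fintype β]
    (F : (ι → α × β) → ℝ) : ∑ z, F z = ∑ a : ι → α, ∑ b : ι → β, F fun i => (a i, b i) := by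
  rw [← (Equiv.arrowProdEquivProdArrow ι (fun _ => α) (fun _ => β)).symm.sum_comp,
    Fintype.sum_prod_type]
  rfl

open scoped Classical in
/-- Covering parameters at rate `R` for an information density with mean below `R`, or for a
density that is nowhere positive. -/
lemma exists_coverParams {Z : Type*} [Fintype Z] {p f g : Z → ℝ} (hp : p ∈ stdSimplex ℝ Z)
    (hf : ∀ z, p z ≠ 0 → 0 < f z) (hg : ∀ z, p z ≠ 0 → 0 < g z) (hf0 : ∀ z, 0 ≤ f z) {R : ℝ}
    (h : ∑ z, p z * Real.logb 2 (f z / g z) < R ∨ ∀ z, f z ≤ g z) :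
    ∃ G τ : ℕ → ℝ, (∀ n, 0 ≤ τ n) ∧ Tendsto τ atTop (nhds 0) ∧
      (∀ n : ℕ, CoverBound (⌊(2 : ℝ) ^ ((n : ℝ) * R)⌋₊ + 1) (G n) (τ n)) ∧
      Tendsto (fun n : ℕ => ∑ z : Fin n → Z,
        if ∏ i, f (z i) ≤ G n * ∏ i, g (z i) then 0 else ∏ i, p (z i)) atTop (nhds 0) := by
  have hnn : ∀ (n : ℕ) (z : Fin n → Z), 0 ≤ ∏ i, p (z i) :=
    fun n z => Finset.prod_nonneg fun i _ => hp.1 _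
  rcases h with h | h
  · obtain ⟨c, hc, hcR⟩ := exists_between h
    -- With c between the mean density and R, G = 2^{nc} and T = 2^{n(R-c)} satisfy TG = 2^{nR} ≤ M,
    -- and e^{-T} → 0.
    refine ⟨fun n => 2 ^ ((n : ℝ) * c), fun n => Real.exp (-(2 ^ ((n : ℝ) * (R - c)))),
      fun n => (Real.exp_pos _).le, ?_, fun n => coverBound_exp (by positivity) ?_ (by positivity),
      ?_⟩
    · refine Real.tendsto_exp_neg_atTop_nhds_zero.comp ?_
      have h1 : (1 : ℝ) < 2 ^ (R - c) := Real.one_lt_rpow one_lt_two (by linarith)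
      refine (tendsto_pow_atTop_atTop_of_one_lt h1).congr fun n => ?_
      rw [mul_comm, Real.rpow_mul two_pos.le, Real.rpow_natCast]
    · rw [← Real.rpow_add two_pos, show (n : ℝ) * (R - c) + n * c = n * R by ring]
      push_cast
      exact (Nat.lt_floor_add_one _).le
    · refine squeeze_zero (fun n => Finset.sum_nonneg fun z _ => ?_) (fun n => ?_)
        (tendsto_density_tail hp hf hg hc)
      · split_ifs
        · exact le_rfl
        · exact hnn n z
      · refine Finset.sum_le_sum fun z _ => ?_
        by_cases h1 : ∏ i, f (z i) ≤ 2 ^ ((n : ℝ) * c) * ∏ i, g (z i)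
        · rw [if_pos h1]
          split_ifs
          · exact hnn n z
          · exact le_rfl
        · rw [if_neg h1, if_pos (not_le.1 h1).le]
  · refine ⟨fun _ => 1, fun _ => 0, fun _ => le_rfl, tendsto_const_nhds,
      fun n => coverBound_one (by omega), ?_⟩
    have : ∀ (n : ℕ) (z : Fin n → Z), ∏ i, f (z i) ≤ 1 * ∏ i, g (z i) := fun n z => by
      rw [one_mul]
      exact Finset.prod_le_prod (fun i _ => hf0 _) fun i _ => h _
    simp only [this, if_true, Finset.sum_const_zero]
    exact tendsto_const_nhds

end BlockTools

/-! ### The information density test at a receiver. -/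

section Receiver

variable {α X Y : Type*} [Fintype α] [Fintype X] [Fintype Y]

/-- The receiver accepts the null hypothesis if the information density between the codeword `a`
and the observation `y` exceeds `n c`. -/
def Accepts {n : ℕ} (fA : α → ℝ) (v : Y → ℝ) (fY : α → Y → ℝ) (c : ℝ) (a : Fin n → α)
    (y : Fin n → Y) : Prop :=
  2 ^ ((n : ℝ) * c) * ∏ i, (fA (a i) * v (y i)) < ∏ i, fY (a i) (y i)

omit [Fintype α] in
open scoped Classical in
/-- Type-II error of the density test, for an arbitrary codeword. -/
lemma sum_accepts_le {n : ℕ} {fA : α → ℝ} {v : Y → ℝ} {fY : α → Y → ℝ}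
    (hfY : ∀ a y, 0 ≤ fY a y) (hfA : ∀ a, ∑ y, fY a y = fA a) (c : ℝ)
    (a : Fin n → α) :
    ∑ y : Fin n → Y, (∏ i, v (y i)) * (if Accepts fA v fY c a y then 1 else 0) ≤
      2 ^ (-((n : ℝ) * c)) := by
  have hnn : ∀ y : Fin n → Y, 0 ≤ ∏ i, fY (a i) (y i) := fun y =>
    Finset.prod_nonneg fun i _ => hfY _ _
  have hsum : ∑ y : Fin n → Y, ∏ i, fY (a i) (y i) = ∏ i, fA (a i) := by
    rw [sum_prod_pi fun i y => fY (a i) y]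
    simp only [hfA]
  have hA0 : 0 ≤ ∏ i, fA (a i) := hsum ▸ Finset.sum_nonneg fun y _ => hnn y
  -- A codeword of probability zero is never accepted: the strict inequality in `Accepts` would read
  -- 0 < 0.
  rcases hA0.eq_or_lt with h0 | h0
  · rw [← h0, Finset.sum_eq_zero_iff_of_nonneg fun y _ => hnn y] at hsum
    have : ∀ y : Fin n → Y, ¬ Accepts fA v fY c a y := fun y h => by
      unfold Accepts at h
      rw [hsum y (Finset.mem_univ y), Finset.prod_mul_distrib, ← h0] at h
      simp at h
    simp only [this, if_false, mul_zero, Finset.sum_const_zero]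
    positivity
  · have hpow : (0 : ℝ) < 2 ^ ((n : ℝ) * c) := by positivity
    rw [Real.rpow_neg two_pos.le]
    calc _ ≤ ∑ y : Fin n → Y,
          (2 ^ ((n : ℝ) * c))⁻¹ * ((∏ i, fY (a i) (y i)) / ∏ i, fA (a i)) := by
          refine Finset.sum_le_sum fun y _ => ?_
          split_ifs with h
          · unfold Accepts at h
            rw [Finset.prod_mul_distrib] at h
            rw [mul_one, inv_mul_eq_div, div_div, le_div_iff₀ (by positivity)]
            nlinarith
          · rw [mul_zero]
            exact mul_nonneg (inv_pos.2 hpow).le (div_nonneg (hnn y) hA0)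
      _ = _ := by
          rw [← Finset.mul_sum, ← Finset.sum_div, hsum, div_self h0.ne', mul_one]

open scoped Classical in
/-- Most jointly distributed pairs `(a, x)` are accepted with high conditional probability. -/
lemma tendsto_sum_not_accepts {f : α → X → ℝ} (hf : ∀ a x, 0 ≤ f a x)
    (hf1 : ∑ a, ∑ x, f a x = 1) {W : X → Y → ℝ} (hW : ∀ x y, 0 ≤ W x y)
    (hW1 : ∀ x, ∑ y, W x y = 1) {fA : α → ℝ} {v : Y → ℝ} {fY : α → Y → ℝ}
    (hfY : ∀ a y, fY a y = ∑ x, f a x * W x y) (hfA : ∀ a, ∑ y, fY a y = fA a)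
    (hv : ∀ y, ∑ a, fY a y = v y) {c : ℝ}
    (hc : c < ∑ a, ∑ y, fY a y * Real.logb 2 (fY a y / (fA a * v y))) {η : ℝ} (hη : 0 < η) :
    Tendsto (fun n : ℕ => ∑ a : Fin n → α, ∑ x : Fin n → X,
      if ∑ y : Fin n → Y, (if Accepts fA v fY c a y then 0 else ∏ i, W (x i) (y i)) ≤ η then 0
      else ∏ i, f (a i) (x i)) atTop (nhds 0) := by
  have hY0 : ∀ a y, 0 ≤ fY a y := fun a y => by
    rw [hfY]; exact Finset.sum_nonneg fun x _ => mul_nonneg (hf _ _) (hW _ _)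
  have hA0 : ∀ a y, fY a y ≤ fA a := fun a y => by
    rw [← hfA]; exact Finset.single_le_sum (fun y _ => hY0 a y) (Finset.mem_univ y)
  have hv0 : ∀ a y, fY a y ≤ v y := fun a y => by
    rw [← hv]; exact Finset.single_le_sum (fun a _ => hY0 a y) (Finset.mem_univ a)
  have hp : (fun z : α × Y => fY z.1 z.2) ∈ stdSimplex ℝ (α × Y) := by
    refine ⟨fun z => hY0 _ _, ?_⟩
    rw [Fintype.sum_prod_type, ← hf1]
    refine Finset.sum_congr rfl fun a _ => ?_
    simp only [hfY]
    rw [Finset.sum_comm]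
    simp only [← Finset.mul_sum, hW1, mul_one]
  have hpos : ∀ z : α × Y, fY z.1 z.2 ≠ 0 → 0 < fY z.1 z.2 := fun z h =>
    lt_of_le_of_ne (hY0 _ _) (Ne.symm h)
  -- The tail bound is used for the reciprocal density, hence the threshold -c.
  have hlim := tendsto_density_tail hp (f := fun z => fA z.1 * v z.2) (g := fun z => fY z.1 z.2)
    (fun z h => mul_pos ((hpos z h).trans_le (hA0 _ _)) ((hpos z h).trans_le (hv0 _ _))) hpos
    (c := -c) (by
      have : ∑ z : α × Y, fY z.1 z.2 * Real.logb 2 (fA z.1 * v z.2 / fY z.1 z.2) =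
          -∑ a, ∑ y, fY a y * Real.logb 2 (fY a y / (fA a * v y)) := by
        rw [Fintype.sum_prod_type, ← Finset.sum_neg_distrib]
        refine Finset.sum_congr rfl fun a _ => ?_
        rw [← Finset.sum_neg_distrib]
        refine Finset.sum_congr rfl fun y _ => ?_
        rw [← inv_div, Real.logb_inv]; ring
      rw [this]; linarith)
  -- Markov's inequality turns a small total rejection probability into small mass of the pairs (a,
  -- x) whose conditional rejection probability exceeds η.
  have hlim' := hlim.mul_const η⁻¹
  rw [zero_mul] at hlim'
  refine squeeze_zero (fun n => Finset.sum_nonneg fun a _ => Finset.sum_nonneg fun x _ => ?_)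
    (fun n => ?_) hlim'
  · split_ifs
    · exact le_rfl
    · exact Finset.prod_nonneg fun i _ => hf _ _
  · rw [sum_arrow_prod, Finset.sum_mul]
    refine Finset.sum_le_sum fun a _ => ?_
    have hWn : ∀ (x : Fin n → X) (y : Fin n → Y), 0 ≤ ∏ i, W (x i) (y i) := fun x y =>
      Finset.prod_nonneg fun i _ => hW _ _
    have hfn : ∀ x : Fin n → X, 0 ≤ ∏ i, f (a i) (x i) := fun x =>
      Finset.prod_nonneg fun i _ => hf _ _
    calc _ ≤ ∑ x : Fin n → X, (∏ i, f (a i) (x i)) *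
          (∑ y : Fin n → Y, (if Accepts fA v fY c a y then 0 else ∏ i, W (x i) (y i))) * η⁻¹ := by
          refine Finset.sum_le_sum fun x _ => ?_
          split_ifs with h
          · refine mul_nonneg (mul_nonneg (hfn x) (Finset.sum_nonneg fun y _ => ?_))
              (inv_pos.2 hη).le
            split_ifs
            · exact le_rfl
            · exact hWn x y
          · rw [mul_assoc]
            refine le_mul_of_one_le_right (hfn x) ?_
            rw [← div_eq_mul_inv, one_le_div hη]
            exact (not_le.1 h).le
      _ = _ := by
          rw [← Finset.sum_mul]
          congr 1
          simp only [Finset.mul_sum]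
          rw [Finset.sum_comm]
          refine Finset.sum_congr rfl fun y _ => ?_
          have hiff : 2 ^ ((n : ℝ) * -c) * ∏ i, fY (a i) (y i) ≤ ∏ i, (fA (a i) * v (y i)) ↔
              ¬ Accepts fA v fY c a y := by
            unfold Accepts
            rw [not_lt, mul_neg, Real.rpow_neg two_pos.le, inv_mul_le_iff₀ (by positivity)]
          simp only [hiff]
          by_cases h : Accepts fA v fY c a y
          · simp [h]
          · simp only [h, if_false, not_false_eq_true, if_true, hfY]
            rw [← sum_prod_pi fun i x => f (a i) x * W x (y i)]
            simp only [Finset.prod_mul_distrib]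

end Receiver

/-! ### Deterministic codes and their error probabilities. -/

section DeterministicCode

variable {X Y₁ Y₂ : Type*} [Fintype X] [Fintype Y₁] [Fintype Y₂] {R₀ R₁ R₂ : ℝ} {n : ℕ}
  {P : X × Y₁ × Y₂ → ℝ} {V : X → Y₁ × Y₂ → ℝ}

open scoped Classical in
/-- The code with the deterministic encoder `e` and the acceptance regions `D₁`, `D₂`. -/
noncomputable def detCode (e : (Fin n → X) → Msg R₀ n × Msg R₁ n × Msg R₂ n)
    (D₁ : (Fin n → Y₁) → Msg R₀ n → Msg R₁ n → Prop)
    (D₂ : (Fin n → Y₂) → Msg R₀ n → Msg R₂ n → Prop) : Code X Y₁ Y₂ R₀ R₁ R₂ n where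
  enc x m := if m = e x then 1 else 0
  enc_mem x := ⟨fun m => by positivity, by simp⟩
  dec₁ y m₀ m₁ := if D₁ y m₀ m₁ then 0 else 1
  dec₂ y m₀ m₂ := if D₂ y m₀ m₂ then 0 else 1

variable (e : (Fin n → X) → Msg R₀ n × Msg R₁ n × Msg R₂ n)
  (D₁ : (Fin n → Y₁) → Msg R₀ n → Msg R₁ n → Prop)
  (D₂ : (Fin n → Y₂) → Msg R₀ n → Msg R₂ n → Prop)

open scoped Classical in
lemma typeI₁_detCode (hV : IsChannelOf P V) : (detCode e D₁ D₂).typeI₁ P =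
    ∑ x : Fin n → X, (∏ i, lawX P (x i)) *
      ∑ y : Fin n → Y₁, if D₁ y (e x).1 (e x).2.1 then 0 else ∏ i, chan₁ V (x i) (y i) := by
  have h := sum_outcomeLaw₁ (detCode e D₁ D₂) hV
    fun _ m y => if D₁ y m.1 m.2.1 then 0 else 1
  have h1 : (detCode e D₁ D₂).typeI₁ P = ∑ ω, (detCode e D₁ D₂).outcomeLaw P ω *
      (if D₁ ω.1.2.1 ω.2.1 ω.2.2.1 then 0 else 1) := by
    rw [Code.typeI₁, prob_eq_sum]
    refine Finset.sum_congr rfl fun ω _ => ?_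
    by_cases hD : D₁ ω.1.2.1 ω.2.1 ω.2.2.1 <;> simp [Code.decision₁, detCode, hD]
  rw [h1, h]
  refine Finset.sum_congr rfl fun x _ => ?_
  rw [Finset.sum_eq_single (e x) (fun m _ hm => by simp [detCode, hm]) (by simp)]
  simp [detCode]

open scoped Classical in
lemma typeI₂_detCode (hV : IsChannelOf P V) : (detCode e D₁ D₂).typeI₂ P =
    ∑ x : Fin n → X, (∏ i, lawX P (x i)) *
      ∑ y : Fin n → Y₂, if D₂ y (e x).1 (e x).2.2 then 0 else ∏ i, chan₂ V (x i) (y i) := by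
  have h := sum_outcomeLaw₂ (detCode e D₁ D₂) hV
    fun _ m y => if D₂ y m.1 m.2.2 then 0 else 1
  have h1 : (detCode e D₁ D₂).typeI₂ P = ∑ ω, (detCode e D₁ D₂).outcomeLaw P ω *
      (if D₂ ω.1.2.2 ω.2.1 ω.2.2.2 then 0 else 1) := by
    rw [Code.typeI₂, prob_eq_sum]
    refine Finset.sum_congr rfl fun ω _ => ?_
    by_cases hD : D₂ ω.1.2.2 ω.2.1 ω.2.2.2 <;> simp [Code.decision₂, detCode, hD]
  rw [h1, h]
  refine Finset.sum_congr rfl fun x _ => ?_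
  rw [Finset.sum_eq_single (e x) (fun m _ hm => by simp [detCode, hm]) (by simp)]
  simp [detCode]

open scoped Classical in
lemma typeII₁_detCode_le (hP : P ∈ stdSimplex ℝ (X × Y₁ × Y₂)) (hV : IsChannelOf P V) {b : ℝ}
    (hb : ∀ m₀ m₁, ∑ y : Fin n → Y₁, (∏ i, output (chan₁ V) (lawX P) (y i)) *
      (if D₁ y m₀ m₁ then 1 else 0) ≤ b) : (detCode e D₁ D₂).typeII₁ P ≤ b := by
  have hp := outcomeLaw_mem_stdSimplex (detCode e D₁ D₂) hP
  have h := sum_altLaw₁ (detCode e D₁ D₂) hP hV fun m y => if D₁ y m.1 m.2.1 then 1 else 0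
  have h1 : (detCode e D₁ D₂).typeII₁ P = ∑ ω, (detCode e D₁ D₂).outcomeLaw (altLaw P) ω *
      (if D₁ ω.1.2.1 ω.2.1 ω.2.2.1 then 1 else 0) := by
    rw [Code.typeII₁, prob_eq_sum]
    refine Finset.sum_congr rfl fun ω _ => ?_
    by_cases hD : D₁ ω.1.2.1 ω.2.1 ω.2.2.1 <;> simp [Code.decision₁, detCode, hD]
  rw [h1, h]
  refine (Finset.sum_le_sum fun ω _ => mul_le_mul_of_nonneg_left (hb _ _) (hp.1 ω)).trans_eq ?_
  rw [← Finset.sum_mul, hp.2, one_mul]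

open scoped Classical in
lemma typeII₂_detCode_le (hP : P ∈ stdSimplex ℝ (X × Y₁ × Y₂)) (hV : IsChannelOf P V) {b : ℝ}
    (hb : ∀ m₀ m₂, ∑ y : Fin n → Y₂, (∏ i, output (chan₂ V) (lawX P) (y i)) *
      (if D₂ y m₀ m₂ then 1 else 0) ≤ b) : (detCode e D₁ D₂).typeII₂ P ≤ b := by
  have hp := outcomeLaw_mem_stdSimplex (detCode e D₁ D₂) hP
  have h := sum_altLaw₂ (detCode e D₁ D₂) hP hV fun m y => if D₂ y m.1 m.2.2 then 1 else 0
  have h1 : (detCode e D₁ D₂).typeII₂ P = ∑ ω, (detCode e D₁ D₂).outcomeLaw (altLaw P) ω *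
      (if D₂ ω.1.2.2 ω.2.1 ω.2.2.2 then 1 else 0) := by
    rw [Code.typeII₂, prob_eq_sum]
    refine Finset.sum_congr rfl fun ω _ => ?_
    by_cases hD : D₂ ω.1.2.2 ω.2.1 ω.2.2.2 <;> simp [Code.decision₂, detCode, hD]
  rw [h1, h]
  refine (Finset.sum_le_sum fun ω _ => mul_le_mul_of_nonneg_left (hb _ _) (hp.1 ω)).trans_eq ?_
  rw [← Finset.sum_mul, hp.2, one_mul]

end DeterministicCode

open AuxSpace

/-! ### Covering parameters of auxiliary variables. -/

section Params

variable {Ω α β γ : Type*} [Fintype Ω] [Fintype α] [Fintype β] [Fintype γ] {p : Ω → ℝ}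

lemma condMutualInfo_eq_sum_law (p : Ω → ℝ) (A : Ω → α) (B : Ω → β) (C : Ω → γ) :
    condMutualInfo p A B C = ∑ z : (γ × α) × β, law p (fun ω => ((C ω, A ω), B ω)) z *
      Real.logb 2 (law p (fun ω => ((C ω, A ω), B ω)) z * law p C z.1.1 /
        (law p (fun ω => (C ω, A ω)) z.1 * law p (fun ω => (C ω, B ω)) (z.1.1, z.2))) := by
  rw [condMutualInfo_eq_sum, sum_law_mul p (fun ω => ((C ω, A ω), B ω))
    (fun z => Real.logb 2 (law p (fun ω => ((C ω, A ω), B ω)) z * law p C z.1.1 /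
        (law p (fun ω => (C ω, A ω)) z.1 * law p (fun ω => (C ω, B ω)) (z.1.1, z.2))))]
  refine Finset.sum_congr rfl fun ω _ => ?_
  rw [law_congr_iff (A := fun ω => (A ω, B ω, C ω)) (B := fun ω => ((C ω, A ω), B ω))
      (b := ((C ω, A ω), B ω)) (fun ω' => by simp only [Prod.mk.injEq]; tauto),
    law_congr_iff (A := fun ω => (A ω, C ω)) (B := fun ω => (C ω, A ω)) (b := (C ω, A ω))
      (fun ω' => by simp only [Prod.mk.injEq]; tauto),
    law_congr_iff (A := fun ω => (B ω, C ω)) (B := fun ω => (C ω, B ω)) (b := (C ω, B ω))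
      (fun ω' => by simp only [Prod.mk.injEq]; tauto)]

/-- Conditional independence makes the density at most 1 everywhere; with the denominator cleared,
P_C = 0 is included. This feeds the case of covering with G = 1. -/
lemma law_mul_le_of_condMutualInfo_le_zero (hp : ∀ ω, 0 ≤ p ω) (A : Ω → α) (B : Ω → β)
    (C : Ω → γ) (h : condMutualInfo p A B C ≤ 0) (z : (γ × α) × β) :
    law p (fun ω => ((C ω, A ω), B ω)) z * law p C z.1.1 ≤
      law p (fun ω => (C ω, A ω)) z.1 * law p (fun ω => (C ω, B ω)) (z.1.1, z.2) := by
  obtain ⟨⟨c, a⟩, b⟩ := z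
  have h1 := law_eq_condProd_of_condMutualInfo_le_zero hp A B C h a b c
  rw [law_congr_iff (A := fun ω => (A ω, B ω, C ω)) (B := fun ω => ((C ω, A ω), B ω))
      (b := ((c, a), b)) (fun ω' => by simp only [Prod.mk.injEq]; tauto),
    law_congr_iff (A := fun ω => (A ω, C ω)) (B := fun ω => (C ω, A ω)) (b := (c, a))
      (fun ω' => by simp only [Prod.mk.injEq]; tauto),
    law_congr_iff (A := fun ω => (B ω, C ω)) (B := fun ω => (C ω, B ω)) (b := (c, b))
      (fun ω' => by simp only [Prod.mk.injEq]; tauto)] at h1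
  by_cases h0 : law p C c = 0
  · simp only [h0, mul_zero]
    exact mul_nonneg (law_nonneg hp _ _) (law_nonneg hp _ _)
  · rw [h1, div_mul_cancel₀ _ h0]

open scoped Classical in
lemma exists_cloudParams (hp : p ∈ stdSimplex ℝ Ω) (A : Ω → α) (B : Ω → β) {R : ℝ}
    (h : mutualInfo p A B < R ∨ mutualInfo p A B ≤ 0) :
    ∃ G τ : ℕ → ℝ, (∀ n, 0 ≤ τ n) ∧ Tendsto τ atTop (nhds 0) ∧
      (∀ n : ℕ, CoverBound (⌊(2 : ℝ) ^ ((n : ℝ) * R)⌋₊ + 1) (G n) (τ n)) ∧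
      Tendsto (fun n : ℕ => ∑ z : Fin n → α × β,
        if ∏ i, law p (fun ω => (A ω, B ω)) (z i) ≤
          G n * ∏ i, (law p A (z i).1 * law p B (z i).2)
        then 0 else ∏ i, law p (fun ω => (A ω, B ω)) (z i)) atTop (nhds 0) := by
  have hpos : ∀ z, law p (fun ω => (A ω, B ω)) z ≠ 0 → 0 < law p (fun ω => (A ω, B ω)) z :=
    fun z hz => lt_of_le_of_ne (law_nonneg hp.1 _ _) (Ne.symm hz)
  refine exists_coverParams (f := law p (fun ω => (A ω, B ω)))
    (g := fun z => law p A z.1 * law p B z.2) (law_mem_stdSimplex hp _) hpos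
    (fun z hz => mul_pos ((hpos z hz).trans_le (law_le_law hp.1 (by rintro ω rfl; rfl)))
      ((hpos z hz).trans_le (law_le_law hp.1 (by rintro ω rfl; rfl))))
    (fun z => law_nonneg hp.1 _ _) ?_
  refine h.imp (fun h => ?_) fun h z => (law_eq_mul_of_mutualInfo_le_zero hp A B h z.1 z.2).le
  rwa [Fintype.sum_prod_type]

-- The density P(c,a,b)P(c) / (P(c,a)P(c,b)) is kept as a product inequality, so that its block
-- version is literally the hypothesis on E₁ and E₂ in `exists_superposition_code`.
open scoped Classical in
lemma exists_satelliteParams (hp : p ∈ stdSimplex ℝ Ω) (A : Ω → α) (B : Ω → β) (C : Ω → γ) {R : ℝ}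
    (h : condMutualInfo p A B C < R ∨ condMutualInfo p A B C ≤ 0) :
    ∃ G τ : ℕ → ℝ, (∀ n, 0 ≤ τ n) ∧ Tendsto τ atTop (nhds 0) ∧
      (∀ n : ℕ, CoverBound (⌊(2 : ℝ) ^ ((n : ℝ) * R)⌋₊ + 1) (G n) (τ n)) ∧
      Tendsto (fun n : ℕ => ∑ z : Fin n → (γ × α) × β,
        if ∏ i, (law p (fun ω => ((C ω, A ω), B ω)) (z i) * law p C (z i).1.1) ≤
          G n * ∏ i, (law p (fun ω => (C ω, A ω)) (z i).1 *
            law p (fun ω => (C ω, B ω)) ((z i).1.1, (z i).2))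
        then 0 else ∏ i, law p (fun ω => ((C ω, A ω), B ω)) (z i)) atTop (nhds 0) := by
  have hpos : ∀ z, law p (fun ω => ((C ω, A ω), B ω)) z ≠ 0 →
      0 < law p (fun ω => ((C ω, A ω), B ω)) z :=
    fun z hz => lt_of_le_of_ne (law_nonneg hp.1 _ _) (Ne.symm hz)
  refine exists_coverParams
    (f := fun z => law p (fun ω => ((C ω, A ω), B ω)) z * law p C z.1.1)
    (g := fun z => law p (fun ω => (C ω, A ω)) z.1 * law p (fun ω => (C ω, B ω)) (z.1.1, z.2))
    (law_mem_stdSimplex hp _)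
    (fun z hz => mul_pos (hpos z hz)
      ((hpos z hz).trans_le (law_le_law hp.1 (by rintro ω rfl; rfl))))
    (fun z hz => mul_pos ((hpos z hz).trans_le (law_le_law hp.1 (by rintro ω rfl; rfl)))
      ((hpos z hz).trans_le (law_le_law hp.1 (by rintro ω rfl; rfl))))
    (fun z => mul_nonneg (law_nonneg hp.1 _ _) (law_nonneg hp.1 _ _)) ?_
  refine h.imp (fun h => ?_) fun h z => law_mul_le_of_condMutualInfo_le_zero hp.1 A B C h z
  rwa [← condMutualInfo_eq_sum_law]

end Params

/-! ### Codes from auxiliary variables. -/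

section Achievability

variable {X Y₁ Y₂ : Type*} [Fintype X] [Fintype Y₁] [Fintype Y₂] {R₀ R₁ R₂ : ℝ}
  {P : X × Y₁ × Y₂ → ℝ} {V : X → Y₁ × Y₂ → ℝ} {k₀ k₁ k₂ : ℕ} {q : AuxSpace k₀ k₁ k₂ X Y₁ Y₂ → ℝ}

lemma sum_prod_law_fst {Ω α β : Type*} [Fintype Ω] [Fintype β] (p : Ω → ℝ) (A : Ω → α) (B : Ω → β)
    {n : ℕ} (a : Fin n → α) :
    ∑ b : Fin n → β, ∏ i, law p (fun ω => (A ω, B ω)) (a i, b i) = ∏ i, law p A (a i) := by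
  rw [sum_prod_pi fun i b => law p (fun ω => (A ω, B ω)) (a i, b)]
  exact Finset.prod_congr rfl fun i _ => (law_eq_sum_fst p A B _).symm

lemma sum_prod_law_snd {Ω α β : Type*} [Fintype Ω] [Fintype α] (p : Ω → ℝ) (A : Ω → α) (B : Ω → β)
    {n : ℕ} (b : Fin n → β) :
    ∑ a : Fin n → α, ∏ i, law p (fun ω => (A ω, B ω)) (a i, b i) = ∏ i, law p B (b i) := by
  rw [sum_prod_pi fun i a => law p (fun ω => (A ω, B ω)) (a, b i)]
  exact Finset.prod_congr rfl fun i _ => (law_eq_sum_snd p A B _).symm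

lemma sum_prod_law_mid {Ω α β γ : Type*} [Fintype Ω] [Fintype γ] (p : Ω → ℝ)
    (C : Ω → α) (A : Ω → γ) (B : Ω → β) {n : ℕ} (a : Fin n → α) (b : Fin n → β) :
    ∑ u : Fin n → γ, ∏ i, law p (fun ω => ((C ω, A ω), B ω)) ((a i, u i), b i) =
      ∏ i, law p (fun ω => (C ω, B ω)) (a i, b i) := by
  rw [sum_prod_pi fun i u => law p (fun ω => ((C ω, A ω), B ω)) ((a i, u), b i)]
  refine Finset.prod_congr rfl fun i _ => ?_
  rw [law_eq_sum_fst p (fun ω => (C ω, B ω)) A]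
  exact Finset.sum_congr rfl fun u _ => law_congr_iff fun ω => by
    simp only [Prod.mk.injEq]; tauto

open scoped Classical in
lemma sum_not_and_le {A B S : Type*} [Fintype A] [Fintype B] [Fintype S] {p : A → B → S → ℝ}
    (hp : ∀ a b s, 0 ≤ p a b s) {H E F : A → B → S → Prop}
    (hH : ∀ a b s, H a b s ↔ E a b s ∧ F a b s) :
    (∑ a, ∑ b, ∑ s, if H a b s then 0 else p a b s) ≤
      (∑ a, ∑ b, ∑ s, if E a b s then 0 else p a b s) +
      ∑ a, ∑ b, ∑ s, if F a b s then 0 else p a b s := by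
  simp only [← Finset.sum_add_distrib]
  refine Finset.sum_le_sum fun a _ => Finset.sum_le_sum fun b _ => Finset.sum_le_sum fun s _ => ?_
  have := hp a b s
  by_cases h1 : E a b s <;> by_cases h2 : F a b s <;> simp [hH, h1, h2, this]

open scoped Classical in
lemma sum_mul_le_sum_add {S : Type*} [Fintype S] {w t : S → ℝ} (hw : w ∈ stdSimplex ℝ S) {η : ℝ}
    (hη : 0 ≤ η) (E : S → Prop) (ht1 : ∀ s, t s ≤ 1) (ht : ∀ s, E s → t s ≤ η) :
    ∑ s, w s * t s ≤ (∑ s, if E s then 0 else w s) + η := by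
  calc _ ≤ ∑ s, ((if E s then 0 else w s) + w s * η) := by
        refine Finset.sum_le_sum fun s _ => ?_
        have hs := hw.1 s
        split_ifs with h
        · rw [zero_add]; exact mul_le_mul_of_nonneg_left (ht s h) hs
        · have := mul_le_mul_of_nonneg_left (ht1 s) hs
          have := mul_nonneg hs hη
          linarith
    _ = _ := by rw [Finset.sum_add_distrib, ← Finset.sum_mul, hw.2, one_mul]

lemma le_three_mul_of_le {F A B₁ B₂ C₁ C₂ D₁ D₂ t₀ t₁ t₂ η : ℝ}
    (h : F ≤ A + B₁ / η + B₂ / η + t₀ + (η + t₁) + (η + t₂)) (h₁ : B₁ ≤ C₁ + D₁)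
    (h₂ : B₂ ≤ C₂ + D₂) (hη : 0 < η)
    (hlt : A + (C₁ + D₁) / η + (C₂ + D₂) / η + t₀ + t₁ + t₂ < η) : F ≤ 3 * η := by
  have d1 := div_le_div_of_nonneg_right h₁ hη.le
  have d2 := div_le_div_of_nonneg_right h₂ hη.le
  linarith

set_option maxHeartbeats 400000 in
open scoped Classical in
/-- Codes for large blocklengths, from auxiliary random variables with slack in the rates. -/
theorem eventually_exists_code (hP : P ∈ stdSimplex ℝ (X × Y₁ × Y₂)) (hq : IsAuxLaw P q)
    (h0 : mutualInfo q U₀ srcX < R₀ ∨ mutualInfo q U₀ srcX ≤ 0)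
    (h1 : condMutualInfo q U₁ srcX U₀ < R₁ ∨ condMutualInfo q U₁ srcX U₀ ≤ 0)
    (h2 : condMutualInfo q U₂ srcX U₀ < R₂ ∨ condMutualInfo q U₂ srcX U₀ ≤ 0) {r₁ r₂ : ℝ}
    (hr₁ : r₁ < mutualInfo q (fun ω => (U₀ ω, U₁ ω)) srcY₁)
    (hr₂ : r₂ < mutualInfo q (fun ω => (U₀ ω, U₂ ω)) srcY₂) {ε : ℝ} (hε : 0 < ε) :
    ∀ᶠ n : ℕ in atTop, ∃ c : Code X Y₁ Y₂ R₀ R₁ R₂ n, c.typeI₁ P ≤ ε ∧ c.typeI₂ P ≤ ε ∧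
      c.typeII₁ P ≤ 2 ^ (-((n : ℝ) * r₁)) ∧ c.typeII₂ P ≤ 2 ^ (-((n : ℝ) * r₂)) := by
  obtain ⟨V, hV⟩ := exists_isChannelOf hP
  have hPX : lawX P ∈ stdSimplex ℝ X := law_mem_stdSimplex hP _
  -- Covering failure takes 3η: two slacks η from the satellites, and all vanishing terms below a
  -- third η. The test takes the fourth.
  set η : ℝ := ε / 4 with hηdef
  have hη : 0 < η := by positivity
  obtain ⟨G₀, τ₀, -, hτ₀, hM₀, ht₀⟩ := exists_cloudParams hq.1 U₀ srcX h0
  obtain ⟨G₁, τ₁, hτ₁0, hτ₁, hM₁, ht₁⟩ := exists_satelliteParams hq.1 U₁ srcX U₀ h1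
  obtain ⟨G₂, τ₂, hτ₂0, hτ₂, hM₂, ht₂⟩ := exists_satelliteParams hq.1 U₂ srcX U₀ h2
  let U₀₁ : AuxSpace k₀ k₁ k₂ X Y₁ Y₂ → Fin k₀ × Fin k₁ := fun ω => (U₀ ω, U₁ ω)
  let U₀₂ : AuxSpace k₀ k₁ k₂ X Y₁ Y₂ → Fin k₀ × Fin k₂ := fun ω => (U₀ ω, U₂ ω)
  let g₁ := fun u y => law q (fun ω => (U₀₁ ω, srcY₁ ω)) (u, y)
  let g₂ := fun u y => law q (fun ω => (U₀₂ ω, srcY₂ ω)) (u, y)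
  have hW₁ : ∀ x y, 0 ≤ chan₁ V x y := fun x y => Finset.sum_nonneg fun _ _ => (hV.mem x).1 _
  have hW₂ : ∀ x y, 0 ≤ chan₂ V x y := fun x y => Finset.sum_nonneg fun _ _ => (hV.mem x).1 _
  have ha₁ := tendsto_sum_not_accepts
    (f := fun u x => law q (fun ω => (U₀₁ ω, srcX ω)) (u, x)) (fun _ _ => law_nonneg hq.1.1 _ _)
    (by rw [← Fintype.sum_prod_type', sum_law, hq.1.2]) hW₁ (chan₁_sum hV)
    (fA := law q U₀₁) (v := law q srcY₁) (fY := g₁)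
    (fun u y => hq.law_pair₁ hV (fun u => (u.1, u.2.1)) u y)
    (fun u => (law_eq_sum_fst q U₀₁ srcY₁ u).symm) (fun y => (law_eq_sum_snd q U₀₁ srcY₁ y).symm)
    hr₁ hη
  have ha₂ := tendsto_sum_not_accepts
    (f := fun u x => law q (fun ω => (U₀₂ ω, srcX ω)) (u, x)) (fun _ _ => law_nonneg hq.1.1 _ _)
    (by rw [← Fintype.sum_prod_type', sum_law, hq.1.2]) hW₂ (chan₂_sum hV)
    (fA := law q U₀₂) (v := law q srcY₂) (fY := g₂)
    (fun u y => hq.law_pair₂ hV (fun u => (u.1, u.2.2)) u y)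
    (fun u => (law_eq_sum_fst q U₀₂ srcY₂ u).symm) (fun y => (law_eq_sum_snd q U₀₂ srcY₂ y).symm)
    hr₂ hη
  have hlim := ((((ht₀.add ((ht₁.add ha₁).div_const η)).add ((ht₂.add ha₂).div_const η)).add
    hτ₀).add hτ₁).add hτ₂
  simp only [add_zero, zero_div] at hlim
  filter_upwards [hlim.eventually_lt_const hη] with n hn
  let p₀ : (Fin n → Fin k₀) → (Fin n → X) → ℝ := fun a s =>
    ∏ i, law q (fun ω => (U₀ ω, srcX ω)) (a i, s i)
  let p₁ : (Fin n → Fin k₀) → (Fin n → Fin k₁) → (Fin n → X) → ℝ := fun a b s =>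
    ∏ i, law q (fun ω => ((U₀ ω, U₁ ω), srcX ω)) ((a i, b i), s i)
  let p₂ : (Fin n → Fin k₀) → (Fin n → Fin k₂) → (Fin n → X) → ℝ := fun a b s =>
    ∏ i, law q (fun ω => ((U₀ ω, U₂ ω), srcX ω)) ((a i, b i), s i)
  let pS : (Fin n → X) → ℝ := fun s => ∏ i, lawX P (s i)
  have hpS : pS ∈ stdSimplex ℝ (Fin n → X) := by
    refine ⟨fun s => Finset.prod_nonneg fun i _ => hPX.1 _, ?_⟩
    rw [sum_prod_pi fun (_ : Fin n) x => lawX P x]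
    simp [hPX.2]
  have hp₁ : ∀ a b s, 0 ≤ p₁ a b s := fun a b s =>
    Finset.prod_nonneg fun i _ => law_nonneg hq.1.1 _ _
  have hp₂ : ∀ a b s, 0 ≤ p₂ a b s := fun a b s =>
    Finset.prod_nonneg fun i _ => law_nonneg hq.1.1 _ _
  have s0 : ∀ a, ∑ s, p₀ a s = ∏ i, law q U₀ (a i) := sum_prod_law_fst q U₀ srcX
  have s1 : ∀ a b, ∑ s, p₁ a b s = ∏ i, law q (fun ω => (U₀ ω, U₁ ω)) (a i, b i) := fun a b =>
    sum_prod_law_fst q U₀₁ srcX (fun i => (a i, b i))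
  have s2 : ∀ a b, ∑ s, p₂ a b s = ∏ i, law q (fun ω => (U₀ ω, U₂ ω)) (a i, b i) := fun a b =>
    sum_prod_law_fst q U₀₂ srcX (fun i => (a i, b i))
  let C₁ := fun a b s => p₁ a b s * ∑ s, p₀ a s ≤ G₁ n * (∑ s, p₁ a b s) * p₀ a s
  let C₂ := fun a b s => p₂ a b s * ∑ s, p₀ a s ≤ G₂ n * (∑ s, p₂ a b s) * p₀ a s
  -- Success of the test given x^n is made part of the event to be covered. A selected codeword then
  -- works for the receiver by construction, although it is not jointly i.i.d. with x^n.
  let T₁ : (Fin n → Fin k₀) → (Fin n → Fin k₁) → (Fin n → X) → Prop := fun a b s =>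
    (∑ y : Fin n → Y₁, if Accepts (law q U₀₁) (law q srcY₁) g₁ r₁ (fun i => (a i, b i)) y
      then 0 else ∏ i, chan₁ V (s i) (y i)) ≤ η
  let T₂ : (Fin n → Fin k₀) → (Fin n → Fin k₂) → (Fin n → X) → Prop := fun a b s =>
    (∑ y : Fin n → Y₂, if Accepts (law q U₀₂) (law q srcY₂) g₂ r₂ (fun i => (a i, b i)) y
      then 0 else ∏ i, chan₂ V (s i) (y i)) ≤ η
  obtain ⟨E₁, hE₁⟩ : ∃ E : (Fin n → Fin k₀) → (Fin n → Fin k₁) → (Fin n → X) → Prop,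
      ∀ a b s, E a b s ↔ C₁ a b s ∧ T₁ a b s := ⟨_, fun _ _ _ => Iff.rfl⟩
  obtain ⟨E₂, hE₂⟩ : ∃ E : (Fin n → Fin k₀) → (Fin n → Fin k₂) → (Fin n → X) → Prop,
      ∀ a b s, E a b s ↔ C₂ a b s ∧ T₂ a b s := ⟨_, fun _ _ _ => Iff.rfl⟩
  obtain ⟨c₀, e₀, c₁, e₁, c₂, e₂, hfail⟩ := exists_superposition_code (p₀ := p₀) (pS := pS) hp₁ hp₂
    (fun a s => sum_prod_law_mid q U₀ U₁ srcX a s) (fun a s => sum_prod_law_mid q U₀ U₂ srcX a s)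
    (fun s => by rw [sum_prod_law_snd q U₀ srcX, hq.law_srcX]) hpS.2 (hM₀ n) (hM₁ n) (hM₂ n)
    (hτ₁0 n) (hτ₂0 n) hη E₁ E₂
    (fun a b s h => ((hE₁ a b s).1 h).1) (fun a b s h => ((hE₂ a b s).1 h).1)
  have b0 : (∑ a, ∑ s, if p₀ a s ≤ G₀ n * (∑ s, p₀ a s) * pS s then 0 else p₀ a s) =
      ∑ z : Fin n → Fin k₀ × X,
        if ∏ i, law q (fun ω => (U₀ ω, srcX ω)) (z i) ≤
          G₀ n * ∏ i, (law q U₀ (z i).1 * law q srcX (z i).2)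
        then 0 else ∏ i, law q (fun ω => (U₀ ω, srcX ω)) (z i) := by
    rw [sum_arrow_prod]
    simp only [s0, p₀, pS, Finset.prod_mul_distrib, hq.law_srcX, mul_assoc]
  have b1 : (∑ a, ∑ b, ∑ s, if C₁ a b s then 0 else p₁ a b s) =
      ∑ z : Fin n → (Fin k₀ × Fin k₁) × X,
        if ∏ i, (law q (fun ω => ((U₀ ω, U₁ ω), srcX ω)) (z i) * law q U₀ (z i).1.1) ≤
          G₁ n * ∏ i, (law q (fun ω => (U₀ ω, U₁ ω)) (z i).1 *
            law q (fun ω => (U₀ ω, srcX ω)) ((z i).1.1, (z i).2))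
        then 0 else ∏ i, law q (fun ω => ((U₀ ω, U₁ ω), srcX ω)) (z i) := by
    rw [sum_arrow_prod, sum_arrow_prod]
    simp only [C₁, s0, s1, p₀, p₁, Finset.prod_mul_distrib, mul_assoc]
  have b2 : (∑ a, ∑ b, ∑ s, if C₂ a b s then 0 else p₂ a b s) =
      ∑ z : Fin n → (Fin k₀ × Fin k₂) × X,
        if ∏ i, (law q (fun ω => ((U₀ ω, U₂ ω), srcX ω)) (z i) * law q U₀ (z i).1.1) ≤
          G₂ n * ∏ i, (law q (fun ω => (U₀ ω, U₂ ω)) (z i).1 *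
            law q (fun ω => (U₀ ω, srcX ω)) ((z i).1.1, (z i).2))
        then 0 else ∏ i, law q (fun ω => ((U₀ ω, U₂ ω), srcX ω)) (z i) := by
    rw [sum_arrow_prod, sum_arrow_prod]
    simp only [C₂, s0, s2, p₀, p₂, Finset.prod_mul_distrib, mul_assoc]
  have b3 := sum_arrow_prod fun a : Fin n → Fin k₀ × Fin k₁ => ∑ x : Fin n → X,
      if ∑ y : Fin n → Y₁, (if Accepts (law q U₀₁) (law q srcY₁) g₁ r₁ a y then 0
        else ∏ i, chan₁ V (x i) (y i)) ≤ η then 0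
      else ∏ i, law q (fun ω => (U₀₁ ω, srcX ω)) (a i, x i)
  have b4 := sum_arrow_prod fun a : Fin n → Fin k₀ × Fin k₂ => ∑ x : Fin n → X,
      if ∑ y : Fin n → Y₂, (if Accepts (law q U₀₂) (law q srcY₂) g₂ r₂ a y then 0
        else ∏ i, chan₂ V (x i) (y i)) ≤ η then 0
      else ∏ i, law q (fun ω => (U₀₂ ω, srcX ω)) (a i, x i)
  have d1 := sum_not_and_le hp₁ hE₁
  have d2 := sum_not_and_le hp₂ hE₂
  rw [b1] at d1
  rw [b2] at d2
  rw [b3, b4] at hn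
  rw [b0] at hfail
  have htot : ∑ s, (if E₁ (c₀ (e₀ s)) (c₁ (e₀ s) (e₁ s)) s ∧ E₂ (c₀ (e₀ s)) (c₂ (e₀ s) (e₂ s)) s
      then 0 else pS s) ≤ 3 * η :=
    le_three_mul_of_le hfail d1 d2 hη hn
  obtain ⟨E, hE⟩ : ∃ E : (Fin n → X) → Prop, ∀ s, E s ↔
      E₁ (c₀ (e₀ s)) (c₁ (e₀ s) (e₁ s)) s ∧ E₂ (c₀ (e₀ s)) (c₂ (e₀ s) (e₂ s)) s :=
    ⟨_, fun _ => Iff.rfl⟩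
  have hfin : (∑ s, if E s then 0 else pS s) + η ≤ ε := by
    rw [Finset.sum_congr rfl fun s _ => if_congr (hE s) rfl rfl]
    linarith
  let e : (Fin n → X) → Msg R₀ n × Msg R₁ n × Msg R₂ n := fun s => (e₀ s, e₁ s, e₂ s)
  let D₁ : (Fin n → Y₁) → Msg R₀ n → Msg R₁ n → Prop := fun y m₀ m₁ =>
    Accepts (law q U₀₁) (law q srcY₁) g₁ r₁ (fun i => (c₀ m₀ i, c₁ m₀ m₁ i)) y
  let D₂ : (Fin n → Y₂) → Msg R₀ n → Msg R₂ n → Prop := fun y m₀ m₂ =>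
    Accepts (law q U₀₂) (law q srcY₂) g₂ r₂ (fun i => (c₀ m₀ i, c₂ m₀ m₂ i)) y
  refine ⟨detCode e D₁ D₂, ?_, ?_, ?_, ?_⟩
  · rw [typeI₁_detCode e D₁ D₂ hV]
    refine (sum_mul_le_sum_add hpS hη.le E (fun s => ?_) fun s hs => ((hE₁ _ _ _).1 ((hE s).1 hs).1).2).trans hfin
    rw [← sum_prod_chan₁ hV s]
    refine Finset.sum_le_sum fun y _ => ?_
    have := Finset.prod_nonneg fun i (_ : i ∈ Finset.univ) => hW₁ (s i) (y i)
    split_ifs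
    · exact this
    · exact le_rfl
  · rw [typeI₂_detCode e D₁ D₂ hV]
    refine (sum_mul_le_sum_add hpS hη.le E (fun s => ?_) fun s hs => ((hE₂ _ _ _).1 ((hE s).1 hs).2).2).trans hfin
    rw [← sum_prod_chan₂ hV s]
    refine Finset.sum_le_sum fun y _ => ?_
    have := Finset.prod_nonneg fun i (_ : i ∈ Finset.univ) => hW₂ (s i) (y i)
    split_ifs
    · exact this
    · exact le_rfl
  · refine typeII₁_detCode_le e D₁ D₂ hP hV fun m₀ m₁ => ?_
    rw [← hq.law_srcY₁ hV]
    exact sum_accepts_le (fun _ _ => law_nonneg hq.1.1 _ _)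
      (fun u => (law_eq_sum_fst q U₀₁ srcY₁ u).symm) r₁ _
  · refine typeII₂_detCode_le e D₁ D₂ hP hV fun m₀ m₂ => ?_
    rw [← hq.law_srcY₂ hV]
    exact sum_accepts_le (fun _ _ => law_nonneg hq.1.1 _ _)
      (fun u => (law_eq_sum_fst q U₀₂ srcY₂ u).symm) r₂ _

end Achievability

/-! ### From codes to the exponents region. -/

open AuxSpace

lemma neg_le_inv_mul_elog_of_le {β c : ℝ} {n : ℕ} (hn : 0 < n) (hβ : 0 ≤ β)
    (h : β ≤ 2 ^ (-((n : ℝ) * c))) :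
    ((1 / (n : ℝ) : ℝ) : EReal) * elog₂ β ≤ ((-c : ℝ) : EReal) := by
  have hn' : (0 : ℝ) < n := Nat.cast_pos.2 hn
  rcases hβ.eq_or_lt with rfl | hβ
  · rw [elog₂, if_pos rfl, EReal.coe_mul_bot_of_pos (by positivity)]
    exact bot_le
  · rw [elog₂, if_neg hβ.ne', ← EReal.coe_mul, EReal.coe_le_coe_iff]
    have h1 : Real.logb 2 β ≤ -((n : ℝ) * c) := by
      rwa [Real.logb_le_iff_le_rpow (by norm_num) hβ]
    calc 1 / (n : ℝ) * Real.logb 2 β ≤ 1 / (n : ℝ) * -((n : ℝ) * c) := by gcongr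
      _ = -c := by field_simp

lemma le_exponent {β : ℕ → ℝ} {c : ℝ} (hβ : ∀ n, 0 ≤ β n)
    (h : ∀ᶠ n : ℕ in atTop, β n ≤ 2 ^ (-((n : ℝ) * c))) : (c : EReal) ≤ exponent β := by
  have h1 : limsup (fun n : ℕ => ((1 / (n : ℝ) : ℝ) : EReal) * elog₂ (β n)) atTop ≤
      ((-c : ℝ) : EReal) := by
    refine limsup_le_of_le (by isBoundedDefault) ?_
    filter_upwards [h, eventually_gt_atTop 0] with n hn h0
    exact neg_le_inv_mul_elog_of_le h0 (hβ n) hn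
  rw [exponent, EReal.le_neg]
  simpa using h1

lemma prob_le_one {Ω : Type*} [Fintype Ω] {p : Ω → ℝ} (hp : p ∈ stdSimplex ℝ Ω) (E : Set Ω) :
    prob p E ≤ 1 :=
  (Finset.sum_le_sum fun ω _ => Set.indicator_le_self' (fun _ _ => hp.1 ω) ω).trans_eq hp.2

/-- Exponent 0 is free because β ≤ 1. This allows thresholds r₁, r₂ that are negative, although
achievable pairs must be nonnegative. -/
lemma max_zero_le_exponent {β : ℕ → ℝ} {c : ℝ} (hβ : ∀ n, 0 ≤ β n) (hβ1 : ∀ n, β n ≤ 1)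
    (h : ∀ᶠ n : ℕ in atTop, β n ≤ 2 ^ (-((n : ℝ) * c))) :
    ((max 0 c : ℝ) : EReal) ≤ exponent β := by
  rcases le_total 0 c with hc | hc
  · rw [max_eq_right hc]; exact le_exponent hβ h
  · rw [max_eq_left hc]
    exact le_exponent hβ (Eventually.of_forall fun n => by simpa using hβ1 n)

section Achievability

variable {X Y₁ Y₂ : Type*} [Fintype X] [Fintype Y₁] [Fintype Y₂] {R₀ R₁ R₂ : ℝ}
  {P : X × Y₁ × Y₂ → ℝ} {k₀ k₁ k₂ : ℕ} {q : AuxSpace k₀ k₁ k₂ X Y₁ Y₂ → ℝ}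

/-- A code whose receivers always accept the null hypothesis makes no error of the first kind. -/
lemma exists_code_typeI_eq_zero (P : X × Y₁ × Y₂ → ℝ) (R₀ R₁ R₂ : ℝ) (n : ℕ) :
    ∃ c : Code X Y₁ Y₂ R₀ R₁ R₂ n, c.typeI₁ P = 0 ∧ c.typeI₂ P = 0 := by
  refine ⟨detCode (fun _ => (0, 0, 0)) (fun _ _ _ => True) (fun _ _ _ => True), ?_, ?_⟩
  · simp [Code.typeI₁, prob, Code.decision₁, detCode]
  · simp [Code.typeI₂, prob, Code.decision₂, detCode]

lemma IsAuxLaw.epsAchievable (hP : P ∈ stdSimplex ℝ (X × Y₁ × Y₂)) (hq : IsAuxLaw P q)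
    (h0 : mutualInfo q U₀ srcX < R₀ ∨ mutualInfo q U₀ srcX ≤ 0)
    (h1 : condMutualInfo q U₁ srcX U₀ < R₁ ∨ condMutualInfo q U₁ srcX U₀ ≤ 0)
    (h2 : condMutualInfo q U₂ srcX U₀ < R₂ ∨ condMutualInfo q U₂ srcX U₀ ≤ 0) {r₁ r₂ : ℝ}
    (hr₁ : r₁ < mutualInfo q (fun ω => (U₀ ω, U₁ ω)) srcY₁)
    (hr₂ : r₂ < mutualInfo q (fun ω => (U₀ ω, U₂ ω)) srcY₂) {ε : ℝ} (hε : 0 < ε) :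
    EpsAchievable P R₀ R₁ R₂ ε (max 0 r₁) (max 0 r₂) := by
  -- Good codes exist only for large n, whereas the type-I constraint holds for every n. Elsewhere
  -- the code that always accepts is used; it has no type-I error.
  have hex : ∀ n, ∃ c : Code X Y₁ Y₂ R₀ R₁ R₂ n, (c.typeI₁ P ≤ ε ∧ c.typeI₂ P ≤ ε) ∧
      ((∃ c : Code X Y₁ Y₂ R₀ R₁ R₂ n, c.typeI₁ P ≤ ε ∧ c.typeI₂ P ≤ ε ∧
        c.typeII₁ P ≤ 2 ^ (-((n : ℝ) * r₁)) ∧ c.typeII₂ P ≤ 2 ^ (-((n : ℝ) * r₂))) →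
        c.typeII₁ P ≤ 2 ^ (-((n : ℝ) * r₁)) ∧ c.typeII₂ P ≤ 2 ^ (-((n : ℝ) * r₂))) := by
    intro n
    by_cases h : ∃ c : Code X Y₁ Y₂ R₀ R₁ R₂ n, c.typeI₁ P ≤ ε ∧ c.typeI₂ P ≤ ε ∧
        c.typeII₁ P ≤ 2 ^ (-((n : ℝ) * r₁)) ∧ c.typeII₂ P ≤ 2 ^ (-((n : ℝ) * r₂))
    · obtain ⟨c, hc₁, hc₂, hc⟩ := h
      exact ⟨c, ⟨hc₁, hc₂⟩, fun _ => hc⟩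
    · obtain ⟨c, hc₁, hc₂⟩ := exists_code_typeI_eq_zero P R₀ R₁ R₂ n
      exact ⟨c, ⟨hc₁.trans_le hε.le, hc₂.trans_le hε.le⟩, fun h' => absurd h' h⟩
  choose c hc hc' using hex
  have hev := eventually_exists_code hP hq h0 h1 h2 hr₁ hr₂ hε
  have hm := fun n => outcomeLaw_mem_stdSimplex (c n) (altLaw_mem_stdSimplex hP)
  exact ⟨c, fun n _ => hc n,
    max_zero_le_exponent (fun n => prob_nonneg (hm n).1 _) (fun n => prob_le_one (hm n) _)
      (hev.mono fun n h => (hc' n h).1),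
    max_zero_le_exponent (fun n => prob_nonneg (hm n).1 _) (fun n => prob_le_one (hm n) _)
      (hev.mono fun n h => (hc' n h).2)⟩

/-- Scaling by 1 - l strictly lowers a positive information, and leaves a nonpositive one
nonpositive: the dichotomy demanded by covering. -/
lemma scaled_lt_or_nonpos {I R l : ℝ} (hl0 : 0 < l) (hl1 : l < 1) (h : I ≤ R) :
    (1 - l) * I < R ∨ (1 - l) * I ≤ 0 := by
  rcases le_or_gt I 0 with hI | hI
  · right; nlinarith
  · left; nlinarith

/-- Time sharing with trivial auxiliary variables scales all informations by `1 - l`. -/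
lemma IsAuxLaw.exists_scaled (hP : P ∈ stdSimplex ℝ (X × Y₁ × Y₂)) (hq : IsAuxLaw P q) {l : ℝ}
    (hl0 : 0 ≤ l) (hl1 : l ≤ 1) :
    ∃ (k₀' k₁' k₂' : ℕ) (q' : AuxSpace k₀' k₁' k₂' X Y₁ Y₂ → ℝ), IsAuxLaw P q' ∧
      mutualInfo q' U₀ srcX = (1 - l) * mutualInfo q U₀ srcX ∧
      condMutualInfo q' U₁ srcX U₀ = (1 - l) * condMutualInfo q U₁ srcX U₀ ∧
      condMutualInfo q' U₂ srcX U₀ = (1 - l) * condMutualInfo q U₂ srcX U₀ ∧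
      mutualInfo q' (fun ω => (U₀ ω, U₁ ω)) srcY₁ =
        (1 - l) * mutualInfo q (fun ω => (U₀ ω, U₁ ω)) srcY₁ ∧
      mutualInfo q' (fun ω => (U₀ ω, U₂ ω)) srcY₂ =
        (1 - l) * mutualInfo q (fun ω => (U₀ ω, U₂ ω)) srcY₂ := by
  obtain ⟨V, hV⟩ := exists_isChannelOf hP
  have hPX : lawX P ∈ stdSimplex ℝ X := law_mem_stdSimplex hP _
  obtain ⟨z, hz, hz1, h0, h1, h2, h3, h4⟩ := hq.exists_entropyVector hV
  -- The vector of constant auxiliary variables has all informations zero, so mixing it in with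
  -- weight l multiplies each affine information by 1 - l.
  have hmem := convex_convexHull ℝ (layer (chan₁ V) (chan₂ V)) hz
    (trivial_mem_entropyRegion (chan₁ V) (chan₂ V) hPX) (sub_nonneg.2 hl1) hl0
    (sub_add_cancel 1 l)
  obtain ⟨k₀', k₁', k₂', q', hq', g0, g1, g2, g3, g4⟩ := exists_isAuxLaw hV hmem (by
    simp only [Prod.fst_add, Prod.smul_fst, hz1, ← add_smul, sub_add_cancel, one_smul])
  simp only [Prod.fst_add, Prod.snd_add, Prod.smul_fst, Prod.smul_snd, smul_eq_mul] at g0 g1 g2 g3 g4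
  refine ⟨k₀', k₁', k₂', q', hq', ?_, ?_, ?_, ?_, ?_⟩
  · rw [g0, h0]; ring
  · rw [g1, h1]; ring
  · rw [g2, h2]; ring
  · rw [g3, h3]; ring
  · rw [g4, h4]; ring

/-- The direct part. -/
theorem IsAuxLaw.mem_exponentsRegion (hP : P ∈ stdSimplex ℝ (X × Y₁ × Y₂)) (hq : IsAuxLaw P q)
    (h0 : mutualInfo q U₀ srcX ≤ R₀)
    (h1 : condMutualInfo q U₁ srcX U₀ ≤ R₁) (h2 : condMutualInfo q U₂ srcX U₀ ≤ R₂) {θ : ℝ × ℝ}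
    (hθ₁ : 0 ≤ θ.1) (hθ₂ : 0 ≤ θ.2) (h3 : θ.1 ≤ mutualInfo q (fun ω => (U₀ ω, U₁ ω)) srcY₁)
    (h4 : θ.2 ≤ mutualInfo q (fun ω => (U₀ ω, U₂ ω)) srcY₂) :
    θ ∈ exponentsRegion P R₀ R₁ R₂ := by
  -- Subtracting l puts the exponents strictly below the scaled informations, as the test requires;
  -- the maximum with 0 restores nonnegativity.
  have hlim : Tendsto (fun l : ℝ => (max 0 ((1 - l) * θ.1 - l), max 0 ((1 - l) * θ.2 - l)))
      (nhdsWithin 0 (Set.Ioi 0)) (nhds θ) := by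
    have hc : Continuous fun l : ℝ =>
        (max 0 ((1 - l) * θ.1 - l), max 0 ((1 - l) * θ.2 - l)) := by fun_prop
    have h := (hc.tendsto 0).mono_left (nhdsWithin_le_nhds (s := Set.Ioi 0))
    simpa [hθ₁, hθ₂] using h
  refine mem_closure_of_tendsto hlim ?_
  filter_upwards [Ioo_mem_nhdsGT (zero_lt_one (α := ℝ))] with l hl
  refine ⟨le_max_left _ _, le_max_left _ _, fun ε hε _ => ?_⟩
  obtain ⟨k₀', k₁', k₂', q', hq', g0, g1, g2, g3, g4⟩ := hq.exists_scaled hP hl.1.le hl.2.le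
  have hl' : 0 ≤ 1 - l := sub_nonneg.2 hl.2.le
  refine hq'.epsAchievable hP ?_ ?_ ?_ ?_ ?_ hε
  · rw [g0]; exact scaled_lt_or_nonpos hl.1 hl.2 h0
  · rw [g1]; exact scaled_lt_or_nonpos hl.1 hl.2 h1
  · rw [g2]; exact scaled_lt_or_nonpos hl.1 hl.2 h2
  · rw [g3]; linarith [mul_le_mul_of_nonneg_left h3 hl', hl.1]
  · rw [g4]; linarith [mul_le_mul_of_nonneg_left h4 hl', hl.1]

end Achievability

end GrayWyner

open GrayWyner GrayWyner.AuxSpace in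
theorem theorem1 {X Y₁ Y₂ : Type*} [Fintype X] [Fintype Y₁] [Fintype Y₂]
    (P : X × Y₁ × Y₂ → ℝ) (hP : P ∈ stdSimplex ℝ (X × Y₁ × Y₂))
    (R₀ R₁ R₂ : ℝ) (hR₀ : 0 ≤ R₀) (hR₁ : 0 ≤ R₁) (hR₂ : 0 ≤ R₂) :
    exponentsRegion P R₀ R₁ R₂ =
      {θ : ℝ × ℝ | 0 ≤ θ.1 ∧ 0 ≤ θ.2 ∧
        ∃ (k₀ k₁ k₂ : ℕ) (q : AuxSpace k₀ k₁ k₂ X Y₁ Y₂ → ℝ),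
          q ∈ stdSimplex ℝ (AuxSpace k₀ k₁ k₂ X Y₁ Y₂) ∧
          law q (fun ω => (srcX ω, srcY₁ ω, srcY₂ ω)) = P ∧
          IsMarkovChain q (fun ω => (U₀ ω, U₁ ω, U₂ ω)) srcX (fun ω => (srcY₁ ω, srcY₂ ω)) ∧
          mutualInfo q U₀ srcX ≤ R₀ ∧
          condMutualInfo q U₁ srcX U₀ ≤ R₁ ∧
          condMutualInfo q U₂ srcX U₀ ≤ R₂ ∧
          θ.1 ≤ mutualInfo q (fun ω => (U₀ ω, U₁ ω)) srcY₁ ∧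
          θ.2 ≤ mutualInfo q (fun ω => (U₀ ω, U₂ ω)) srcY₂} := by
  obtain ⟨V, hV⟩ := exists_isChannelOf hP
  ext θ
  constructor
  · intro hθ
    obtain ⟨h₁, h₂⟩ := nonneg_of_mem_exponentsRegion hθ
    obtain ⟨z, hz, hzP, e0, e1, e2, e3, e4⟩ :=
      exists_entropyVector_of_mem_exponentsRegion hP hV hR₀ hR₁ hR₂ hθ
    obtain ⟨k₀, k₁, k₂, q, ⟨hq, hlaw, hM⟩, g0, g1, g2, g3, g4⟩ := exists_isAuxLaw hV hz hzP
    exact ⟨h₁, h₂, k₀, k₁, k₂, q, hq, hlaw, hM, g0.trans_le e0, g1.trans_le e1, g2.trans_le e2,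
      e3.trans_eq g3.symm, e4.trans_eq g4.symm⟩
  · rintro ⟨h₁, h₂, k₀, k₁, k₂, q, hq, hlaw, hM, e0, e1, e2, e3, e4⟩
    exact IsAuxLaw.mem_exponentsRegion hP ⟨hq, hlaw, hM⟩ e0 e1 e2 h₁ h₂ e3 e4
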